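/- \textbf{Setting.} Scalars are real or complex. Transmitter $i\in\{1,2\}$ has $M_i$ antennas and a unitary precoder $V_i=[V_i^L\;V_i^J]$, where $V_i^J$ has $J_i$ columns and $V_i^L$ has $L_i=M_i-J_i$ columns; put $N_E=J_1+J_2$. In each channel use it sends $X_i=V_i^Ls_i+V_i^Jr_i$, where $s_i$ is the legitimate signal and the jamming signal $r_i$ is white Gaussian (circularly symmetric in the complex case) of total power $\alpha P$ (no jamming if $J_i=0$), with $0<\alpha<1$ fixed, independent over time, of the other transmitter's jamming and of everything else. The power constraint is $\mathrm E\|X_i\|^2\le P$, jamming included, on average over the block. An eavesdropper with $m\le N_E$ antennas receives $Z=G_1X_1+G_2X_2+n$, where $n$ is white Gaussian noise of fixed variance $\sigma^2>0$ and the entries of $G_1,G_2$ are i.i.d. over entries and time, independent of the signals and the noise, with an atomless law $\nu$ of finite variance. The eavesdropper may or may not know the realizations of its own channel matrices; if it does, read $(Z,G_1,G_2)$ for $Z$ below. Logarithms are to base 2. For an eavesdropper $e$ let $\bar R_e(P)=\sup\frac1n I(s_1^n,s_2^n;Z^n)$, over all $n\ge1$ and all laws of $(s_1^n,s_2^n)$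 that meet the power constraint, and $R_e(P)=\sup\frac1n I(W_1,W_2;Z^n)$, over all $n\ge1$, all independent uniformly distributed messages $W_1,W_2$ in finite non-empty sets and all pairs of stochastic encoders $W_i\mapsto s_i^n$, randomized independently of each other, that meet the power constraint. \textbf{Proposition 1.} (1) If $\sup_{c}\mathrm E_{g\sim\nu}\log^+\frac1{|g-c|}<\infty$ (for instance, if $\nu$ has a bounded density), then there is a constant $C<\infty$ with $\bar R_e(P)\le C$ for all $P\ge0$ and all eavesdroppers $e$ with at most $N_E$ antennas. (2) For every eavesdropper with at most $N_E$ antennas, $\bar R_e(P)/(\tfrac12\log P)\to0$ and $R_e(P)/(\tfrac12\log P)\to0$ as $P\to\infty$; that is, it gets zero degrees of freedom of the legitimate signals and messages. (3) Fix $P\ge 0$, any family of eavesdroppers $j$ with at most $N_E$ antennas each, input laws $p_1,p_2$ of $s_1,s_2$ (independent) that meet the power constraint, message rates $R_i\ge0$ and randomization rates $R^l_i\ge0$ such that $I(s_1,s_2;Z_j)\le R^l_i$ for $i=1,2$ and every $j$. Draw all symbols of the codewords $s_i^n(w,v)$, $1\le w\le\lceil2^{nR_i}\rceil$, $1\le v\le\lceil2^{nR^l_i}\rceil$,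 independently from $p_i$; to send a uniformly distributed message $W_i$, independent of the other message, transmitter $i$ sends $s_i^n(W_i,v)$ with $v$ uniformly random (Wyner's stochastic encoder), the two choices of $v$ being independent. Then for every $\varepsilon>0$ the probability over the codebooks that $$\tfrac1nH(W_1,W_2\mid Z_j^n)\ge\tfrac1nH(W_1,W_2)-\varepsilon\quad\text{for all }j$$ tends to $1$ as $n\to\infty$. -/

import Mathlib

open MeasureTheory ProbabilityTheory Filter Topology InformationTheory
open scoped ENNReal NNReal Matrix

noncomputable section

namespace JammedMAC

/-! ### Information measures (in bits) -/

/-- Mutual information, in bits, between an input of law `μ` and the output of the channel `κ`: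
the divergence of the joint law from the product of the two marginals. -/
def mutualInfo {A B : Type*} [MeasurableSpace A] [MeasurableSpace B]
    (μ : Measure A) (κ : Kernel A B) : ℝ≥0∞ :=
  klDiv (μ ⊗ₘ κ) (μ.prod (κ ∘ₘ μ)) / ENNReal.ofReal (Real.log 2)

/-- Entropy, in bits, of a law on a finite set. -/
def entropy {W : Type*} [Fintype W] [MeasurableSpace W] (μ : Measure W) : ℝ :=
  (∑ w, Real.negMulLog (μ.real {w})) / Real.log 2

/-- Conditional entropy `H(W | O)`, in bits, of a variable `W` of law `μ` on a finite set given
the output `O` of the channel `κ` with input `W`: the mean entropy of the conditional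
probabilities `P(W = w | O)`. -/
def condEntropy {W O : Type*} [Fintype W] [MeasurableSpace W] [MeasurableSpace O]
    (μ : Measure W) (κ : Kernel W O) : ℝ :=
  (∫ x, ∑ w, Real.negMulLog
    (((μ ⊗ₘ κ)[(Prod.fst ⁻¹' {w}).indicator (fun _ => (1 : ℝ)) |
      MeasurableSpace.comap Prod.snd inferInstance]) x) ∂(μ ⊗ₘ κ)) / Real.log 2

/-! ### White Gaussian vectors -/

/-- Centred Gaussian law of variance `v` on the scalar field: the usual one on `ℝ`, the circularly
symmetric one on `ℂ` (where each of the two real coordinates has variance `v / 2`). -/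
def gaussianScalar (𝕜 : Type*) [RCLike 𝕜] (v : ℝ≥0) : Measure 𝕜 :=
  ((gaussianReal 0 (v / (Module.finrank ℝ 𝕜 : ℝ≥0))).prod
    (gaussianReal 0 (v / (Module.finrank ℝ 𝕜 : ℝ≥0)))).map
      (fun p : ℝ × ℝ => (p.1 : 𝕜) + (p.2 : 𝕜) * RCLike.I)

/-- `k` independent centred Gaussian entries of variance `v`. -/
def whiteGaussian (𝕜 : Type*) [RCLike 𝕜] (k : ℕ) (v : ℝ≥0) : Measure (Fin k → 𝕜) :=
  Measure.pi fun _ => gaussianScalar 𝕜 v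

/-! ### The system -/

/-- Two transmitters (indexed by `Fin 2`) that send a legitimate signal and a jamming signal over
fading links to eavesdroppers. The scalars are `ℝ` or `ℂ`. -/
structure System (𝕜 : Type*) [RCLike 𝕜] where
  /-- number of antennas of transmitter `i` -/
  M : Fin 2 → ℕ
  /-- number of legitimate streams of transmitter `i` -/
  L : Fin 2 → ℕ
  /-- number of jamming streams of transmitter `i` -/
  J : Fin 2 → ℕ
  /-- the precoder `[V^L V^J]` of transmitter `i` -/
  V : ∀ i, Matrix (Fin (M i)) (Fin (L i) ⊕ Fin (J i)) 𝕜
  V_mul_conjTranspose : ∀ i, V i * (V i)ᴴ = 1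
  V_conjTranspose_mul : ∀ i, (V i)ᴴ * V i = 1
  /-- fraction of the power spent on jamming -/
  α : ℝ≥0
  α_pos : 0 < α
  α_lt_one : α < 1
  /-- variance of the receiver noise at each eavesdropper antenna -/
  noiseVar : ℝ≥0
  noiseVar_pos : 0 < noiseVar
  /-- law of each channel coefficient towards an eavesdropper -/
  fading : Measure 𝕜
  fading_prob : IsProbabilityMeasure fading
  /-- the fading law is continuous -/
  fading_noAtoms : NullSingletonClass fading
  /-- the fading law has a mean and a variance -/
  fading_memLp : MemLp (fun g : 𝕜 => g) 2 fading

/-- An eavesdropper. As the channel coefficients towards all eavesdroppers have the same law, the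
law of what it observes is determined by its number of antennas and by whether or not it knows the
realizations of its own channel matrices. -/
structure Eavesdropper where
  antennas : ℕ
  knowsChannel : Bool

/-- `E log⁺ (1 / |g - c|)` is bounded uniformly in `c` (the value at the single point `g = c` is
irrelevant for a law without atoms). Laws with a bounded density satisfy this. -/
def LogRegular {𝕜 : Type*} [RCLike 𝕜] (ν : Measure 𝕜) : Prop :=
  ∃ B : ℝ≥0, ∀ c : 𝕜, ∫⁻ g, ENNReal.ofReal (-Real.log ‖g - c‖) ∂ν ≤ B

/-- Measurability of a map applied in each coordinate of a pair of blocks. -/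
theorem measurable_block {A B C : Type*} [MeasurableSpace A] [MeasurableSpace B]
    [MeasurableSpace C] {g : A → B → C} (hg : Measurable fun p : A × B => g p.1 p.2) (n : ℕ) :
    Measurable fun (p : (Fin n → A) × (Fin n → B)) (k : Fin n) => g (p.1 k) (p.2 k) := by
  refine measurable_pi_lambda _ fun k => ?_
  have h : Measurable fun p : (Fin n → A) × (Fin n → B) => (p.1 k, p.2 k) := by fun_prop
  exact hg.comp h

namespace System

variable {𝕜 : Type*} [RCLike 𝕜] (S : System 𝕜)

/-- Legitimate signals `(s₁, s₂)` in one channel use. -/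
abbrev Signal : Type _ := ∀ i, Fin (S.L i) → 𝕜

/-- Jamming signals `(r₁, r₂)` in one channel use. -/
abbrev Jam : Type _ := ∀ i, Fin (S.J i) → 𝕜

/-- Channel matrices `(G₁, G₂)` towards `m` antennas in one channel use. -/
abbrev Chan (m : ℕ) : Type _ := ∀ i, Fin m → Fin (S.M i) → 𝕜

/-- What an eavesdropper with `m` antennas gets in one channel use: the received vector, and its
channel matrices (blanked out by zero if it does not know them). -/
abbrev Obs (m : ℕ) : Type _ := (Fin m → 𝕜) × S.Chan m

/-- All the randomness of one channel use other than the legitimate signals: jamming signals,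
channel matrices, and noise. -/
abbrev Env (m : ℕ) : Type _ := S.Jam × S.Chan m × (Fin m → 𝕜)

/-- Channel input `X_i = V_i x_i`, where `x_i = [s_i; r_i]`. -/
def chanInput (i : Fin 2) (s : Fin (S.L i) → 𝕜) (r : Fin (S.J i) → 𝕜) : Fin (S.M i) → 𝕜 :=
  S.V i *ᵥ Sum.elim s r

/-- Law of the jamming signal of transmitter `i`: white Gaussian of total power `α P`. -/
def jamLaw (P : ℝ≥0) (i : Fin 2) : Measure (Fin (S.J i) → 𝕜) :=
  whiteGaussian 𝕜 (S.J i) (S.α * P / (S.J i : ℝ≥0))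

/-- Independent jamming signals, i.i.d. channel coefficients, and white Gaussian noise. -/
def envLaw (P : ℝ≥0) (m : ℕ) : Measure (S.Env m) :=
  (Measure.pi fun i => S.jamLaw P i).prod
    ((Measure.pi fun _ => Measure.pi fun _ => Measure.pi fun _ => S.fading).prod
      (whiteGaussian 𝕜 m S.noiseVar))

/-- Received vector `Z = G₁ X₁ + G₂ X₂ + n`. -/
def received {m : ℕ} (s : S.Signal) (ω : S.Env m) : Fin m → 𝕜 :=
  (∑ i, Matrix.of (ω.2.1 i) *ᵥ S.chanInput i (s i) (ω.1 i)) + ω.2.2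

/-- What the eavesdropper observes in one channel use. -/
def observe (e : Eavesdropper) (s : S.Signal) (ω : S.Env e.antennas) : S.Obs e.antennas :=
  (S.received s ω, if e.knowsChannel then ω.2.1 else 0)

instance (v : ℝ≥0) : IsProbabilityMeasure (gaussianScalar 𝕜 v) := by
  unfold gaussianScalar
  exact Measure.isProbabilityMeasure_map (by fun_prop)

instance (k : ℕ) (v : ℝ≥0) : IsProbabilityMeasure (whiteGaussian 𝕜 k v) := by
  unfold whiteGaussian
  infer_instance

instance (P : ℝ≥0) (i : Fin 2) : IsProbabilityMeasure (S.jamLaw P i) := by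
  unfold jamLaw
  infer_instance

instance : IsProbabilityMeasure S.fading := S.fading_prob

instance (P : ℝ≥0) (m : ℕ) : IsProbabilityMeasure (S.envLaw P m) := by
  unfold envLaw
  infer_instance

theorem measurable_observe (e : Eavesdropper) :
    Measurable fun p : S.Signal × S.Env e.antennas => S.observe e p.1 p.2 := by
  unfold observe
  refine Measurable.prodMk ?_ ?_
  · unfold received chanInput
    refine Measurable.add (Finset.measurable_fun_sum _ fun i _ => ?_) (by fun_prop)
    refine measurable_pi_lambda _ fun a => ?_
    simp only [Matrix.mulVec, dotProduct, Matrix.of_apply, Fintype.sum_sum_type, Sum.elim_inl,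
      Sum.elim_inr]
    fun_prop
  · split_ifs <;> fun_prop

/-- The channel to the eavesdropper in a single use, with input the legitimate signals. -/
def useKernel (P : ℝ≥0) (e : Eavesdropper) : Kernel S.Signal (S.Obs e.antennas) :=
  ((Kernel.id : Kernel S.Signal S.Signal) ×ₖ Kernel.const S.Signal (S.envLaw P e.antennas)).map
    fun p => S.observe e p.1 p.2

/-- The channel to the eavesdropper over `n` uses: jamming, channel matrices and noise are
independent from one use to the next. -/
def blockKernel (P : ℝ≥0) (e : Eavesdropper) (n : ℕ) :
    Kernel (Fin n → S.Signal) (Fin n → S.Obs e.antennas) :=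
  ((Kernel.id : Kernel (Fin n → S.Signal) (Fin n → S.Signal)) ×ₖ
    Kernel.const (Fin n → S.Signal) (Measure.pi fun _ : Fin n => S.envLaw P e.antennas)).map
    fun p k => S.observe e (p.1 k) (p.2 k)

instance (P : ℝ≥0) (e : Eavesdropper) : IsMarkovKernel (S.useKernel P e) :=
  Kernel.IsMarkovKernel.map _ (S.measurable_observe e)

theorem measurable_observe_block (e : Eavesdropper) (n : ℕ) :
    Measurable fun (p : (Fin n → S.Signal) × (Fin n → S.Env e.antennas)) (k : Fin n) =>
      S.observe e (p.1 k) (p.2 k) :=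
  measurable_block (S.measurable_observe e) n

instance (P : ℝ≥0) (e : Eavesdropper) (n : ℕ) : IsMarkovKernel (S.blockKernel P e n) :=
  Kernel.IsMarkovKernel.map _ (S.measurable_observe_block e n)

/-- Mean transmitted energy `E ‖X_i‖²` of transmitter `i` in one use, when it sends the legitimate
symbols `s` together with its jamming signal. -/
def energy (P : ℝ≥0) (i : Fin 2) (s : Fin (S.L i) → 𝕜) : ℝ≥0∞ :=
  ∫⁻ r, ENNReal.ofReal (∑ a, ‖S.chanInput i s r a‖ ^ 2) ∂(S.jamLaw P i)

/-- Power constraint on a (jointly distributed) block of legitimate signals: with the jamming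
included, each transmitter spends at most `P` per channel use on average over the block. -/
def PowerConstraint (P : ℝ≥0) {n : ℕ} (μ : Measure (Fin n → S.Signal)) : Prop :=
  ∀ i, ∑ k, ∫⁻ s, S.energy P i (s k i) ∂μ ≤ n * P

/-- Information rate of the eavesdropper about the legitimate signals,
`sup (1/n) I(s₁ⁿ, s₂ⁿ; Zⁿ)` over all block lengths and all laws of the legitimate signals that
obey the power constraint. -/
def signalRate (P : ℝ≥0) (e : Eavesdropper) : ℝ≥0∞ :=
  ⨆ (n : ℕ) (_ : 0 < n) (μ : Measure (Fin n → S.Signal)) (_ : IsProbabilityMeasure μ)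
    (_ : S.PowerConstraint P μ), mutualInfo μ (S.blockKernel P e n) / n

/-- Stochastic encoders with messages `w_i ∈ Fin (K i)`: transmitter `i` maps `w_i` to a random
block of legitimate symbols of law `f i (w_i)`, independently of the other transmitter. -/
def jointEncoder {n : ℕ} {K : Fin 2 → ℕ}
    (f : ∀ i, Fin (K i) → Measure (Fin n → Fin (S.L i) → 𝕜)) :
    Kernel (∀ i, Fin (K i)) (Fin n → S.Signal) :=
  Kernel.ofFunOfCountable fun w =>
    (Measure.pi fun i => f i (w i)).map fun x k i => x i k

/-- Law of independent uniformly distributed messages. -/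
def messageLaw (K : Fin 2 → ℕ) : Measure (∀ i, Fin (K i)) := uniformOn Set.univ

/-- Information rate of the eavesdropper about the legitimate messages,
`sup (1/n) I(W₁, W₂; Zⁿ)` over all block lengths, message sets and stochastic encoders that obey
the power constraint. -/
def messageRate (P : ℝ≥0) (e : Eavesdropper) : ℝ≥0∞ :=
  ⨆ (n : ℕ) (_ : 0 < n) (K : Fin 2 → ℕ) (_ : ∀ i, 0 < K i)
    (f : ∀ i, Fin (K i) → Measure (Fin n → Fin (S.L i) → 𝕜))
    (_ : ∀ i w, IsProbabilityMeasure (f i w))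
    (_ : S.PowerConstraint P (S.jointEncoder f ∘ₘ messageLaw K)),
    mutualInfo (messageLaw K) (S.blockKernel P e n ∘ₖ S.jointEncoder f) / n

/-- A rate, as a function of the power, carries zero degrees of freedom:
its ratio to `(1/2) log P` tends to zero. -/
def ZeroDoF (rate : ℝ≥0 → ℝ≥0∞) : Prop :=
  Tendsto (fun P : ℝ≥0 => rate P / ENNReal.ofReal (1 / 2 * Real.logb 2 P)) atTop (𝓝 0)

/-! ### Wyner codes -/

/-- Number `⌈2^(n R)⌉` of indices at rate `R` and block length `n`. -/
def size (n : ℕ) (R : ℝ) : ℕ := ⌈(2 : ℝ) ^ ((n : ℝ) * R)⌉₊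

/-- A pair of codebooks `s_i^n(w_i, v_i)`, where `w_i` indexes the bin (the message) and `v_i` the
codeword in the bin. -/
abbrev Codebook (n : ℕ) (K B : Fin 2 → ℕ) : Type _ :=
  ∀ i, Fin (K i) → Fin (B i) → Fin n → Fin (S.L i) → 𝕜

/-- Random coding: all symbols of all codewords of transmitter `i` are drawn independently
from `p i`. -/
def codebookLaw (p : ∀ i, Measure (Fin (S.L i) → 𝕜)) (n : ℕ) (K B : Fin 2 → ℕ) :
    Measure (S.Codebook n K B) :=
  Measure.pi fun i => Measure.pi fun _ => Measure.pi fun _ => Measure.pi fun _ => p i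

/-- The stochastic encoder of a Wyner code: to send the message `w`, transmitter `i` picks a
codeword uniformly at random from bin `w`. -/
def wynerEncoder {n : ℕ} {K B : Fin 2 → ℕ} (cb : S.Codebook n K B) (i : Fin 2) (w : Fin (K i)) :
    Measure (Fin n → Fin (S.L i) → 𝕜) :=
  (uniformOn (Set.univ : Set (Fin (B i)))).map (cb i w)

/-- The secrecy constraint at block length `n`, with slack `ε`, at one eavesdropper:
`(1/n) H(W₁, W₂ | Zⁿ) ≥ (1/n) H(W₁, W₂) - ε`. -/
def Secret (P : ℝ≥0) {n : ℕ} {K B : Fin 2 → ℕ} (cb : S.Codebook n K B) (ε : ℝ)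
    (e : Eavesdropper) : Prop :=
  entropy (messageLaw K) / n - ε ≤
    condEntropy (messageLaw K) (S.blockKernel P e n ∘ₖ S.jointEncoder (S.wynerEncoder cb)) / n

end System

end JammedMAC

end

/-!
All three parts are statements about Kullback-Leibler divergence in nats; `mutualInfo_le` turns a
bound on the divergence of the channel outputs from *any* reference law `Q` into a bound on mutual
information.

**Rates.** An eavesdropper with at most `J 0 + J 1` antennas is a degraded version of one with one
antenna per jamming stream that knows its channel (`degrade`). For that one the jamming streams
reach the antennas through a square matrix, `jamMatrix G`. When it is invertible, the legitimate
signals act like a shift of the Gaussian jamming signals (`exists_shift`). As the energies of the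
shift and of the jamming are both proportional to `P`, the output stays close in divergence to the
output for stretched jamming and no signal, up to a constant and a multiple of
`log (1 + amplification G)`. Here `amplification G` is bounded by a constant times a power of
`1 + gain G`, the squared channel norm plus one, over
`|det|^2`, where `det` is the determinant of the jamming matrix. The determinant is
multilinear in the rows of `G`, and its value at one particular choice of rows, built from the
columns of the jamming precoder, is one. Averaging over one coefficient at a time
(`Spread.pi`, `lintegral_multilinear_le`) shows that it almost surely does not vanish when the
fading has no atoms, and that its negative logarithm is integrable when the fading is `LogRegular`.
The second fact gives the bound of part (1) on the rate (`exists_signalRate_le`).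
Without regularity, the bound is only used on the event that the amplification is at most `k`; on
the complement, the mean divergence from stretched noise is at most a constant plus `N log (1 + P)`
(`klDiv_received_le`), and the probability of the complement tends to zero with `k`. Dividing by
`log P` gives zero degrees of freedom (`zeroDoF`). Bounds for one channel use extend to blocks
because divergence is subadditive over independent coordinates (`rates_le`).

**Secrecy.** The conditional entropy of the messages is their entropy minus the divergence between
the joint law of messages and observation and the product of its marginals (`condEntropy_eq`). It
is therefore enough to bound the mean, over random codebooks, of the divergence from the
memoryless output law `Qⁿ` of the output caused by a fixed pair of messages. The pair of codeword
indices is uniform on a rectangle, hence also uniform on a random cyclic diagonal whose length `b`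
is the smaller of the two bin sizes; by convexity it suffices to treat one diagonal
(`klDiv_comp_map_le_of_shift`), and along it the pairs of codewords are independent with law
`p 0 × p 1`. For `b` independent codewords the soft covering inequality
`lintegral_codeDivergence_le` bounds the mean divergence by `E log (1 + exp i / b)`, where `i` is
the information density of the block. As `i` is a sum of `n` independent terms of mean
`I(s₁, s₂; Z) ≤ (log b) / n`, the law of large numbers in `L¹` makes this `o(n)`
(`tendsto_lintegral_log_one_add_prod`), even when the rates equal the mutual information. Markov's
inequality finishes the proof for one eavesdropper; as only its number of antennas and its knowledge
of the channel matter, an arbitrary family reduces to finitely many.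
-/

namespace JammedMAC

/-! ### Inequalities for the Kullback-Leibler divergence -/

section Divergence

variable {A B : Type*} [MeasurableSpace A] [MeasurableSpace B]

theorem klDiv_withDensity (ν : Measure A) [IsFiniteMeasure ν] {f : A → ℝ≥0∞} (hf : Measurable f)
    [IsFiniteMeasure (ν.withDensity f)] :
    klDiv (ν.withDensity f) ν = ∫⁻ x, ENNReal.ofReal (klFun (f x).toReal) ∂ν := by
  rw [klDiv_eq_lintegral_klFun_of_ac (withDensity_absolutelyContinuous _ _)]
  refine lintegral_congr_ae ?_
  filter_upwards [Measure.rnDeriv_withDensity ν hf] with x hx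
  rw [hx]

/-- The conditional divergence is at most the mean of any measurable bound on the divergences of
the fibres. -/
theorem klDiv_compProd_le [MeasurableSpace.CountablyGenerated B] {μ : Measure A}
    [IsFiniteMeasure μ] {κ η : Kernel A B} [IsMarkovKernel κ] [IsMarkovKernel η] {F : A → ℝ≥0∞}
    (hF : AEMeasurable F μ) (h : ∀ᵐ x ∂μ, klDiv (κ x) (η x) ≤ F x) :
    klDiv (μ ⊗ₘ κ) (μ ⊗ₘ η) ≤ ∫⁻ x, F x ∂μ := by
  by_cases htop : ∫⁻ x, F x ∂μ = ∞
  · rw [htop]; exact le_top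
  have hac : ∀ᵐ x ∂μ, κ x ≪ η x := by
    filter_upwards [h, ae_lt_top' hF htop] with x hx hx'
    exact (klDiv_ne_top_iff.1 (hx.trans_lt hx').ne).1
  have heq : κ =ᵐ[μ] η.withDensity (κ.rnDeriv η) := by
    filter_upwards [hac] with a ha using (Kernel.withDensity_rnDeriv_eq ha).symm
  have hm : Measurable fun p : A × B => κ.rnDeriv η p.1 p.2 := Kernel.measurable_rnDeriv κ η
  have hcomp : μ ⊗ₘ κ = (μ ⊗ₘ η).withDensity fun p => κ.rnDeriv η p.1 p.2 := by
    rw [Measure.compProd_congr heq, Measure.compProd_withDensity hm]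
  have : IsFiniteMeasure ((μ ⊗ₘ η).withDensity fun p => κ.rnDeriv η p.1 p.2) := by
    rw [← hcomp]; infer_instance
  rw [hcomp, klDiv_withDensity _ hm, Measure.lintegral_compProd (by fun_prop)]
  refine lintegral_mono_ae ?_
  filter_upwards [h, hac] with x hx hxac
  refine le_of_eq_of_le ?_ hx
  rw [klDiv_eq_lintegral_klFun_of_ac hxac]
  refine lintegral_congr_ae ?_
  filter_upwards [Kernel.rnDeriv_eq_rnDeriv_measure (κ := κ) (η := η) (a := x)] with y hy
  rw [hy]

theorem klDiv_map_equiv (e : A ≃ᵐ B) (μ ν : Measure A) [IsFiniteMeasure μ] [IsFiniteMeasure ν] :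
    klDiv (μ.map e) (ν.map e) = klDiv μ ν := by
  refine le_antisymm (klDiv_map_le _ _ e.measurable) ?_
  have h := klDiv_map_le (μ.map e) (ν.map e) e.symm.measurable
  rwa [MeasurableEquiv.map_symm_map, MeasurableEquiv.map_symm_map] at h

theorem klDiv_prod_le [MeasurableSpace.CountablyGenerated B] (μ μ' : Measure A) (ν ν' : Measure B)
    [IsProbabilityMeasure μ] [IsProbabilityMeasure μ'] [IsProbabilityMeasure ν]
    [IsProbabilityMeasure ν'] :
    klDiv (μ.prod ν) (μ'.prod ν') ≤ klDiv μ μ' + klDiv ν ν' := by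
  rw [← Measure.compProd_const, ← Measure.compProd_const, klDiv_compProd_eq_add]
  gcongr
  refine (klDiv_compProd_le (F := fun _ => klDiv ν ν') aemeasurable_const (by simp)).trans ?_
  simp

/-- The divergence is subadditive over independent coordinates. -/
theorem klDiv_pi_le {ι : Type*} [Fintype ι] {X : ι → Type*} [∀ i, MeasurableSpace (X i)]
    [∀ i, MeasurableSpace.CountablyGenerated (X i)] (μ ν : ∀ i, Measure (X i))
    [∀ i, IsProbabilityMeasure (μ i)] [∀ i, IsProbabilityMeasure (ν i)] :
    klDiv (Measure.pi μ) (Measure.pi ν) ≤ ∑ i, klDiv (μ i) (ν i) := by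
  revert X
  refine Fintype.induction_empty_option (P := fun ι [Fintype ι] =>
    ∀ {X : ι → Type _} [∀ i, MeasurableSpace (X i)]
      [∀ i, MeasurableSpace.CountablyGenerated (X i)] (μ ν : ∀ i, Measure (X i))
      [∀ i, IsProbabilityMeasure (μ i)] [∀ i, IsProbabilityMeasure (ν i)],
      klDiv (Measure.pi μ) (Measure.pi ν) ≤ ∑ i, klDiv (μ i) (ν i)) ?_ ?_ ?_ ι
  · intro α β _ e ih X _ _ μ ν _ _
    have : Fintype α := Fintype.ofEquiv β e.symm
    rw [← Measure.pi_map_piCongrLeft e μ, ← Measure.pi_map_piCongrLeft e ν, klDiv_map_equiv,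
      ← e.sum_comp]
    convert ih (fun i => μ (e i)) (fun i => ν (e i))
  · intro X _ _ μ ν _ _
    have : μ = ν := Subsingleton.elim _ _
    simp [this]
  · intro α _ ih X _ _ μ ν _ _
    rw [← Measure.pi_map_piOptionEquivProd μ, ← Measure.pi_map_piOptionEquivProd ν, klDiv_map_equiv,
      Fintype.sum_option, add_comm]
    exact (klDiv_prod_le _ _ _ _).trans (by gcongr; exact ih _ _)

theorem klDiv_compProd_prod_le [MeasurableSpace.CountablyGenerated B] {μ : Measure A}
    [IsFiniteMeasure μ] {κ : Kernel A B} [IsMarkovKernel κ] {Q : Measure B}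
    [IsProbabilityMeasure Q] {F : A → ℝ≥0∞} (hF : AEMeasurable F μ)
    (h : ∀ᵐ x ∂μ, klDiv (κ x) Q ≤ F x) :
    klDiv (μ ⊗ₘ κ) (μ.prod Q) ≤ ∫⁻ x, F x ∂μ := by
  rw [← Measure.compProd_const]
  exact klDiv_compProd_le hF (by simpa using h)

/-- Convexity of the divergence in its first argument. -/
theorem klDiv_comp_le [MeasurableSpace.CountablyGenerated B] {μ : Measure A}
    [IsProbabilityMeasure μ] {κ : Kernel A B} [IsMarkovKernel κ] {Q : Measure B}
    [IsProbabilityMeasure Q] {F : A → ℝ≥0∞} (hF : AEMeasurable F μ)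
    (h : ∀ᵐ x ∂μ, klDiv (κ x) Q ≤ F x) :
    klDiv (κ ∘ₘ μ) Q ≤ ∫⁻ x, F x ∂μ := by
  refine le_trans ?_ (klDiv_compProd_prod_le hF h)
  have h1 := klDiv_map_le (μ ⊗ₘ κ) (μ.prod Q) (g := Prod.snd) measurable_snd
  rwa [← Measure.snd, Measure.snd_compProd, ← Measure.snd, Measure.snd_prod] at h1

/-- The output marginal minimises the divergence of a joint law from a product law with the given
input marginal. -/
theorem klDiv_prod_comp_le [StandardBorelSpace A] [Nonempty A] (μ : Measure A)
    [IsProbabilityMeasure μ] (κ : Kernel A B) [IsMarkovKernel κ] (Q : Measure B)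
    [IsProbabilityMeasure Q] :
    klDiv (μ ⊗ₘ κ) (μ.prod (κ ∘ₘ μ)) ≤ klDiv (μ ⊗ₘ κ) (μ.prod Q) := by
  have hswap : ∀ R : Measure B, IsProbabilityMeasure R →
      klDiv (μ ⊗ₘ κ) (μ.prod R) = klDiv ((κ ∘ₘ μ) ⊗ₘ κ†μ) (R ⊗ₘ Kernel.const B μ) := by
    intro R _
    rw [← klDiv_map_equiv MeasurableEquiv.prodComm]
    congr 1
    · exact compProd_posterior_eq_map_swap.symm
    · rw [Measure.compProd_const]; exact Measure.prod_swap
  rw [hswap _ inferInstance, hswap _ inferInstance, klDiv_compProd_eq_add (κ ∘ₘ μ) Q]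
  exact le_add_self

/-- An upper bound on the mutual information in terms of any reference output law `Q`. -/
theorem mutualInfo_le [StandardBorelSpace A] [Nonempty A] [MeasurableSpace.CountablyGenerated B]
    (μ : Measure A) [IsProbabilityMeasure μ] (κ : Kernel A B) [IsMarkovKernel κ] (Q : Measure B)
    [IsProbabilityMeasure Q] {F : A → ℝ≥0∞} (hF : AEMeasurable F μ)
    (h : ∀ᵐ x ∂μ, klDiv (κ x) Q ≤ F x) :
    mutualInfo μ κ ≤ (∫⁻ x, F x ∂μ) / ENNReal.ofReal (Real.log 2) := by
  unfold mutualInfo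
  gcongr
  exact (klDiv_prod_comp_le μ κ Q).trans (klDiv_compProd_prod_le hF h)

/-- The divergence between the laws of two functions of `(g, x)`, both of which reveal `g`, is at
most the mean over `g` of the divergence between the laws for fixed `g`. -/
theorem klDiv_map_prod_le {C : Type*} [MeasurableSpace C] [MeasurableSpace.CountablyGenerated C]
    (l : Measure A) [IsProbabilityMeasure l] (ρ : Measure B) [IsProbabilityMeasure ρ]
    {φ ψ : A → B → C} (hφ : Measurable (Function.uncurry φ)) (hψ : Measurable (Function.uncurry ψ))
    {F : A → ℝ≥0∞} (hF : AEMeasurable F l)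
    (h : ∀ᵐ g ∂l, klDiv (ρ.map (φ g)) (ρ.map (ψ g)) ≤ F g) :
    klDiv ((l.prod ρ).map fun p => (p.1, φ p.1 p.2)) ((l.prod ρ).map fun p => (p.1, ψ p.1 p.2)) ≤
      ∫⁻ g, F g ∂l := by
  have key : ∀ χ : A → B → C, Measurable (Function.uncurry χ) →
      ∃ κ : Kernel A C, IsMarkovKernel κ ∧ (∀ g, κ g = ρ.map (χ g)) ∧
        (l.prod ρ).map (fun p => (p.1, χ p.1 p.2)) = l ⊗ₘ κ := by
    intro χ hχ
    have hκ : ∀ g, ((Kernel.id ×ₖ Kernel.const A ρ).map (Function.uncurry χ)) g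
        = ρ.map (χ g) := by
      intro g
      rw [Kernel.map_apply _ hχ, Kernel.prod_apply, Kernel.id_apply, Kernel.const_apply,
        Measure.dirac_prod, Measure.map_map hχ (by fun_prop)]
      rfl
    refine ⟨(Kernel.id ×ₖ Kernel.const A ρ).map (Function.uncurry χ),
      Kernel.IsMarkovKernel.map _ hχ, hκ, ?_⟩
    have hm : Measurable fun p : A × B => (p.1, χ p.1 p.2) := measurable_fst.prodMk hχ
    ext s hs
    rw [Measure.map_apply hm hs, Measure.prod_apply (hm hs), Measure.compProd_apply hs]
    refine lintegral_congr fun g => ?_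
    have hχg : Measurable (χ g) := hχ.comp measurable_prodMk_left
    rw [hκ, Measure.map_apply hχg (measurable_prodMk_left hs)]
    rfl
  obtain ⟨κ, _, hκ, h1⟩ := key φ hφ
  obtain ⟨η, _, hη, h2⟩ := key ψ hψ
  rw [h1, h2]
  refine klDiv_compProd_le hF ?_
  filter_upwards [h] with g hg
  rwa [hκ, hη]

end Divergence

/-! ### Divergence of Gaussian laws -/

section Gaussian

theorem integral_sq_gaussianReal (m : ℝ) (v : ℝ≥0) :
    ∫ x, x ^ 2 ∂gaussianReal m v = v + m ^ 2 := by
  have h := variance_eq_sub (memLp_id_gaussianReal (μ := m) (v := v) 2)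
  rw [variance_id_gaussianReal] at h
  have h2 : ∫ x, id x ∂gaussianReal m v = m := integral_id_gaussianReal
  rw [h2] at h
  have h3 : ∫ x, (id ^ 2 : ℝ → ℝ) x ∂gaussianReal m v = ∫ x, x ^ 2 ∂gaussianReal m v := rfl
  rw [h3] at h
  linarith

theorem integrable_sq_gaussianReal (m : ℝ) (v : ℝ≥0) :
    Integrable (fun x : ℝ => x ^ 2) (gaussianReal m v) :=
  (memLp_id_gaussianReal (μ := m) (v := v) 2).integrable_sq

/-- A shifted Gaussian law against a wider centred one. The term `v / (2 * w) - 1 / 2` of the exact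
divergence is not positive and is dropped. -/
theorem klDiv_gaussianReal_le (m : ℝ) {v w : ℝ≥0} (hv : v ≠ 0) (hvw : v ≤ w) :
    klDiv (gaussianReal m v) (gaussianReal 0 w) ≤
      ENNReal.ofReal (Real.log (w / v) / 2 + m ^ 2 / (2 * w)) := by
  have hv0 : (0 : ℝ) < v := by positivity
  have hvw' : (v : ℝ) ≤ w := by exact_mod_cast hvw
  have hw0 : (0 : ℝ) < w := hv0.trans_le hvw'
  have hw : w ≠ 0 := by rintro rfl; simp at hw0
  set f : ℝ → ℝ≥0∞ := fun x => gaussianPDF m v x / gaussianPDF 0 w x with hf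
  have hfm : Measurable f := (measurable_gaussianPDF m v).div (measurable_gaussianPDF 0 w)
  have heq : gaussianReal m v = (gaussianReal 0 w).withDensity f := by
    rw [gaussianReal_of_var_ne_zero 0 hw, ← withDensity_mul _ (measurable_gaussianPDF 0 w) hfm,
      gaussianReal_of_var_ne_zero m hv]
    congr 1
    ext x
    simp only [Pi.mul_apply, hf]
    rw [ENNReal.mul_div_cancel (gaussianPDF_pos 0 hw x).ne' gaussianPDF_ne_top]
  have hac : gaussianReal m v ≪ gaussianReal 0 w := by
    rw [heq]; exact withDensity_absolutelyContinuous _ _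
  set g : ℝ → ℝ := fun x => Real.log (w / v) / 2 - (x - m) ^ 2 / (2 * v) + x ^ 2 / (2 * w) with hg
  have hllr : llr (gaussianReal m v) (gaussianReal 0 w) =ᵐ[gaussianReal m v] g := by
    refine hac.ae_le ?_
    have h1 := Measure.rnDeriv_withDensity (gaussianReal 0 w) hfm
    rw [← heq] at h1
    filter_upwards [h1] with x hx
    rw [llr, hx]
    simp only [hf, hg, ENNReal.toReal_div, toReal_gaussianPDF, gaussianPDFReal]
    have hl : ∀ u : ℝ≥0, (0 : ℝ) < u → Real.log (√(2 * Real.pi * u))⁻¹ =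
        -((Real.log (2 * Real.pi) + Real.log u) / 2) := by
      intro u hu
      rw [Real.log_inv, Real.log_sqrt (by positivity), Real.log_mul (by positivity) hu.ne']
    rw [Real.log_div (by positivity) (by positivity), Real.log_mul (by positivity) (by positivity),
      Real.log_mul (by positivity) (by positivity), Real.log_exp, Real.log_exp, hl v hv0, hl w hw0,
      Real.log_div (by positivity) (by positivity)]
    ring
  have hi1 : Integrable (fun x : ℝ => x) (gaussianReal m v) :=
    (memLp_id_gaussianReal (μ := m) (v := v) 1).integrable le_rfl
  have hi2 := integrable_sq_gaussianReal m v
  have hg' : g = fun x => (Real.log (w / v) / 2 - m ^ 2 / (2 * v)) + ((m / v) * x +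
      (1 / (2 * w) - 1 / (2 * v)) * x ^ 2) := by
    ext x; simp only [hg]; field_simp; ring
  have hi3 : Integrable (fun x : ℝ => (m / v) * x + (1 / (2 * w) - 1 / (2 * v)) * x ^ 2)
      (gaussianReal m v) := (hi1.const_mul _).add (hi2.const_mul _)
  have hgi : Integrable g (gaussianReal m v) := by
    rw [hg']
    exact (integrable_const _).add hi3
  have hint : ∫ x, g x ∂gaussianReal m v =
      Real.log (w / v) / 2 - 1 / 2 + (v + m ^ 2) / (2 * w) := by
    rw [hg', integral_add (integrable_const _) hi3,
      integral_add (hi1.const_mul _) (hi2.const_mul _), integral_const_mul, integral_const_mul,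
      integral_sq_gaussianReal, integral_id_gaussianReal]
    simp
    field_simp
    ring
  rw [klDiv_of_ac_of_integrable hac ((integrable_congr hllr).2 hgi), integral_congr_ae hllr, hint]
  refine ENNReal.ofReal_le_ofReal ?_
  have h1 : (v : ℝ) / (2 * w) ≤ 1 / 2 := by
    rw [div_le_div_iff₀ (by positivity) (by norm_num)]; linarith
  simp only [probReal_univ]
  rw [add_div]
  linarith

variable {𝕜 : Type*} [RCLike 𝕜]

/-- A shifted Gaussian scalar against the same scalar stretched by `τ ≥ 1`. The factor two of
`log τ` is that of the two real coordinates. Over the reals, the second coordinate is multiplied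
by `RCLike.I = 0`. -/
theorem klDiv_gaussianScalar_le {v : ℝ≥0} (hv : v ≠ 0) (c : 𝕜) {τ : ℝ} (hτ : 1 ≤ τ) :
    klDiv ((gaussianScalar 𝕜 v).map (c + ·)) ((gaussianScalar 𝕜 v).map ((τ : 𝕜) * ·)) ≤
      ENNReal.ofReal (2 * Real.log τ + ‖c‖ ^ 2 / (τ ^ 2 * v)) := by
  have hv0 : (0 : ℝ) < v := by positivity
  set d : ℝ≥0 := (Module.finrank ℝ 𝕜 : ℝ≥0) with hd
  have hdpos : 0 < d := by
    rw [hd]; exact_mod_cast Module.finrank_pos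
  have hd2 : (d : ℝ) ≤ 2 := by
    rw [hd]; exact_mod_cast RCLike.finrank_le_two 𝕜
  have hd0 : (0 : ℝ) < d := by exact_mod_cast hdpos
  set w : ℝ≥0 := v / d with hw
  have hw0 : w ≠ 0 := div_ne_zero hv hdpos.ne'
  set φ : ℝ × ℝ → 𝕜 := fun p => (p.1 : 𝕜) + (p.2 : 𝕜) * RCLike.I with hφ
  have hφm : Measurable φ := by fun_prop
  have h1 : (gaussianScalar 𝕜 v).map (c + ·) =
      ((gaussianReal (RCLike.re c) w).prod (gaussianReal (RCLike.im c) w)).map φ := by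
    have e1 := gaussianReal_map_const_add (μ := 0) (v := w) (RCLike.re c)
    have e2 := gaussianReal_map_const_add (μ := 0) (v := w) (RCLike.im c)
    rw [zero_add] at e1 e2
    rw [← e1, ← e2, Measure.map_prod_map _ _ (by fun_prop) (by fun_prop),
      Measure.map_map hφm (by fun_prop)]
    change Measure.map (c + ·) (Measure.map φ _) = _
    rw [Measure.map_map (by fun_prop) hφm]
    congr 1
    ext p
    simp only [Function.comp_apply, hφ, Prod.map]
    conv_lhs => rw [← RCLike.re_add_im c]
    push_cast
    ring
  have h2 : (gaussianScalar 𝕜 v).map ((τ : 𝕜) * ·) =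
      ((gaussianReal 0 (NNReal.mk (τ ^ 2) (sq_nonneg τ) * w)).prod
        (gaussianReal 0 (NNReal.mk (τ ^ 2) (sq_nonneg τ) * w))).map φ := by
    have e1 := gaussianReal_map_const_mul (μ := 0) (v := w) τ
    rw [mul_zero] at e1
    rw [← e1, Measure.map_prod_map _ _ (by fun_prop) (by fun_prop),
      Measure.map_map hφm (by fun_prop)]
    change Measure.map ((τ : 𝕜) * ·) (Measure.map φ _) = _
    rw [Measure.map_map (by fun_prop) hφm]
    congr 1
    ext p
    simp only [Function.comp_apply, hφ, Prod.map]
    push_cast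
    ring
  have hww : w ≤ NNReal.mk (τ ^ 2) (sq_nonneg τ) * w := by
    refine le_mul_of_one_le_left zero_le ?_
    rw [← NNReal.coe_le_coe]
    change (1 : ℝ) ≤ τ ^ 2
    exact one_le_pow₀ hτ
  rw [h1, h2]
  refine (klDiv_map_le _ _ hφm).trans ((klDiv_prod_le _ _ _ _).trans ((add_le_add
    (klDiv_gaussianReal_le _ hw0 hww) (klDiv_gaussianReal_le _ hw0 hww)).trans ?_))
  have hτ0 : 0 < τ := by linarith
  have hw0' : (0 : ℝ) < w := by positivity
  have hr : ((NNReal.mk (τ ^ 2) (sq_nonneg τ) * w : ℝ≥0) : ℝ) = τ ^ 2 * w := by simp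
  have hlog : Real.log (((NNReal.mk (τ ^ 2) (sq_nonneg τ) * w : ℝ≥0) : ℝ) / w) =
      2 * Real.log τ := by
    rw [hr, mul_div_assoc, div_self hw0'.ne', mul_one, Real.log_pow]; simp
  have hlog0 := Real.log_nonneg hτ
  rw [hlog, hr, ← ENNReal.ofReal_add (by positivity) (by positivity)]
  refine ENNReal.ofReal_le_ofReal ?_
  have hn : ‖c‖ ^ 2 = RCLike.re c ^ 2 + RCLike.im c ^ 2 := by
    rw [← RCLike.normSq_eq_def', RCLike.normSq_apply]; ring
  have hwd : (w : ℝ) = v / d := by rw [hw]; simp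
  have hfin : ‖c‖ ^ 2 / (2 * (τ ^ 2 * w)) ≤ ‖c‖ ^ 2 / (τ ^ 2 * v) := by
    refine div_le_div_of_nonneg_left (by positivity) (by positivity) ?_
    have : (v : ℝ) ≤ 2 * w := by rw [hwd]; rw [← mul_div_assoc, le_div_iff₀ hd0]; nlinarith
    nlinarith [sq_nonneg τ]
  have hsplit : ‖c‖ ^ 2 / (2 * (τ ^ 2 * w)) = RCLike.re c ^ 2 / (2 * (τ ^ 2 * w)) +
      RCLike.im c ^ 2 / (2 * (τ ^ 2 * w)) := by rw [hn, add_div]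
  linarith

/-- A shifted Gaussian vector against the same vector stretched by `τ ≥ 1`. -/
theorem klDiv_pi_gaussianScalar_le {ι : Type*} [Fintype ι] {v : ℝ≥0} (hv : ι → v ≠ 0) (c : ι → 𝕜)
    {τ : ℝ} (hτ : 1 ≤ τ) :
    klDiv ((Measure.pi fun _ : ι => gaussianScalar 𝕜 v).map (c + ·))
        ((Measure.pi fun _ : ι => gaussianScalar 𝕜 v).map ((τ : 𝕜) • ·)) ≤
      ENNReal.ofReal (∑ i, (2 * Real.log τ + ‖c i‖ ^ 2 / (τ ^ 2 * v))) := by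
  have hlog0 := Real.log_nonneg hτ
  have h1 := Measure.pi_map_pi (μ := fun _ : ι => gaussianScalar 𝕜 v) (f := fun i => (c i + ·))
    (fun i => by fun_prop)
  have h2 := Measure.pi_map_pi (μ := fun _ : ι => gaussianScalar 𝕜 v)
    (f := fun i => ((τ : 𝕜) * ·)) (fun i => by fun_prop)
  have e1 : (fun x : ι → 𝕜 => c + x) = fun x i => c i + x i := rfl
  have e2 : (fun x : ι → 𝕜 => (τ : 𝕜) • x) = fun x i => (τ : 𝕜) * x i := rfl
  rw [e1, e2, h1, h2, ENNReal.ofReal_sum_of_nonneg (fun i _ => by positivity)]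
  have := fun i => Measure.isProbabilityMeasure_map (μ := gaussianScalar 𝕜 v) (f := (c i + ·))
    (by fun_prop)
  have := Measure.isProbabilityMeasure_map (μ := gaussianScalar 𝕜 v) (f := ((τ : 𝕜) * ·))
    (by fun_prop)
  exact (klDiv_pi_le _ _).trans
    (Finset.sum_le_sum fun i _ => klDiv_gaussianScalar_le (hv i) (c i) hτ)

theorem lintegral_norm_sq_gaussianScalar_le (v : ℝ≥0) :
    ∫⁻ x, ENNReal.ofReal (‖x‖ ^ 2) ∂(gaussianScalar 𝕜 v) ≤ ENNReal.ofReal (4 * v) := by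
  unfold gaussianScalar
  rw [lintegral_map (by fun_prop) (by fun_prop)]
  set w : ℝ≥0 := v / (Module.finrank ℝ 𝕜 : ℝ≥0) with hw
  have hwv : (w : ℝ) ≤ v := by
    rw [NNReal.coe_le_coe, hw]
    refine div_le_self zero_le ?_
    exact_mod_cast Nat.one_le_iff_ne_zero.2 (Module.finrank_pos (R := ℝ) (M := 𝕜)).ne'
  have hsq : ∫⁻ x : ℝ, ENNReal.ofReal (x ^ 2) ∂(gaussianReal 0 w) = ENNReal.ofReal w := by
    rw [← ofReal_integral_eq_lintegral_ofReal (integrable_sq_gaussianReal 0 w)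
      (ae_of_all _ fun x => sq_nonneg x), integral_sq_gaussianReal]
    simp
  have hb : ∀ p : ℝ × ℝ, ENNReal.ofReal (‖(p.1 : 𝕜) + (p.2 : 𝕜) * RCLike.I‖ ^ 2) ≤
      2 * ENNReal.ofReal (p.1 ^ 2) + 2 * ENNReal.ofReal (p.2 ^ 2) := by
    intro p
    have e2 : (2 : ℝ≥0∞) = ENNReal.ofReal 2 := by simp
    rw [e2, ← ENNReal.ofReal_mul (by norm_num), ← ENNReal.ofReal_mul (by norm_num),
      ← ENNReal.ofReal_add (by positivity) (by positivity)]
    refine ENNReal.ofReal_le_ofReal ?_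
    have h1 : ‖(p.1 : 𝕜) + (p.2 : 𝕜) * RCLike.I‖ ≤ |p.1| + |p.2| := by
      refine (norm_add_le _ _).trans ?_
      rw [norm_mul, RCLike.norm_ofReal, RCLike.norm_ofReal]
      have : ‖(RCLike.I : 𝕜)‖ ≤ 1 := by
        rw [RCLike.norm_I]; split_ifs <;> norm_num
      nlinarith [abs_nonneg p.2]
    have h2 := pow_le_pow_left₀ (norm_nonneg _) h1 2
    nlinarith [sq_abs p.1, sq_abs p.2, sq_nonneg (|p.1| - |p.2|)]
  refine (lintegral_mono hb).trans ?_
  have f1 := lintegral_map (μ := (gaussianReal 0 w).prod (gaussianReal 0 w))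
    (f := fun x : ℝ => ENNReal.ofReal (x ^ 2)) (by fun_prop) measurable_fst
  have f2 := lintegral_map (μ := (gaussianReal 0 w).prod (gaussianReal 0 w))
    (f := fun x : ℝ => ENNReal.ofReal (x ^ 2)) (by fun_prop) measurable_snd
  rw [← Measure.fst, Measure.fst_prod, hsq] at f1
  rw [← Measure.snd, Measure.snd_prod, hsq] at f2
  rw [lintegral_add_left (by fun_prop), lintegral_const_mul _ (by fun_prop),
    lintegral_const_mul _ (by fun_prop), ← f1, ← f2, ← two_mul, ← mul_assoc,
    ENNReal.ofReal_mul (by norm_num)]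
  have : ENNReal.ofReal 4 = 2 * 2 := by norm_num
  rw [this]
  gcongr

end Gaussian

/-! ### Anticoncentration of determinants -/

section Determinant

variable {𝕜 : Type*} [RCLike 𝕜]

/-- The mean of the penalty `φ` at an affine function `ℓ + c` of a random vector of law `μ` exceeds
the penalty at the value of `ℓ` at a fixed vector `v` by at most a constant that depends on `v`
only. For a penalty that is infinite at zero this says nothing if `ℓ v = 0`. -/
def Spread {E : Type*} [AddCommGroup E] [Module 𝕜 E] [MeasurableSpace E] (φ : 𝕜 → ℝ≥0∞)
    (μ : Measure E) : Prop :=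
  (∀ ℓ : E →ₗ[𝕜] 𝕜, Measurable ℓ) ∧
    ∀ v : E, ∃ K : ℝ≥0, ∀ (ℓ : E →ₗ[𝕜] 𝕜) (c : 𝕜), ∫⁻ x, φ (ℓ x + c) ∂μ ≤ φ (ℓ v) + K

/-- A penalty for small scalars, infinite at zero, that changes by a bounded amount when the scalar
is multiplied by a bounded factor. -/
structure IsPenalty (φ : 𝕜 → ℝ≥0∞) : Prop where
  measurable : Measurable φ
  zero : φ 0 = ∞
  one : φ 1 = 0
  scale : ∀ n : ℕ, ∃ C : ℝ≥0, ∀ a b : 𝕜, ‖b‖ ≤ n * ‖a‖ → φ a ≤ φ b + C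

/-- The penalty that is infinite at zero and vanishes elsewhere. -/
noncomputable def zeroPenalty (x : 𝕜) : ℝ≥0∞ := open Classical in if x = 0 then ∞ else 0

/-- The penalty `log⁺ (1 / ‖x‖)`. -/
noncomputable def logPenalty (x : 𝕜) : ℝ≥0∞ :=
  open Classical in if x = 0 then ∞ else ENNReal.ofReal (-Real.log ‖x‖)

theorem isPenalty_zeroPenalty : IsPenalty (zeroPenalty : 𝕜 → ℝ≥0∞) where
  measurable := Measurable.ite (measurableSet_singleton 0) measurable_const measurable_const
  zero := by simp [zeroPenalty]
  one := by simp [zeroPenalty]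
  scale n := by
    refine ⟨0, fun a b h => ?_⟩
    unfold zeroPenalty
    by_cases ha : a = 0
    · have : b = 0 := by simpa [ha] using h
      simp [this]
    · simp [ha]

theorem isPenalty_logPenalty : IsPenalty (logPenalty : 𝕜 → ℝ≥0∞) where
  measurable := Measurable.ite (measurableSet_singleton 0) measurable_const (by fun_prop)
  zero := by simp [logPenalty]
  one := by simp [logPenalty]
  scale n := by
    refine ⟨(Real.log n).toNNReal, fun a b h => ?_⟩
    unfold logPenalty
    by_cases hb : b = 0
    · simp [hb]
    have ha : a ≠ 0 := by
      rintro rfl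
      exact hb (by simpa using h)
    have hb' : 0 < ‖b‖ := norm_pos_iff.2 hb
    have ha' : 0 < ‖a‖ := norm_pos_iff.2 ha
    have hn : (0 : ℝ) < n := by
      by_contra hn
      have : (n : ℝ) * ‖a‖ ≤ 0 := mul_nonpos_of_nonpos_of_nonneg (not_lt.1 hn) ha'.le
      linarith
    rw [if_neg ha, if_neg hb]
    change _ ≤ _ + ENNReal.ofReal _
    refine le_trans (ENNReal.ofReal_le_ofReal ?_) ENNReal.ofReal_add_le
    have := Real.log_le_log hb' h
    rw [Real.log_mul hn.ne' ha'.ne'] at this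
    linarith

theorem measurable_linearMap_self (ℓ : 𝕜 →ₗ[𝕜] 𝕜) : Measurable ℓ :=
  (LinearMap.continuous_of_finiteDimensional ℓ).measurable

theorem linearMap_self_apply (ℓ : 𝕜 →ₗ[𝕜] 𝕜) (x : 𝕜) : ℓ x = ℓ 1 * x := by
  have := ℓ.map_smul x 1
  simpa [mul_comm] using this

theorem spread_zeroPenalty (ν : Measure 𝕜) [NullSingletonClass ν] :
    Spread (zeroPenalty : 𝕜 → ℝ≥0∞) ν := by
  refine ⟨measurable_linearMap_self, fun v => ⟨0, fun ℓ c => ?_⟩⟩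
  by_cases hv : ℓ v = 0
  · simp [hv, zeroPenalty]
  have hu : ℓ 1 ≠ 0 := by
    intro h
    rw [linearMap_self_apply, h, zero_mul] at hv
    exact hv rfl
  refine le_trans (le_of_eq ?_) zero_le
  have hm : Measurable fun x => zeroPenalty (ℓ x + c) :=
    isPenalty_zeroPenalty.measurable.comp ((measurable_linearMap_self ℓ).add_const c)
  rw [lintegral_eq_zero_iff hm]
  have h := measure_eq_zero_iff_ae_notMem.1 (measure_singleton (μ := ν) (-c / ℓ 1))
  filter_upwards [h] with x hx
  have : ℓ x + c ≠ 0 := by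
    intro h0
    rw [linearMap_self_apply] at h0
    refine hx ?_
    rw [Set.mem_singleton_iff, eq_div_iff hu]
    linear_combination h0
  simp [zeroPenalty, this]

theorem spread_logPenalty (ν : Measure 𝕜) [IsProbabilityMeasure ν] [NullSingletonClass ν]
    (h : LogRegular ν) : Spread (logPenalty : 𝕜 → ℝ≥0∞) ν := by
  obtain ⟨B, hB⟩ := h
  refine ⟨measurable_linearMap_self, fun v => ⟨(Real.log ‖v‖).toNNReal + B, fun ℓ c => ?_⟩⟩
  by_cases hv : ℓ v = 0
  · simp [hv, logPenalty]
  have hu : ℓ 1 ≠ 0 := by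
    intro h
    rw [linearMap_self_apply, h, zero_mul] at hv
    exact hv rfl
  have hv0 : v ≠ 0 := by rintro rfl; simp at hv
  have hae := measure_eq_zero_iff_ae_notMem.1 (measure_singleton (μ := ν) (-c / ℓ 1))
  have hpt : ∀ᵐ x ∂ν, logPenalty (ℓ x + c) ≤
      (logPenalty (ℓ v) + ENNReal.ofReal (Real.log ‖v‖)) +
        ENNReal.ofReal (-Real.log ‖x - -c / ℓ 1‖) := by
    filter_upwards [hae] with x hx
    have hx' : x - -c / ℓ 1 ≠ 0 := fun h0 => hx (sub_eq_zero.1 h0)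
    have e : ℓ x + c = ℓ 1 * (x - -c / ℓ 1) := by
      rw [linearMap_self_apply]; field_simp; ring
    have hne : ℓ x + c ≠ 0 := by rw [e]; exact mul_ne_zero hu hx'
    unfold logPenalty
    rw [if_neg hne, if_neg hv]
    refine le_trans (ENNReal.ofReal_le_ofReal (q := (-Real.log ‖ℓ v‖ + Real.log ‖v‖) +
      -Real.log ‖x - -c / ℓ 1‖) ?_) (ENNReal.ofReal_add_le.trans
        (add_le_add_left ENNReal.ofReal_add_le _))
    rw [e, linearMap_self_apply ℓ v, norm_mul, norm_mul,
      Real.log_mul (by simpa) (by simpa using hx'),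
      Real.log_mul (by simpa) (by simpa)]
    linarith
  refine (lintegral_mono_ae hpt).trans ?_
  rw [lintegral_add_left measurable_const, lintegral_const, measure_univ, mul_one]
  rw [ENNReal.coe_add, ← add_assoc]
  exact add_le_add le_rfl (hB _)

/-- Anticoncentration passes to vectors with independent components: it is enough to average over
the component that contributes most to `ℓ v`. -/
theorem Spread.pi {ι : Type*} [Fintype ι] {E : ι → Type*} [∀ i, AddCommGroup (E i)]
    [∀ i, Module 𝕜 (E i)] [∀ i, MeasurableSpace (E i)] {φ : 𝕜 → ℝ≥0∞} (hφ : IsPenalty φ)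
    {μ : ∀ i, Measure (E i)} [∀ i, IsProbabilityMeasure (μ i)] (h : ∀ i, Spread φ (μ i)) :
    Spread φ (Measure.pi μ) := by
  classical
  have hsum : ∀ (ℓ : (∀ i, E i) →ₗ[𝕜] 𝕜) x, ℓ x = ∑ i, ℓ (Pi.single i (x i)) := by
    intro ℓ x
    rw [← map_sum, Finset.univ_sum_single]
  have hmeas : ∀ ℓ : (∀ i, E i) →ₗ[𝕜] 𝕜, Measurable ℓ := by
    intro ℓ
    have : (ℓ : (∀ i, E i) → 𝕜) = fun x => ∑ i, ℓ (Pi.single i (x i)) := funext (hsum ℓ)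
    rw [this]
    refine Finset.measurable_fun_sum _ fun i _ => ?_
    exact ((h i).1 (ℓ ∘ₗ LinearMap.single 𝕜 E i)).comp (measurable_pi_apply i)
  refine ⟨hmeas, fun v => ?_⟩
  choose K hK using fun i => (h i).2 (v i)
  obtain ⟨C, hC⟩ := hφ.scale (Fintype.card ι)
  refine ⟨C + ∑ i, K i, fun ℓ c => ?_⟩
  by_cases hv : ℓ v = 0
  · simp [hv, hφ.zero]
  -- by the triangle inequality, some component carries a fair share of `ℓ v`
  have hex : ∃ i, ‖ℓ v‖ ≤ (Fintype.card ι : ℝ) * ‖ℓ (Pi.single i (v i))‖ := by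
    by_contra! hcon
    have hne : (Finset.univ : Finset ι).Nonempty := by
      by_contra hne
      rw [Finset.not_nonempty_iff_eq_empty] at hne
      rw [hsum, hne] at hv
      simp at hv
    have h1 : ‖ℓ v‖ ≤ ∑ i, ‖ℓ (Pi.single i (v i))‖ := by
      conv_lhs => rw [hsum]
      exact norm_sum_le _ _
    have h2 : ∑ i, (Fintype.card ι : ℝ) * ‖ℓ (Pi.single i (v i))‖ < ∑ _i : ι, ‖ℓ v‖ :=
      Finset.sum_lt_sum_of_nonempty hne fun i _ => hcon i
    rw [← Finset.mul_sum, Finset.sum_const, Finset.card_univ, nsmul_eq_mul] at h2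
    exact absurd (mul_le_mul_of_nonneg_left h1 (Nat.cast_nonneg _)) (not_le.2 h2)
  obtain ⟨i, hi⟩ := hex
  have hf : Measurable fun x => φ (ℓ x + c) := hφ.measurable.comp ((hmeas ℓ).add_const c)
  -- integrate over that component first, the others being part of the constant `c`
  rw [lintegral_eq_lmarginal_univ (0 : ∀ i, E i), ← Finset.insert_erase (Finset.mem_univ i),
    lmarginal_insert' _ hf (Finset.notMem_erase _ _)]
  have hin : ∀ x : ∀ i, E i, ∫⁻ y, φ (ℓ (Function.update x i y) + c) ∂μ i ≤
      φ (ℓ v) + C + K i := by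
    intro x
    have e : ∀ y, ℓ (Function.update x i y) + c =
        (ℓ ∘ₗ LinearMap.single 𝕜 E i) y + (ℓ (Function.update x i 0) + c) := by
      intro y
      have : Function.update x i y = Pi.single i y + Function.update x i 0 := by
        ext j
        by_cases hj : j = i
        · subst hj
          rw [Function.update_self, Pi.add_apply, Pi.single_eq_same, Function.update_self, add_zero]
        · rw [Function.update_of_ne hj, Pi.add_apply, Pi.single_eq_of_ne hj,
            Function.update_of_ne hj, zero_add]
      rw [this, map_add, add_assoc]; rfl
    exact (lintegral_congr fun y => congrArg φ (e y)).trans_le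
      ((hK i _ _).trans (add_le_add_left (hC _ _ hi) _))
  refine (lmarginal_mono hin _).trans ?_
  rw [lmarginal, lintegral_const, measure_univ, mul_one, add_assoc]
  gcongr
  rw [← ENNReal.coe_add, ENNReal.coe_le_coe, Finset.insert_erase (Finset.mem_univ i)]
  exact add_le_add_right (Finset.single_le_sum (f := K) (fun _ _ => zero_le) (Finset.mem_univ i)) C

/-- Anticoncentration of a multilinear function of independent vectors, by averaging over one
vector after the other. -/
theorem lintegral_multilinear_le {T E : Type*} [Fintype T] [AddCommGroup E]
    [Module 𝕜 E] [MeasurableSpace E] {φ : 𝕜 → ℝ≥0∞} (hφ : IsPenalty φ) {l : Measure E}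
    [IsProbabilityMeasure l] (h : Spread φ l) (f : MultilinearMap 𝕜 (fun _ : T => E) 𝕜)
    (hf : Measurable f) (v : T → E) :
    ∃ K : ℝ≥0, ∫⁻ g, φ (f g) ∂(Measure.pi fun _ : T => l) ≤ φ (f v) + K := by
  classical
  choose K hK using h.2
  have hfm : Measurable fun g => φ (f g) := hφ.measurable.comp hf
  -- replace the vectors `v a` by random ones, one after the other
  have main : ∀ (s : Finset T) (v : T → E),
      (∫⋯∫⁻_s, (fun g => φ (f g)) ∂(fun _ : T => l)) v ≤ φ (f v) + ∑ a ∈ s, (K (v a) : ℝ≥0∞) := by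
    intro s
    induction s using Finset.induction_on with
    | empty => intro v; simp
    | insert a s ha ih =>
      intro v
      rw [lmarginal_insert _ hfm ha]
      have h1 : ∀ x, (∫⋯∫⁻_s, (fun g => φ (f g)) ∂(fun _ : T => l)) (Function.update v a x) ≤
          φ (f (Function.update v a x)) + ∑ b ∈ s, (K (v b) : ℝ≥0∞) := by
        intro x
        refine (ih _).trans_eq ?_
        congr 1
        refine Finset.sum_congr rfl fun b hb => ?_
        rw [Function.update_of_ne (ne_of_mem_of_not_mem hb ha)]
      refine (lintegral_mono h1).trans ?_
      rw [lintegral_add_right _ measurable_const, lintegral_const, measure_univ, mul_one,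
        Finset.sum_insert ha, ← add_assoc]
      gcongr
      have := hK (v a) (f.toLinearMap v a) 0
      simpa using this
  refine ⟨∑ a, K (v a), ?_⟩
  rw [lintegral_eq_lmarginal_univ v]
  push_cast
  exact main _ _

end Determinant

namespace System

variable {𝕜 : Type*} [RCLike 𝕜] (S : System 𝕜)

instance : NullSingletonClass S.fading := S.fading_noAtoms

/-! ### The jamming matrix of an eavesdropper with as many antennas as jamming streams -/

/-- All jamming streams. They also index the antennas of the strongest eavesdropper considered. -/
abbrev Stream : Type := Σ i, Fin (S.J i)

/-- The channel coefficients towards one antenna. -/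
abbrev Row : Type _ := ∀ i, Fin (S.M i) → 𝕜

/-- The law of the channel coefficients towards one antenna. -/
noncomputable def rowLaw : Measure S.Row := Measure.pi fun _ => Measure.pi fun _ => S.fading

instance : IsProbabilityMeasure S.rowLaw := by unfold rowLaw; infer_instance

/-- The law of the channel coefficients towards one antenna per jamming stream. -/
noncomputable def squareLaw : Measure (S.Stream → S.Row) := Measure.pi fun _ => S.rowLaw

instance : IsProbabilityMeasure S.squareLaw := by unfold squareLaw; infer_instance

/-- The gains of the jamming streams at an antenna, as a function of its channel coefficients. -/
def jamRow : S.Row →ₗ[𝕜] (S.Stream → 𝕜) where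
  toFun g u := ∑ b, g u.1 b * S.V u.1 b (Sum.inr u.2)
  map_add' g g' := by ext u; simp [add_mul, Finset.sum_add_distrib]
  map_smul' a g := by ext u; simp [Finset.mul_sum, mul_assoc]

/-- The square matrix that maps the jamming streams to the antennas. -/
def jamMatrix (G : S.Stream → S.Row) : Matrix S.Stream S.Stream 𝕜 :=
  Matrix.of fun t => S.jamRow (G t)

theorem measurable_det_jamMatrix : Measurable fun G => (S.jamMatrix G).det := by
  simp only [Matrix.det_apply, jamMatrix, Matrix.of_apply, jamRow, LinearMap.coe_mk,
    AddHom.coe_mk]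
  refine Finset.measurable_fun_sum _ fun σ _ => ?_
  refine Measurable.const_smul ?_ _
  fun_prop

/-- Channel coefficients equal to the conjugate of a column of the jamming precoder single out that
jamming stream, because the precoder is unitary. -/
theorem jamRow_single (t : S.Stream) :
    S.jamRow (Pi.single t.1 fun b => star (S.V t.1 b (Sum.inr t.2))) = Pi.single t 1 := by
  obtain ⟨i, j⟩ := t
  ext ⟨i', j'⟩
  by_cases hi : i' = i
  · subst hi
    have h := congrFun (congrFun (S.V_conjTranspose_mul i') (Sum.inr j)) (Sum.inr j')
    simp only [Matrix.mul_apply, Matrix.conjTranspose_apply] at h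
    simp only [jamRow, LinearMap.coe_mk, AddHom.coe_mk, Pi.single_eq_same]
    rw [h, Matrix.one_apply, Pi.single_apply]
    simp [eq_comm]
  · have : (⟨i', j'⟩ : S.Stream) ≠ ⟨i, j⟩ := fun h => hi (congrArg Sigma.fst h)
    simp [jamRow, Pi.single_eq_of_ne hi, Pi.single_eq_of_ne this]

/-- The determinant of the jamming matrix is not concentrated near zero. It is multilinear in the
rows, and equals one when the rows are the conjugated columns of the jamming precoder. -/
theorem lintegral_det_jamMatrix_le {φ : 𝕜 → ℝ≥0∞} (hφ : IsPenalty φ) (h : Spread φ S.fading) :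
    ∃ K : ℝ≥0, ∫⁻ G, φ (S.jamMatrix G).det ∂S.squareLaw ≤ K := by
  have hrow : Spread φ S.rowLaw := Spread.pi hφ fun i => Spread.pi hφ fun b => h
  let f : MultilinearMap 𝕜 (fun _ : S.Stream => S.Row) 𝕜 :=
    (Matrix.detRowAlternating (R := 𝕜) (n := S.Stream)).toMultilinearMap.compLinearMap
      fun _ => S.jamRow
  have hf : ∀ G, f G = (S.jamMatrix G).det := fun G => rfl
  have hfm : Measurable f := by
    have := S.measurable_det_jamMatrix
    exact this
  obtain ⟨K, hK⟩ := lintegral_multilinear_le hφ hrow f hfm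
    fun t => Pi.single t.1 fun b => star (S.V t.1 b (Sum.inr t.2))
  refine ⟨K, hK.trans ?_⟩
  rw [hf, jamMatrix]
  simp only [jamRow_single]
  have : Matrix.of (fun t : S.Stream => (Pi.single t 1 : S.Stream → 𝕜)) = 1 := by
    ext t u
    simp [Matrix.one_apply, Pi.single_apply, eq_comm]
  rw [this, Matrix.det_one, hφ.one, zero_add]

theorem ae_det_jamMatrix_ne_zero : ∀ᵐ G ∂S.squareLaw, (S.jamMatrix G).det ≠ 0 := by
  obtain ⟨K, hK⟩ := S.lintegral_det_jamMatrix_le isPenalty_zeroPenalty (spread_zeroPenalty S.fading)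
  have h := ae_lt_top (isPenalty_zeroPenalty.measurable.comp S.measurable_det_jamMatrix)
    (hK.trans_lt ENNReal.coe_lt_top).ne
  filter_upwards [h] with G hG h0
  simp [zeroPenalty, h0] at hG

end System

/-! ### Rearranging product measures -/

section Product

/-- Independent coordinates with the same law, read off along an injection. -/
theorem measurePreserving_pi_comp {T T' X : Type*} [Fintype T] [Fintype T'] [MeasurableSpace X]
    (μ : Measure X) [IsProbabilityMeasure μ] {f : T' → T} (hf : Function.Injective f) :
    MeasurePreserving (fun (x : T → X) a => x (f a)) (Measure.pi fun _ => μ)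
      (Measure.pi fun _ => μ) := by
  refine ⟨by fun_prop, ?_⟩
  have h := (iIndepFun_pi (μ := fun _ : T => μ) (X := fun _ x => x)
    fun _ => aemeasurable_id).precomp hf
  rw [iIndepFun_iff_map_fun_eq_pi_map
    (fun a => (measurable_pi_apply (f a)).aemeasurable)] at h
  refine h.trans ?_
  congr 1
  funext a
  exact (measurePreserving_eval (fun _ : T => μ) (f a)).map_eq

/-- Exchanging the two indices of a family of independent variables. -/
theorem measurePreserving_pi_swap {T I : Type*} [Fintype T] [Fintype I] {X : I → Type*}
    [∀ i, MeasurableSpace (X i)] (μ : ∀ i, Measure (X i)) [∀ i, IsProbabilityMeasure (μ i)] :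
    MeasurePreserving (fun (x : T → ∀ i, X i) i a => x a i)
      (Measure.pi fun _ => Measure.pi μ) (Measure.pi fun i => Measure.pi fun _ => μ i) := by
  have hm : Measurable (fun (x : T → ∀ i, X i) i a => x a i) := by fun_prop
  refine ⟨hm, ?_⟩
  refine (Measure.pi_eq_generateFrom (fun _ => generateFrom_pi) (fun _ => isPiSystem_pi)
    (fun i => Measure.FiniteSpanningSetsIn.pi fun _ : T => (μ i).toFiniteSpanningSetsIn) ?_).symm
  intro s hs
  choose t ht hts using hs
  obtain rfl : (fun i => Set.univ.pi (t i)) = s := funext hts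
  have htm : ∀ i a, MeasurableSet (t i a) := fun i a => ht i a (Set.mem_univ _)
  rw [Measure.map_apply hm (MeasurableSet.univ_pi fun i => MeasurableSet.univ_pi fun a => htm i a)]
  have : (fun (x : T → ∀ i, X i) i a => x a i) ⁻¹' Set.univ.pi (fun i => Set.univ.pi (t i)) =
      Set.univ.pi fun a => Set.univ.pi fun i => t i a := by
    ext x
    simp only [Set.mem_preimage, Set.mem_univ_pi]
    exact forall_comm
  rw [this]
  simp_rw [Measure.pi_pi]
  exact Finset.prod_comm

end Product

/-! ### Mixtures -/

/-- Revealing part of the randomness of the first law can only increase the mean divergence. -/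
theorem klDiv_map_prod_le_of_snd {A B C : Type*} [MeasurableSpace A] [MeasurableSpace B]
    [MeasurableSpace C] [MeasurableSpace.CountablyGenerated C]
    (l : Measure A) [IsProbabilityMeasure l] (ρ : Measure B) [IsProbabilityMeasure ρ]
    {φ : A → B → C} (hφ : Measurable (Function.uncurry φ)) {ψ : B → C} (hψ : Measurable ψ)
    {F : A → ℝ≥0∞} (hF : AEMeasurable F l)
    (h : ∀ᵐ g ∂l, klDiv (ρ.map (φ g)) (ρ.map ψ) ≤ F g) :
    klDiv ((l.prod ρ).map fun p => φ p.1 p.2) (ρ.map ψ) ≤ ∫⁻ g, F g ∂l := by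
  refine le_trans ?_ (klDiv_map_prod_le l ρ hφ (ψ := fun _ => ψ) (by fun_prop) hF h)
  have h1 : Measurable fun p : A × B => (p.1, φ p.1 p.2) := measurable_fst.prodMk hφ
  have h2 : Measurable fun p : A × B => (p.1, ψ p.2) := by fun_prop
  refine le_of_eq_of_le ?_ (klDiv_map_le _ _ (g := Prod.snd) measurable_snd)
  rw [Measure.map_map measurable_snd h1, Measure.map_map measurable_snd h2]
  congr 1
  change ρ.map ψ = (l.prod ρ).map (ψ ∘ Prod.snd)
  rw [← Measure.map_map hψ measurable_snd, ← Measure.snd, Measure.snd_prod]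

namespace System

variable {𝕜 : Type*} [RCLike 𝕜] (S : System 𝕜)

/-! ### The received signal of the strongest eavesdropper -/

/-- The noiseless received signal with one antenna per jamming stream. -/
def mix (s : S.Signal) (r : S.Jam) (G : S.Stream → S.Row) : S.Stream → 𝕜 := fun t =>
  ∑ i, ∑ b, G t i b * S.chanInput i (s i) (r i) b

/-- The squared norm of a family of vectors. -/
def sqNorm {I : Type*} [Fintype I] {n : I → ℕ} (x : ∀ i, Fin (n i) → 𝕜) : ℝ :=
  ∑ i, ∑ a, ‖x i a‖ ^ 2

theorem sqNorm_nonneg {I : Type*} [Fintype I] {n : I → ℕ} (x : ∀ i, Fin (n i) → 𝕜) :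
    0 ≤ sqNorm x := by unfold sqNorm; positivity

/-- The squared norm of the channel matrix. -/
def gain (G : S.Stream → S.Row) : ℝ := ∑ t, sqNorm (G t)

theorem gain_nonneg (G : S.Stream → S.Row) : 0 ≤ S.gain G :=
  Finset.sum_nonneg fun _ _ => sqNorm_nonneg _

theorem measurable_gain : Measurable S.gain := by unfold gain sqNorm; fun_prop

theorem chanInput_eq (i : Fin 2) (s : Fin (S.L i) → 𝕜) (r : Fin (S.J i) → 𝕜) (b : Fin (S.M i)) :
    S.chanInput i s r b = ∑ l, S.V i b (Sum.inl l) * s l + ∑ j, S.V i b (Sum.inr j) * r j := by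
  simp [chanInput, Matrix.mulVec, dotProduct, Fintype.sum_sum_type]

theorem mix_add (s s' : S.Signal) (r r' : S.Jam) (G : S.Stream → S.Row) :
    S.mix (s + s') (r + r') G = S.mix s r G + S.mix s' r' G := by
  ext t
  simp only [mix, chanInput_eq, Pi.add_apply, mul_add, Finset.sum_add_distrib]
  ring

theorem mix_zero_left (r : S.Jam) (G : S.Stream → S.Row) :
    S.mix 0 r G = S.jamMatrix G *ᵥ fun u => r u.1 u.2 := by
  ext t
  simp only [mix, chanInput_eq, Matrix.mulVec, dotProduct, jamMatrix, Matrix.of_apply, jamRow,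
    LinearMap.coe_mk, AddHom.coe_mk, Pi.zero_apply, mul_zero, Finset.sum_const_zero, zero_add,
    Fintype.sum_sigma, Finset.sum_mul, Finset.mul_sum]
  refine Finset.sum_congr rfl fun i _ => ?_
  rw [Finset.sum_comm]
  simp only [mul_assoc]

theorem measurable_mix : Measurable fun p : S.Signal × S.Jam × (S.Stream → S.Row) =>
    S.mix p.1 p.2.1 p.2.2 := by
  refine measurable_pi_lambda _ fun t => ?_
  simp only [mix, chanInput_eq]
  fun_prop

/-- The precoders preserve energy. -/
theorem sum_norm_sq_chanInput (i : Fin 2) (s : Fin (S.L i) → 𝕜) (r : Fin (S.J i) → 𝕜) :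
    ∑ b, ‖S.chanInput i s r b‖ ^ 2 = ∑ l, ‖s l‖ ^ 2 + ∑ j, ‖r j‖ ^ 2 := by
  have key : ∀ {ι : Type} [Fintype ι] (y : ι → 𝕜),
      ((∑ b, ‖y b‖ ^ 2 : ℝ) : 𝕜) = star y ⬝ᵥ y := by
    intro ι _ y
    simp only [dotProduct, Pi.star_apply]
    push_cast
    exact Finset.sum_congr rfl fun b _ => (RCLike.conj_mul (y b)).symm
  have h : ((∑ b, ‖S.chanInput i s r b‖ ^ 2 : ℝ) : 𝕜) =
      ((∑ u, ‖Sum.elim s r u‖ ^ 2 : ℝ) : 𝕜) := by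
    rw [key, key, chanInput, Matrix.star_mulVec, ← Matrix.dotProduct_mulVec, Matrix.mulVec_mulVec,
      S.V_conjTranspose_mul, Matrix.one_mulVec]
  have h' := RCLike.ofReal_injective h
  rw [h', Fintype.sum_sum_type]
  simp

theorem norm_sum_mul_sq_le {I : Type*} [Fintype I] {n : I → ℕ} (x y : ∀ i, Fin (n i) → 𝕜) :
    ‖∑ i, ∑ b, x i b * y i b‖ ^ 2 ≤ sqNorm x * sqNorm y := by
  have h1 : ‖∑ i, ∑ b, x i b * y i b‖ ≤ ∑ u : Σ i, Fin (n i), ‖x u.1 u.2‖ * ‖y u.1 u.2‖ := by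
    rw [Fintype.sum_sigma]
    refine (norm_sum_le _ _).trans (Finset.sum_le_sum fun i _ => (norm_sum_le _ _).trans ?_)
    simp
  have h2 := Finset.sum_mul_sq_le_sq_mul_sq Finset.univ
    (fun u : Σ i, Fin (n i) => ‖x u.1 u.2‖) (fun u => ‖y u.1 u.2‖)
  rw [Fintype.sum_sigma (fun u : Σ i, Fin (n i) => ‖x u.1 u.2‖ ^ 2),
    Fintype.sum_sigma (fun u : Σ i, Fin (n i) => ‖y u.1 u.2‖ ^ 2)] at h2
  exact (pow_le_pow_left₀ (norm_nonneg _) h1 2).trans h2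

theorem sum_norm_sq_mix_le (s : S.Signal) (r : S.Jam) (G : S.Stream → S.Row) :
    ∑ t, ‖S.mix s r G t‖ ^ 2 ≤ S.gain G * (sqNorm s + sqNorm r) := by
  rw [gain, Finset.sum_mul]
  refine Finset.sum_le_sum fun t _ => ?_
  have h := norm_sum_mul_sq_le (G t) (fun i => S.chanInput i (s i) (r i))
  have e : sqNorm (fun i => S.chanInput i (s i) (r i)) = sqNorm s + sqNorm r := by
    simp only [sqNorm, sum_norm_sq_chanInput, Finset.sum_add_distrib]
  rwa [e] at h

/-- A bound on the squared norm of the linear map that takes the legitimate signals to the jamming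
signals with the same effect at the receiver; meaningful if the jamming matrix is invertible. -/
noncomputable def amplification (G : S.Stream → S.Row) : ℝ :=
  (∑ u, ∑ t, ‖(S.jamMatrix G).adjugate u t‖ ^ 2) * S.gain G / ‖(S.jamMatrix G).det‖ ^ 2

theorem amplification_nonneg (G : S.Stream → S.Row) : 0 ≤ S.amplification G := by
  have := S.gain_nonneg G
  unfold amplification; positivity

theorem measurable_amplification : Measurable S.amplification := by
  unfold amplification
  refine Measurable.div (Measurable.mul ?_ S.measurable_gain)
    (S.measurable_det_jamMatrix.norm.pow_const 2)
  refine Finset.measurable_fun_sum _ fun u _ => Finset.measurable_fun_sum _ fun t _ => ?_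
  refine Measurable.pow_const (Measurable.norm ?_) 2
  simp only [Matrix.adjugate_apply, Matrix.det_apply, Matrix.updateRow_apply, jamMatrix,
    Matrix.of_apply, jamRow, LinearMap.coe_mk, AddHom.coe_mk]
  refine Finset.measurable_fun_sum _ fun σ _ => Measurable.const_smul ?_ _
  refine Finset.measurable_fun_prod _ fun v _ => ?_
  split_ifs <;> fun_prop

/-- If the jamming matrix is invertible, then the legitimate signals act at the receiver like a
shift of the jamming signals. -/
theorem exists_shift (G : S.Stream → S.Row) (hG : (S.jamMatrix G).det ≠ 0) (s : S.Signal) :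
    ∃ c : S.Jam, (∀ r, S.mix s r G = S.mix 0 (c + r) G) ∧
      sqNorm c ≤ S.amplification G * sqNorm s := by
  set A := S.jamMatrix G with hA
  set h : S.Stream → 𝕜 := S.mix s 0 G with hh
  set c : S.Stream → 𝕜 := (A.det)⁻¹ • (A.adjugate *ᵥ h) with hc
  have hAc : A *ᵥ c = h := by
    rw [hc, Matrix.mulVec_smul, Matrix.mulVec_mulVec, Matrix.mul_adjugate, Matrix.smul_mulVec,
      Matrix.one_mulVec, smul_smul, inv_mul_cancel₀ hG, one_smul]
  refine ⟨fun i j => c ⟨i, j⟩, fun r => ?_, ?_⟩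
  · have h1 := S.mix_add s 0 0 r G
    have h2 := S.mix_add 0 0 (fun i j => c ⟨i, j⟩) r G
    rw [add_zero, zero_add] at h1
    rw [add_zero] at h2
    rw [h1, h2, S.mix_zero_left (fun i j => c ⟨i, j⟩), ← hA, hAc]
  · have h1 : ∑ t, ‖h t‖ ^ 2 ≤ S.gain G * sqNorm s := by
      have := S.sum_norm_sq_mix_le s 0 G
      have e : sqNorm (0 : S.Jam) = 0 := by simp [sqNorm]
      rwa [e, add_zero] at this
    have h2 : ∀ u, ‖c u‖ ^ 2 ≤ (∑ t, ‖A.adjugate u t‖ ^ 2) * (∑ t, ‖h t‖ ^ 2) / ‖A.det‖ ^ 2 := by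
      intro u
      have hcu : c u = (A.det)⁻¹ * ∑ t, A.adjugate u t * h t := rfl
      rw [hcu, norm_mul, norm_inv, mul_pow, inv_pow, div_eq_inv_mul]
      gcongr
      have h3 : ‖∑ t, A.adjugate u t * h t‖ ≤ ∑ t, ‖A.adjugate u t‖ * ‖h t‖ := by
        refine (norm_sum_le _ _).trans ?_
        simp
      exact (pow_le_pow_left₀ (norm_nonneg _) h3 2).trans
        (Finset.sum_mul_sq_le_sq_mul_sq _ _ _)
    have h4 : sqNorm (fun i j => c ⟨i, j⟩ : S.Jam) = ∑ u, ‖c u‖ ^ 2 := by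
      rw [Fintype.sum_sigma]; rfl
    rw [h4]
    refine (Finset.sum_le_sum fun u _ => h2 u).trans ?_
    rw [← Finset.sum_div, ← Finset.sum_mul, amplification, ← hA, div_mul_eq_mul_div, mul_assoc]
    exact div_le_div_of_nonneg_right (mul_le_mul_of_nonneg_left h1
      (Finset.sum_nonneg fun _ _ => Finset.sum_nonneg fun _ _ => sq_nonneg _)) (sq_nonneg _)

/-! ### Moments of the channel matrix -/

theorem lintegral_gain_lt_top : ∫⁻ G, ENNReal.ofReal (S.gain G) ∂S.squareLaw < ∞ := by
  have h2 : ∫⁻ g, ENNReal.ofReal (‖g‖ ^ 2) ∂S.fading < ∞ := by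
    have h := (memLp_two_iff_integrable_sq_norm S.fading_memLp.1).1 S.fading_memLp
    exact h.lintegral_lt_top
  have h1 : ∀ t i b, ∫⁻ G : S.Stream → S.Row, ENNReal.ofReal (‖G t i b‖ ^ 2) ∂S.squareLaw =
      ∫⁻ g, ENNReal.ofReal (‖g‖ ^ 2) ∂S.fading := by
    intro t i b
    have m1 := measurePreserving_eval (fun _ : S.Stream => S.rowLaw) t
    have m2 := measurePreserving_eval (fun i => Measure.pi fun _ : Fin (S.M i) => S.fading) i
    have m3 := measurePreserving_eval (fun _ : Fin (S.M i) => S.fading) b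
    exact (m3.comp (m2.comp m1)).lintegral_comp
      (f := fun g => ENNReal.ofReal (‖g‖ ^ 2)) (by fun_prop)
  have h3 : ∀ G : S.Stream → S.Row, ENNReal.ofReal (S.gain G) =
      ∑ t, ∑ i, ∑ b, ENNReal.ofReal (‖G t i b‖ ^ 2) := by
    intro G
    unfold gain sqNorm
    rw [ENNReal.ofReal_sum_of_nonneg fun _ _ => by positivity]
    refine Finset.sum_congr rfl fun t _ => ?_
    rw [ENNReal.ofReal_sum_of_nonneg fun _ _ => by positivity]
    refine Finset.sum_congr rfl fun i _ => ?_
    rw [ENNReal.ofReal_sum_of_nonneg fun _ _ => by positivity]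
  simp_rw [h3]
  rw [lintegral_finsetSum _ fun t _ => by fun_prop]
  refine ENNReal.sum_lt_top.2 fun t _ => ?_
  rw [lintegral_finsetSum _ fun t _ => by fun_prop]
  refine ENNReal.sum_lt_top.2 fun i _ => ?_
  rw [lintegral_finsetSum _ fun t _ => by fun_prop]
  refine ENNReal.sum_lt_top.2 fun b _ => ?_
  rw [h1]
  exact h2

theorem norm_sq_jamMatrix_le (G : S.Stream → S.Row) (t u : S.Stream) :
    ‖S.jamMatrix G t u‖ ^ 2 ≤ S.gain G := by
  have h := S.sum_norm_sq_mix_le 0 (fun i j => (Pi.single u (1 : 𝕜) : S.Stream → 𝕜) ⟨i, j⟩) G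
  have e1 : sqNorm (0 : S.Signal) = 0 := by simp [sqNorm]
  have e2 : sqNorm (fun i j => (Pi.single u (1 : 𝕜) : S.Stream → 𝕜) ⟨i, j⟩ : S.Jam) = 1 := by
    have : sqNorm (fun i j => (Pi.single u (1 : 𝕜) : S.Stream → 𝕜) ⟨i, j⟩ : S.Jam) =
        ∑ v : S.Stream, ‖(Pi.single u (1 : 𝕜) : S.Stream → 𝕜) v‖ ^ 2 := by
      rw [Fintype.sum_sigma]; rfl
    rw [this, Finset.sum_eq_single u]
    · simp
    · intro v _ hv; simp [Pi.single_eq_of_ne hv]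
    · simp
  rw [e1, e2, zero_add, mul_one, mix_zero_left] at h
  refine le_trans ?_ h
  have e3 : S.jamMatrix G t u = (S.jamMatrix G *ᵥ (Pi.single u (1 : 𝕜) : S.Stream → 𝕜)) t := by
    simp
  rw [e3]
  exact Finset.single_le_sum (f := fun t => ‖(S.jamMatrix G *ᵥ
    (Pi.single u (1 : 𝕜) : S.Stream → 𝕜)) t‖ ^ 2) (fun _ _ => sq_nonneg _) (Finset.mem_univ t)

/-- A bound on the cofactors, from the Leibniz formula. -/
theorem norm_sq_adjugate_le (G : S.Stream → S.Row) (u t : S.Stream) :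
    ‖(S.jamMatrix G).adjugate u t‖ ^ 2 ≤
      (Fintype.card S.Stream).factorial ^ 2 * (1 + S.gain G) ^ Fintype.card S.Stream := by
  have hg := S.gain_nonneg G
  have hx : ∀ v w, ‖(S.jamMatrix G).updateRow t (Pi.single u 1) v w‖ ≤ √(1 + S.gain G) := by
    intro v w
    refine Real.le_sqrt_of_sq_le ?_
    rw [Matrix.updateRow_apply]
    split_ifs with h
    · rw [Pi.single_apply]
      split_ifs
      · simpa using hg
      · simp; positivity
    · have := S.norm_sq_jamMatrix_le G v w
      linarith
  have h := Matrix.det_le (abv := NormedField.toAbsoluteValue 𝕜)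
    (A := (S.jamMatrix G).updateRow t (Pi.single u 1)) (x := √(1 + S.gain G)) hx
  rw [nsmul_eq_mul] at h
  rw [Matrix.adjugate_apply]
  refine (pow_le_pow_left₀ (norm_nonneg _) h 2).trans_eq ?_
  rw [mul_pow, ← pow_mul, mul_comm (Fintype.card S.Stream) 2, pow_mul, Real.sq_sqrt (by positivity)]

theorem lintegral_log_amplification_lt_top (h : LogRegular S.fading) :
    ∫⁻ G, ENNReal.ofReal (Real.log (1 + S.amplification G)) ∂S.squareLaw < ∞ := by
  set N := Fintype.card S.Stream with hN
  set D : ℝ := N * (N * (N.factorial ^ 2)) with hD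
  have hD0 : 0 ≤ D := by positivity
  have hpt : ∀ᵐ G ∂S.squareLaw, ENNReal.ofReal (Real.log (1 + S.amplification G)) ≤
      ENNReal.ofReal (Real.log (1 + D)) + (ENNReal.ofReal (N + 1 : ℝ) * ENNReal.ofReal (S.gain G) +
        2 * logPenalty (S.jamMatrix G).det) := by
    filter_upwards [S.ae_det_jamMatrix_ne_zero] with G hG
    have hg := S.gain_nonneg G
    set δ := ‖(S.jamMatrix G).det‖ with hδ
    have hδ0 : 0 < δ := norm_pos_iff.2 hG
    set l := max (-Real.log δ) 0 with hl
    have hl0 : 0 ≤ l := le_max_right _ _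
    have hpen : logPenalty (S.jamMatrix G).det = ENNReal.ofReal l := by
      rw [logPenalty, if_neg hG, ← hδ, hl]
      rcases le_total 0 (-Real.log δ) with h0 | h0
      · rw [max_eq_left h0]
      · rw [max_eq_right h0, ENNReal.ofReal_of_nonpos h0, ENNReal.ofReal_zero]
    have hexp1 : 1 ≤ Real.exp (2 * l) := Real.one_le_exp (by positivity)
    have hexp2 : 1 / δ ^ 2 ≤ Real.exp (2 * l) := by
      have : 1 / δ ^ 2 = Real.exp (2 * -Real.log δ) := by
        rw [two_mul, Real.exp_add, Real.exp_neg, Real.exp_log hδ0]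
        field_simp
      rw [this]
      gcongr
      exact le_max_left _ _
    have hadj : ∑ u, ∑ t, ‖(S.jamMatrix G).adjugate u t‖ ^ 2 ≤ D * (1 + S.gain G) ^ N := by
      refine (Finset.sum_le_sum fun u _ => Finset.sum_le_sum fun t _ =>
        S.norm_sq_adjugate_le G u t).trans_eq ?_
      simp only [Finset.sum_const, Finset.card_univ, nsmul_eq_mul]
      rw [hD, ← hN]
      ring
    have hamp : S.amplification G ≤ D * (1 + S.gain G) ^ (N + 1) * Real.exp (2 * l) := by
      rw [amplification, ← hδ, div_eq_mul_one_div, pow_succ (1 + S.gain G), ← mul_assoc D]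
      gcongr
      linarith
    have hone : 1 ≤ (1 + S.gain G) ^ (N + 1) * Real.exp (2 * l) :=
      one_le_mul_of_one_le_of_one_le (one_le_pow₀ (by linarith)) hexp1
    have hfin : 1 + S.amplification G ≤
        (1 + D) * ((1 + S.gain G) ^ (N + 1) * Real.exp (2 * l)) := by
      rw [add_mul, one_mul]
      linarith
    have hA := S.amplification_nonneg G
    have hlog := Real.log_le_log (by positivity) hfin
    rw [Real.log_mul (by positivity) (by positivity), Real.log_mul (by positivity) (by positivity),
      Real.log_pow, Real.log_exp] at hlog
    have hlg : Real.log (1 + S.gain G) ≤ S.gain G := by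
      have := Real.log_le_sub_one_of_pos (show 0 < 1 + S.gain G by positivity)
      linarith
    rw [hpen]
    have e2 : (2 : ℝ≥0∞) = ENNReal.ofReal 2 := by simp
    rw [e2, ← ENNReal.ofReal_mul (by positivity), ← ENNReal.ofReal_mul (by positivity),
      ← ENNReal.ofReal_add (by positivity) (by positivity),
      ← ENNReal.ofReal_add (Real.log_nonneg (by linarith)) (by positivity)]
    refine ENNReal.ofReal_le_ofReal (hlog.trans ?_)
    have := mul_le_mul_of_nonneg_left hlg (show (0 : ℝ) ≤ N + 1 by positivity)
    push_cast
    linarith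
  obtain ⟨K, hK⟩ := S.lintegral_det_jamMatrix_le isPenalty_logPenalty
    (spread_logPenalty S.fading h)
  have hm : Measurable fun G => ENNReal.ofReal (S.gain G) :=
    ENNReal.measurable_ofReal.comp S.measurable_gain
  refine (lintegral_mono_ae hpt).trans_lt ?_
  rw [lintegral_add_left measurable_const, lintegral_add_left (hm.const_mul _),
    lintegral_const, measure_univ, mul_one, lintegral_const_mul _ hm,
    lintegral_const_mul' _ _ (by simp)]
  refine ENNReal.add_lt_top.2 ⟨ENNReal.ofReal_lt_top, ENNReal.add_lt_top.2 ⟨?_, ?_⟩⟩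
  · exact ENNReal.mul_lt_top ENNReal.ofReal_lt_top S.lintegral_gain_lt_top
  · exact ENNReal.mul_lt_top (by simp) (hK.trans_lt ENNReal.coe_lt_top)

/-! ### Reference laws for a fixed channel matrix -/

/-- The law of all jamming signals. -/
noncomputable def allJamLaw (P : ℝ≥0) : Measure S.Jam := Measure.pi fun i => S.jamLaw P i

instance (P : ℝ≥0) : IsProbabilityMeasure (S.allJamLaw P) := by unfold allJamLaw; infer_instance

/-- The law of the noise at the antennas of the strongest eavesdropper. -/
noncomputable def noiseLaw : Measure (S.Stream → 𝕜) :=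
  Measure.pi fun _ => gaussianScalar 𝕜 S.noiseVar

instance : IsProbabilityMeasure S.noiseLaw := by unfold noiseLaw; infer_instance

/-- The jamming signals hide a shift: divergence from the stretched jamming signals. -/
theorem klDiv_allJamLaw_le {P : ℝ≥0} (hP : 0 < P) (c : S.Jam) {τ : ℝ} (hτ : 1 ≤ τ) :
    klDiv ((S.allJamLaw P).map (c + ·)) ((S.allJamLaw P).map ((τ : 𝕜) • ·)) ≤
      ENNReal.ofReal (Fintype.card S.Stream * (2 * Real.log τ) +
        Fintype.card S.Stream * sqNorm c / (τ ^ 2 * (S.α * P))) := by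
  have hlog0 := Real.log_nonneg hτ
  have hα : (0 : ℝ) < S.α := by exact_mod_cast S.α_pos
  have hP' : (0 : ℝ) < P := by exact_mod_cast hP
  have hv : ∀ i, Fin (S.J i) → S.α * P / (S.J i : ℝ≥0) ≠ 0 := by
    intro i j
    have hJ : (S.J i : ℝ≥0) ≠ 0 := by
      have := j.pos
      exact_mod_cast this.ne'
    exact div_ne_zero (mul_pos S.α_pos hP).ne' hJ
  have e1 : (fun r : S.Jam => c + r) = fun r i => c i + r i := rfl
  have e2 : (fun r : S.Jam => (τ : 𝕜) • r) = fun r i => (τ : 𝕜) • r i := rfl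
  unfold allJamLaw
  rw [e1, e2, Measure.pi_map_pi (f := fun i => (c i + ·)) fun i => by fun_prop,
    Measure.pi_map_pi (f := fun i (r : Fin (S.J i) → 𝕜) => (τ : 𝕜) • r) fun i => by fun_prop]
  have := fun i => Measure.isProbabilityMeasure_map (μ := S.jamLaw P i) (f := (c i + ·))
    (by fun_prop)
  have := fun i => Measure.isProbabilityMeasure_map (μ := S.jamLaw P i)
    (f := fun r : Fin (S.J i) → 𝕜 => (τ : 𝕜) • r) (by fun_prop)
  refine (klDiv_pi_le _ _).trans ((Finset.sum_le_sum fun i _ =>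
    klDiv_pi_gaussianScalar_le (hv i) (c i) hτ).trans ?_)
  rw [← ENNReal.ofReal_sum_of_nonneg fun i _ => Finset.sum_nonneg fun j _ => by positivity]
  refine ENNReal.ofReal_le_ofReal ?_
  have hterm : ∀ i j, 2 * Real.log τ + ‖c i j‖ ^ 2 /
      (τ ^ 2 * (S.α * P / (S.J i : ℝ≥0) : ℝ≥0)) ≤
      2 * Real.log τ + Fintype.card S.Stream * ‖c i j‖ ^ 2 / (τ ^ 2 * (S.α * P)) := by
    intro i j
    have hJ0 : (0 : ℝ) < S.J i := by exact_mod_cast j.pos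
    have hJN : (S.J i : ℝ) ≤ Fintype.card S.Stream := by
      have : S.J i ≤ Fintype.card S.Stream := by
        rw [Fintype.card_sigma]
        simpa using Finset.single_le_sum (f := S.J) (fun _ _ => Nat.zero_le _) (Finset.mem_univ i)
      exact_mod_cast this
    have e : ‖c i j‖ ^ 2 / (τ ^ 2 * (S.α * P / (S.J i : ℝ≥0) : ℝ≥0)) =
        S.J i * ‖c i j‖ ^ 2 / (τ ^ 2 * (S.α * P)) := by
      push_cast
      field_simp
    rw [e]
    gcongr
  refine (Finset.sum_le_sum fun i _ => Finset.sum_le_sum fun j _ => hterm i j).trans_eq ?_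
  have hcard : (Fintype.card S.Stream : ℝ) = ∑ i, (S.J i : ℝ) := by
    rw [Fintype.card_sigma]; simp
  simp only [Finset.sum_add_distrib, Finset.sum_const, Finset.card_univ, Fintype.card_fin,
    nsmul_eq_mul]
  rw [← Finset.sum_mul, ← hcard, sqNorm]
  simp only [← Finset.sum_div, ← Finset.mul_sum]

theorem lintegral_sqNorm_allJamLaw_le (P : ℝ≥0) :
    ∫⁻ r, ENNReal.ofReal (sqNorm r) ∂S.allJamLaw P ≤ ENNReal.ofReal (8 * P) := by
  have h1 : ∀ i (j : Fin (S.J i)), ∫⁻ r, ENNReal.ofReal (‖r i j‖ ^ 2) ∂S.allJamLaw P ≤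
      ENNReal.ofReal (4 * (P / S.J i)) := by
    intro i j
    have m1 := measurePreserving_eval (fun i => S.jamLaw P i) i
    have m2 := measurePreserving_eval
      (fun _ : Fin (S.J i) => gaussianScalar 𝕜 (S.α * P / (S.J i : ℝ≥0))) j
    refine ((m2.comp m1).lintegral_comp
      (f := fun g => ENNReal.ofReal (‖g‖ ^ 2)) (by fun_prop)).trans_le ?_
    refine (lintegral_norm_sq_gaussianScalar_le _).trans (ENNReal.ofReal_le_ofReal ?_)
    push_cast
    gcongr
    have hα : (S.α : ℝ) ≤ 1 := by exact_mod_cast S.α_lt_one.le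
    have hP' : (0 : ℝ) ≤ P := P.2
    nlinarith
  have h3 : ∀ r : S.Jam, ENNReal.ofReal (sqNorm r) =
      ∑ i, ∑ j, ENNReal.ofReal (‖r i j‖ ^ 2) := by
    intro r
    unfold sqNorm
    rw [ENNReal.ofReal_sum_of_nonneg fun _ _ => by positivity]
    refine Finset.sum_congr rfl fun i _ => ?_
    rw [ENNReal.ofReal_sum_of_nonneg fun _ _ => by positivity]
  simp_rw [h3]
  rw [lintegral_finsetSum _ fun t _ => by fun_prop]
  have h4 : ∀ i, ∫⁻ r : S.Jam, ∑ j, ENNReal.ofReal (‖r i j‖ ^ 2) ∂S.allJamLaw P ≤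
      ENNReal.ofReal (4 * P) := by
    intro i
    rw [lintegral_finsetSum _ fun t _ => by fun_prop]
    refine (Finset.sum_le_sum fun j _ => h1 i j).trans ?_
    rw [← ENNReal.ofReal_sum_of_nonneg fun _ _ => by positivity]
    refine ENNReal.ofReal_le_ofReal ?_
    rw [Finset.sum_const, Finset.card_univ, Fintype.card_fin, nsmul_eq_mul]
    rcases Nat.eq_zero_or_pos (S.J i) with h0 | h0
    · rw [h0]; simp
    · have : (S.J i : ℝ) ≠ 0 := by exact_mod_cast h0.ne'
      field_simp
      rfl
  refine (Finset.sum_le_sum fun i _ => h4 i).trans ?_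
  rw [Fin.sum_univ_two, ← ENNReal.ofReal_add (by positivity) (by positivity)]
  refine ENNReal.ofReal_le_ofReal ?_
  linarith

/-- Invertible jamming matrix: even without noise the signals are hidden by the jamming. -/
theorem klDiv_received_le_of_det_ne_zero {P : ℝ≥0} (hP : 0 < P) (G : S.Stream → S.Row)
    (hG : (S.jamMatrix G).det ≠ 0) (s : S.Signal) :
    klDiv (((S.allJamLaw P).prod S.noiseLaw).map fun p => S.mix s p.1 G + p.2)
        (((S.allJamLaw P).prod S.noiseLaw).map fun p =>
          S.mix 0 ((√(1 + S.amplification G) : 𝕜) • p.1) G + p.2) ≤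
      ENNReal.ofReal (Fintype.card S.Stream / S.α * (sqNorm s / P)) +
        ENNReal.ofReal (Fintype.card S.Stream * Real.log (1 + S.amplification G)) := by
  obtain ⟨c, hc, hcn⟩ := S.exists_shift G hG s
  set β := S.amplification G with hβ
  have hβ0 : 0 ≤ β := S.amplification_nonneg G
  have hτ : 1 ≤ √(1 + β) := Real.one_le_sqrt.2 (by linarith)
  have hα : (0 : ℝ) < S.α := by exact_mod_cast S.α_pos
  have hP' : (0 : ℝ) < P := by exact_mod_cast hP
  have hm0 : Measurable fun p : S.Jam × (S.Stream → 𝕜) => S.mix 0 p.1 G + p.2 :=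
    (S.measurable_mix.comp (by fun_prop :
      Measurable fun p : S.Jam × (S.Stream → 𝕜) => ((0 : S.Signal), p.1, G))).add measurable_snd
  have h1 : (((S.allJamLaw P).prod S.noiseLaw).map fun p => S.mix s p.1 G + p.2) =
      (((S.allJamLaw P).map (c + ·)).prod S.noiseLaw).map fun p => S.mix 0 p.1 G + p.2 := by
    conv_rhs => rw [← Measure.map_id (μ := S.noiseLaw)]
    rw [Measure.map_prod_map _ _ (by fun_prop) (by fun_prop), Measure.map_map hm0 (by fun_prop)]
    congr 1
    ext1 p
    simp only [Function.comp_apply, Prod.map, id, hc p.1]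
  have h2 : (((S.allJamLaw P).prod S.noiseLaw).map fun p =>
      S.mix 0 ((√(1 + β) : 𝕜) • p.1) G + p.2) =
      (((S.allJamLaw P).map ((√(1 + β) : 𝕜) • ·)).prod S.noiseLaw).map
        fun p => S.mix 0 p.1 G + p.2 := by
    conv_rhs => rw [← Measure.map_id (μ := S.noiseLaw)]
    rw [Measure.map_prod_map _ _ (by fun_prop) (by fun_prop), Measure.map_map hm0 (by fun_prop)]
    rfl
  have := Measure.isProbabilityMeasure_map (μ := S.allJamLaw P) (f := (c + ·)) (by fun_prop)
  have := Measure.isProbabilityMeasure_map (μ := S.allJamLaw P)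
    (f := ((√(1 + β) : 𝕜) • ·)) (by fun_prop)
  rw [h1, h2]
  -- receiving is a function of jamming and noise, and the noise is the same in both laws
  refine (klDiv_map_le _ _ hm0).trans ((klDiv_prod_le _ _ _ _).trans ?_)
  rw [klDiv_self, add_zero]
  have hs := sqNorm_nonneg s
  have hl : 0 ≤ Real.log (1 + β) := Real.log_nonneg (by linarith)
  refine (S.klDiv_allJamLaw_le hP c hτ).trans ?_
  rw [← ENNReal.ofReal_add (by positivity) (by positivity)]
  refine ENNReal.ofReal_le_ofReal ?_
  rw [Real.log_sqrt (by positivity), Real.sq_sqrt (by positivity), add_comm]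
  refine add_le_add ?_ (le_of_eq (by ring))
  rw [div_le_iff₀ (by positivity)]
  have e : Fintype.card S.Stream / S.α * (sqNorm s / P) * ((1 + β) * (S.α * P)) =
      Fintype.card S.Stream * ((1 + β) * sqNorm s) := by field_simp
  rw [e]
  gcongr
  nlinarith

/-- Any jamming matrix: a bound that grows with the logarithm of the power. -/
theorem klDiv_received_le {P : ℝ≥0} (hP : 0 < P) (G : S.Stream → S.Row) (s : S.Signal) :
    klDiv (((S.allJamLaw P).prod S.noiseLaw).map fun p => S.mix s p.1 G + p.2)
        (((S.allJamLaw P).prod S.noiseLaw).map fun p =>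
          (√(1 + S.gain G * P / S.noiseVar) : 𝕜) • p.2) ≤
      ENNReal.ofReal (8 + sqNorm s / P) +
        ENNReal.ofReal (Fintype.card S.Stream * Real.log (1 + S.gain G * P / S.noiseVar)) := by
  have hσ : (0 : ℝ) < S.noiseVar := by exact_mod_cast S.noiseVar_pos
  have hP' : (0 : ℝ) < P := by exact_mod_cast hP
  have hg := S.gain_nonneg G
  have hs := sqNorm_nonneg s
  set τ := √(1 + S.gain G * P / S.noiseVar) with hτdef
  have hτ : 1 ≤ τ := Real.one_le_sqrt.2 (by
    have : 0 ≤ S.gain G * P / S.noiseVar := by positivity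
    linarith)
  have hτ2 : τ ^ 2 * S.noiseVar = S.noiseVar + S.gain G * P := by
    rw [hτdef, Real.sq_sqrt (by positivity)]; field_simp
  have hlogτ : 2 * Real.log τ = Real.log (1 + S.gain G * P / S.noiseVar) := by
    rw [hτdef, Real.log_sqrt (by positivity)]; ring
  have hl : 0 ≤ Real.log (1 + S.gain G * P / S.noiseVar) := by
    rw [← hlogτ]; have := Real.log_nonneg hτ; positivity
  have hm : Measurable (Function.uncurry fun (r : S.Jam) (n : S.Stream → 𝕜) =>
      S.mix s r G + n) :=
    (S.measurable_mix.comp (by fun_prop :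
      Measurable fun p : S.Jam × (S.Stream → 𝕜) => (s, p.1, G))).add measurable_snd
  have e2 : (((S.allJamLaw P).prod S.noiseLaw).map fun p => (τ : 𝕜) • p.2) =
      S.noiseLaw.map ((τ : 𝕜) • ·) := by
    change ((S.allJamLaw P).prod S.noiseLaw).map ((fun n => (τ : 𝕜) • n) ∘ Prod.snd) = _
    rw [← Measure.map_map (by fun_prop) measurable_snd, ← Measure.snd, Measure.snd_prod]
  rw [e2]
  have hsq : Measurable fun r : S.Jam => ENNReal.ofReal (sqNorm r) := by
    unfold sqNorm; fun_prop
  set N := Fintype.card S.Stream with hN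
  -- condition on the jamming signals `r`, so that only the noise is left to hide the shift
  refine (klDiv_map_prod_le_of_snd (S.allJamLaw P) S.noiseLaw hm (by fun_prop)
    (F := fun r => ENNReal.ofReal (N * Real.log (1 + S.gain G * P / S.noiseVar) + sqNorm s / P) +
      ENNReal.ofReal (1 / P) * ENNReal.ofReal (sqNorm r))
    (((hsq.const_mul _).const_add _).aemeasurable) (ae_of_all _ fun r => ?_)).trans ?_
  · refine (klDiv_pi_gaussianScalar_le (fun _ => S.noiseVar_pos.ne') (S.mix s r G) hτ).trans ?_
    have hr := sqNorm_nonneg r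
    rw [← ENNReal.ofReal_mul (by positivity), ← ENNReal.ofReal_add (by positivity) (by positivity)]
    refine ENNReal.ofReal_le_ofReal ?_
    rw [Finset.sum_add_distrib, Finset.sum_const, Finset.card_univ, nsmul_eq_mul, hlogτ,
      ← Finset.sum_div, add_assoc, hτ2]
    gcongr
    rw [div_le_iff₀ (by positivity)]
    refine (S.sum_norm_sq_mix_le s r G).trans ?_
    have e : (sqNorm s / P + 1 / P * sqNorm r) * (S.noiseVar + S.gain G * P) =
        S.gain G * (sqNorm s + sqNorm r) + (sqNorm s + sqNorm r) * S.noiseVar / P := by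
      field_simp; ring
    rw [e]
    have : 0 ≤ (sqNorm s + sqNorm r) * S.noiseVar / P := by positivity
    linarith
  · rw [lintegral_add_left measurable_const, lintegral_const, measure_univ, mul_one,
      lintegral_const_mul _ hsq]
    have h8 := S.lintegral_sqNorm_allJamLaw_le P
    refine (add_le_add_right (mul_le_mul_right h8 _) _).trans ?_
    rw [← ENNReal.ofReal_mul (by positivity), ← ENNReal.ofReal_add (by positivity) (by positivity),
      ← ENNReal.ofReal_add (by positivity) (by positivity)]
    refine ENNReal.ofReal_le_ofReal (le_of_eq ?_)
    field_simp
    ring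

/-! ### Reduction to the strongest eavesdropper -/

/-- The law of channel matrix, jamming and noise for the strongest eavesdropper. -/
noncomputable def fullLaw (P : ℝ≥0) :
    Measure ((S.Stream → S.Row) × S.Jam × (S.Stream → 𝕜)) :=
  S.squareLaw.prod ((S.allJamLaw P).prod S.noiseLaw)

instance (P : ℝ≥0) : IsProbabilityMeasure (S.fullLaw P) := by unfold fullLaw; infer_instance

/-- An eavesdropper's observation, as a function of what the strongest eavesdropper knows: the
antennas outside the range of `f` are ignored. -/
def degrade (e : Eavesdropper) (f : Fin e.antennas → S.Stream)
    (p : (S.Stream → S.Row) × (S.Stream → 𝕜)) : S.Obs e.antennas :=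
  (fun a => p.2 (f a), if e.knowsChannel then fun i a => p.1 (f a) i else 0)

theorem measurable_degrade (e : Eavesdropper) (f : Fin e.antennas → S.Stream) :
    Measurable (S.degrade e f) := by
  unfold degrade
  refine Measurable.prodMk (by fun_prop) ?_
  split_ifs <;> fun_prop

instance (m : ℕ) : StandardBorelSpace (S.Obs m) :=
  StandardBorelSpace.prod (α := Fin m → 𝕜) (β := S.Chan m)

theorem measurable_observe_right (e : Eavesdropper) (s : S.Signal) :
    Measurable (S.observe e s) := by
  have h := (S.measurable_observe e).comp
    (measurable_prodMk_left (x := s) (β := S.Env e.antennas))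
  exact h

theorem useKernel_apply (P : ℝ≥0) (e : Eavesdropper) (s : S.Signal) :
    S.useKernel P e s = (S.envLaw P e.antennas).map (S.observe e s) := by
  rw [useKernel, Kernel.map_apply _ (S.measurable_observe e), Kernel.prod_apply, Kernel.id_apply,
    Kernel.const_apply, Measure.dirac_prod,
    Measure.map_map (S.measurable_observe e) measurable_prodMk_left]
  rfl

theorem blockKernel_apply (P : ℝ≥0) (e : Eavesdropper) (n : ℕ) (s : Fin n → S.Signal) :
    S.blockKernel P e n s = Measure.pi fun k => S.useKernel P e (s k) := by
  have hm := S.measurable_observe_right e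
  have := fun k : Fin n => Measure.isProbabilityMeasure_map (μ := S.envLaw P e.antennas)
    (hm (s k)).aemeasurable
  have h := Measure.pi_map_pi (μ := fun _ : Fin n => S.envLaw P e.antennas)
    (f := fun k => S.observe e (s k)) fun k => (hm (s k)).aemeasurable
  simp_rw [useKernel_apply]
  rw [← h, blockKernel, Kernel.map_apply _ (S.measurable_observe_block e n), Kernel.prod_apply,
    Kernel.id_apply, Kernel.const_apply, Measure.dirac_prod,
    Measure.map_map (S.measurable_observe_block e n) measurable_prodMk_left]
  rfl

/-- The observation of an eavesdropper is a degraded version of that of the strongest one. -/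
theorem useKernel_eq_map_fullLaw (P : ℝ≥0) (e : Eavesdropper) {f : Fin e.antennas → S.Stream}
    (hf : Function.Injective f) (s : S.Signal) :
    S.useKernel P e s =
      ((S.fullLaw P).map fun p => (p.1, S.mix s p.2.1 p.1 + p.2.2)).map (S.degrade e f) := by
  have hmix : Measurable fun p : (S.Stream → S.Row) × S.Jam × (S.Stream → 𝕜) =>
      (p.1, S.mix s p.2.1 p.1 + p.2.2) :=
    measurable_fst.prodMk ((S.measurable_mix.comp (by fun_prop :
      Measurable fun p : (S.Stream → S.Row) × S.Jam × (S.Stream → 𝕜) =>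
        (s, p.2.1, p.1))).add (by fun_prop))
  have hobs := S.measurable_observe_right e s
  have m1 : MeasurePreserving (fun (G : S.Stream → S.Row) i a => G (f a) i) S.squareLaw
      (Measure.pi fun i => Measure.pi fun _ : Fin e.antennas => Measure.pi fun _ : Fin (S.M i) =>
        S.fading) :=
    (measurePreserving_pi_swap (T := Fin e.antennas)
      (fun i => Measure.pi fun _ : Fin (S.M i) => S.fading)).comp
      (measurePreserving_pi_comp S.rowLaw hf)
  have m2 : MeasurePreserving (fun (z : S.Stream → 𝕜) a => z (f a)) S.noiseLaw
      (whiteGaussian 𝕜 e.antennas S.noiseVar) :=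
    measurePreserving_pi_comp (gaussianScalar 𝕜 S.noiseVar) hf
  have m3 : MeasurePreserving (fun p : (S.Stream → S.Row) × S.Jam × (S.Stream → 𝕜) =>
      (p.2.1, p.1, p.2.2)) (S.fullLaw P)
      ((S.allJamLaw P).prod (S.squareLaw.prod S.noiseLaw)) :=
    ((MeasurePreserving.id (S.allJamLaw P)).prod
      (Measure.measurePreserving_swap (μ := S.noiseLaw) (ν := S.squareLaw))).comp
      ((measurePreserving_prodAssoc (S.allJamLaw P) S.noiseLaw S.squareLaw).comp
        (Measure.measurePreserving_swap (μ := S.squareLaw)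
          (ν := (S.allJamLaw P).prod S.noiseLaw)))
  have m4 := ((MeasurePreserving.id (S.allJamLaw P)).prod (m1.prod m2)).comp m3
  have henv : S.envLaw P e.antennas = (S.allJamLaw P).prod
      ((Measure.pi fun i => Measure.pi fun _ : Fin e.antennas => Measure.pi fun _ : Fin (S.M i) =>
        S.fading).prod (whiteGaussian 𝕜 e.antennas S.noiseVar)) := rfl
  rw [useKernel_apply, henv, ← m4.map_eq, Measure.map_map hobs m4.measurable,
    Measure.map_map (S.measurable_degrade e f) hmix]
  congr 1

/-- A reference output law for one channel use, chosen by means of a set `Γ` of channel matrices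
for which the jamming alone hides the signals; for the others the noise has to hide them. -/
theorem exists_reference {P : ℝ≥0} (hP : 0 < P) {Γ : Set (S.Stream → S.Row)}
    (hΓ : MeasurableSet Γ) (hdet : ∀ G ∈ Γ, (S.jamMatrix G).det ≠ 0) (e : Eavesdropper)
    (he : e.antennas ≤ Fintype.card S.Stream) :
    ∃ Q : Measure (S.Obs e.antennas), IsProbabilityMeasure Q ∧ ∀ s,
      klDiv (S.useKernel P e s) Q ≤
        ENNReal.ofReal ((Fintype.card S.Stream / S.α + 1) * (sqNorm s / P)) +
        (8 + (∫⁻ G in Γ, ENNReal.ofReal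
            (Fintype.card S.Stream * Real.log (1 + S.amplification G)) ∂S.squareLaw +
          ∫⁻ G in Γᶜ, ENNReal.ofReal
            (Fintype.card S.Stream * Real.log (1 + S.gain G * P / S.noiseVar)) ∂S.squareLaw)) := by
  classical
  obtain ⟨f⟩ : Nonempty (Fin e.antennas ↪ S.Stream) :=
    Function.Embedding.nonempty_of_card_le (by simpa using he)
  set N := Fintype.card S.Stream with hN
  have hα : (0 : ℝ) < S.α := by exact_mod_cast S.α_pos
  have hP' : (0 : ℝ) < P := by exact_mod_cast hP
  have hgm := S.measurable_gain
  have ham := S.measurable_amplification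
  let ψ : (S.Stream → S.Row) → S.Jam × (S.Stream → 𝕜) → S.Stream → 𝕜 := fun G p =>
    if G ∈ Γ then S.mix 0 ((√(1 + S.amplification G) : 𝕜) • p.1) G + p.2
    else (√(1 + S.gain G * P / S.noiseVar) : 𝕜) • p.2
  have hψ : Measurable (Function.uncurry ψ) := by
    refine Measurable.ite (measurable_fst hΓ) ?_ ?_
    · have h1 : Measurable fun p : (S.Stream → S.Row) × S.Jam × (S.Stream → 𝕜) =>
          ((0 : S.Signal), (√(1 + S.amplification p.1) : 𝕜) • p.2.1, p.1) := by fun_prop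
      exact (S.measurable_mix.comp h1).add (by fun_prop)
    · have h2 : Measurable fun p : (S.Stream → S.Row) × S.Jam × (S.Stream → 𝕜) =>
          (√(1 + S.gain p.1 * P / S.noiseVar) : 𝕜) • p.2.2 := by fun_prop
      exact h2
  have hm1 : Measurable fun p : (S.Stream → S.Row) × S.Jam × (S.Stream → 𝕜) =>
      (p.1, ψ p.1 p.2) := measurable_fst.prodMk hψ
  have := Measure.isProbabilityMeasure_map (μ := S.fullLaw P) hm1.aemeasurable
  refine ⟨((S.fullLaw P).map fun p => (p.1, ψ p.1 p.2)).map (S.degrade e f),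
    Measure.isProbabilityMeasure_map (S.measurable_degrade e f).aemeasurable, fun s => ?_⟩
  rw [S.useKernel_eq_map_fullLaw P e f.injective s]
  refine (klDiv_map_le _ _ (S.measurable_degrade e f)).trans ?_
  have hφ : Measurable (Function.uncurry fun (G : S.Stream → S.Row)
      (p : S.Jam × (S.Stream → 𝕜)) => S.mix s p.1 G + p.2) :=
    (S.measurable_mix.comp (by fun_prop :
      Measurable fun p : (S.Stream → S.Row) × S.Jam × (S.Stream → 𝕜) =>
        (s, p.2.1, p.1))).add (by fun_prop)
  let F1 : (S.Stream → S.Row) → ℝ≥0∞ := fun G =>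
    ENNReal.ofReal (N * Real.log (1 + S.amplification G))
  let F2 : (S.Stream → S.Row) → ℝ≥0∞ := fun G =>
    ENNReal.ofReal (N * Real.log (1 + S.gain G * P / S.noiseVar))
  have hF1 : Measurable F1 := by fun_prop
  have hF2 : Measurable F2 := by fun_prop
  have hF : Measurable fun G => if G ∈ Γ then F1 G else F2 G := Measurable.ite hΓ hF1 hF2
  have hs := sqNorm_nonneg s
  have hmain := klDiv_map_prod_le S.squareLaw ((S.allJamLaw P).prod S.noiseLaw) hφ hψ
    (F := fun G => ENNReal.ofReal ((N / S.α + 1) * (sqNorm s / P)) +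
      (8 + if G ∈ Γ then F1 G else F2 G)) ((hF.const_add _).const_add _).aemeasurable
    (ae_of_all _ fun G => ?_)
  · refine hmain.trans_eq ?_
    rw [lintegral_add_left measurable_const, lintegral_add_left measurable_const, lintegral_const,
      lintegral_const, measure_univ, mul_one, mul_one, ← lintegral_add_compl _ hΓ]
    congr 3
    · exact setLIntegral_congr_fun hΓ fun G hG => if_pos hG
    · exact setLIntegral_congr_fun hΓ.compl fun G hG => if_neg hG
  · by_cases hG : G ∈ Γ
    · simp only [ψ, if_pos hG]
      refine (S.klDiv_received_le_of_det_ne_zero hP G (hdet G hG) s).trans ?_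
      refine add_le_add (ENNReal.ofReal_le_ofReal ?_) le_add_self
      gcongr
      linarith
    · simp only [ψ, if_neg hG]
      refine (S.klDiv_received_le hP G s).trans ?_
      rw [ENNReal.ofReal_add (by norm_num) (by positivity), add_comm (ENNReal.ofReal 8), add_assoc]
      refine add_le_add (ENNReal.ofReal_le_ofReal ?_)
        (le_of_eq (by rw [show ENNReal.ofReal 8 = 8 by norm_num]))
      rw [add_mul, one_mul]
      have : 0 ≤ (N : ℝ) / S.α * (sqNorm s / P) := by positivity
      linarith

/-! ### Information rates -/

theorem ofReal_sum_norm_sq_le_energy (P : ℝ≥0) (i : Fin 2) (s : Fin (S.L i) → 𝕜) :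
    ENNReal.ofReal (∑ l, ‖s l‖ ^ 2) ≤ S.energy P i s := by
  unfold energy
  calc ENNReal.ofReal (∑ l, ‖s l‖ ^ 2)
      = ∫⁻ _, ENNReal.ofReal (∑ l, ‖s l‖ ^ 2) ∂(S.jamLaw P i) := by simp
    _ ≤ _ := by
      refine lintegral_mono fun r => ENNReal.ofReal_le_ofReal ?_
      rw [sum_norm_sq_chanInput]
      have : 0 ≤ ∑ j, ‖r j‖ ^ 2 := by positivity
      linarith

theorem sum_lintegral_sqNorm_le {P : ℝ≥0} {n : ℕ} {μ : Measure (Fin n → S.Signal)}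
    (hμ : S.PowerConstraint P μ) :
    ∑ k, ∫⁻ s, ENNReal.ofReal (sqNorm (s k)) ∂μ ≤ 2 * (n * P) := by
  have h1 : ∀ k, ∫⁻ s : Fin n → S.Signal, ENNReal.ofReal (sqNorm (s k)) ∂μ ≤
      ∑ i, ∫⁻ s, S.energy P i (s k i) ∂μ := by
    intro k
    have e : ∀ s : Fin n → S.Signal, ENNReal.ofReal (sqNorm (s k)) =
        ∑ i, ENNReal.ofReal (∑ l, ‖s k i l‖ ^ 2) := fun s =>
      ENNReal.ofReal_sum_of_nonneg fun _ _ => by positivity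
    simp_rw [e]
    rw [lintegral_finsetSum _ fun i _ => by fun_prop]
    exact Finset.sum_le_sum fun i _ =>
      lintegral_mono fun s => S.ofReal_sum_norm_sq_le_energy P i (s k i)
  refine (Finset.sum_le_sum fun k _ => h1 k).trans ?_
  rw [Finset.sum_comm]
  refine (Finset.sum_le_sum fun i _ => hμ i).trans_eq ?_
  simp

theorem klDiv_blockKernel_le (P : ℝ≥0) (e : Eavesdropper) {n : ℕ} (Q : Measure (S.Obs e.antennas))
    [IsProbabilityMeasure Q] (s : Fin n → S.Signal) :
    klDiv (S.blockKernel P e n s) (Measure.pi fun _ => Q) ≤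
      ∑ k, klDiv (S.useKernel P e (s k)) Q := by
  rw [blockKernel_apply]
  exact klDiv_pi_le _ _

instance {n : ℕ} {K : Fin 2 → ℕ} (f : ∀ i, Fin (K i) → Measure (Fin n → Fin (S.L i) → 𝕜))
    [∀ i w, IsProbabilityMeasure (f i w)] : IsMarkovKernel (S.jointEncoder f) := by
  refine ⟨fun w => ?_⟩
  change IsProbabilityMeasure ((Measure.pi fun i => f i (w i)).map fun x k i => x i k)
  have hm : Measurable fun (x : ∀ i, Fin n → Fin (S.L i) → 𝕜) k i => x i k := by fun_prop
  exact Measure.isProbabilityMeasure_map hm.aemeasurable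

theorem isProbabilityMeasure_messageLaw {K : Fin 2 → ℕ} (hK : ∀ i, 0 < K i) :
    IsProbabilityMeasure (messageLaw K) := by
  have : ∀ i, Nonempty (Fin (K i)) := fun i => ⟨⟨0, hK i⟩⟩
  exact isProbabilityMeasure_uniformOn Set.finite_univ Set.univ_nonempty

/-- A reference output law for one channel use bounds the information rates. -/
theorem rates_le {P : ℝ≥0} (hP : 0 < P) (e : Eavesdropper) {Q : Measure (S.Obs e.antennas)}
    [IsProbabilityMeasure Q] {a : ℝ} (ha : 0 ≤ a) {D : ℝ≥0∞}
    (h : ∀ s, klDiv (S.useKernel P e s) Q ≤ ENNReal.ofReal (a * (sqNorm s / P)) + D) :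
    S.signalRate P e ≤ (ENNReal.ofReal (a * 2) + D) / ENNReal.ofReal (Real.log 2) ∧
      S.messageRate P e ≤ (ENNReal.ofReal (a * 2) + D) / ENNReal.ofReal (Real.log 2) := by
  have hP' : (0 : ℝ) < P := by exact_mod_cast hP
  let F : ∀ n, (Fin n → S.Signal) → ℝ≥0∞ := fun n s =>
    ∑ k, (ENNReal.ofReal (a * (sqNorm (s k) / P)) + D)
  have hsq : Measurable fun s : S.Signal => ENNReal.ofReal (sqNorm s) := by
    unfold sqNorm; fun_prop
  have hsq' : Measurable fun s : S.Signal => ENNReal.ofReal (a * (sqNorm s / P)) := by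
    unfold sqNorm; fun_prop
  have hFm : ∀ n, Measurable (F n) := fun n => Finset.measurable_fun_sum _ fun k _ =>
    (hsq'.comp (measurable_pi_apply k)).add_const D
  have hkl : ∀ n s, klDiv (S.blockKernel P e n s) (Measure.pi fun _ => Q) ≤ F n s := fun n s =>
    (S.klDiv_blockKernel_le P e Q s).trans (Finset.sum_le_sum fun k _ => h (s k))
  have hint : ∀ (n : ℕ) (μ : Measure (Fin n → S.Signal)) [IsProbabilityMeasure μ],
      S.PowerConstraint P μ → ∫⁻ s, F n s ∂μ ≤ n * (ENNReal.ofReal (a * 2) + D) := by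
    intro n μ _ hμ
    have e1 : ∀ k : Fin n, ∫⁻ s, (ENNReal.ofReal (a * (sqNorm (s k) / P)) + D) ∂μ =
        ENNReal.ofReal (a / P) * ∫⁻ s, ENNReal.ofReal (sqNorm (s k)) ∂μ + D := by
      intro k
      rw [lintegral_add_right _ measurable_const, lintegral_const, measure_univ, mul_one,
        ← lintegral_const_mul _ (f := fun s : Fin n → S.Signal => ENNReal.ofReal (sqNorm (s k)))
          (hsq.comp (measurable_pi_apply k))]
      congr 1
      refine lintegral_congr fun s => ?_
      rw [← ENNReal.ofReal_mul (by positivity)]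
      congr 1
      ring
    have e0 : ∫⁻ s, F n s ∂μ =
        ∑ k, ∫⁻ s, (ENNReal.ofReal (a * (sqNorm (s k) / P)) + D) ∂μ :=
      lintegral_finsetSum _ fun k _ => (hsq'.comp (measurable_pi_apply k)).add_const D
    rw [e0]
    simp_rw [e1]
    rw [Finset.sum_add_distrib, ← Finset.mul_sum]
    have e2 := mul_le_mul_right (S.sum_lintegral_sqNorm_le hμ) (ENNReal.ofReal (a / P))
    refine (add_le_add_left e2 _).trans_eq ?_
    rw [Finset.sum_const, Finset.card_univ, Fintype.card_fin, nsmul_eq_mul, mul_add]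
    congr 1
    have e3 : (P : ℝ≥0∞) = ENNReal.ofReal P := by simp
    have e4 : (2 : ℝ≥0∞) = ENNReal.ofReal 2 := by simp
    have e5 : (n : ℝ≥0∞) = ENNReal.ofReal n := by simp
    rw [e3, e4, e5, ← ENNReal.ofReal_mul (by positivity), ← ENNReal.ofReal_mul (by positivity),
      ← ENNReal.ofReal_mul (by positivity), ← ENNReal.ofReal_mul (by positivity)]
    congr 1
    field_simp
  have hdiv : ∀ (n : ℕ) (x : ℝ≥0∞), 0 < n → ∀ I : ℝ≥0∞,
      I ≤ n * x / ENNReal.ofReal (Real.log 2) → I / n ≤ x / ENNReal.ofReal (Real.log 2) := by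
    intro n x hn I hI
    refine ENNReal.div_le_of_le_mul (hI.trans_eq ?_)
    rw [div_eq_mul_inv, div_eq_mul_inv]
    ring
  constructor
  · refine iSup_le fun n => iSup_le fun hn => iSup_le fun μ => iSup_le fun hprob =>
      iSup_le fun hμ => hdiv n _ hn _ ?_
    refine (mutualInfo_le μ (S.blockKernel P e n) (Measure.pi fun _ => Q) (hFm n).aemeasurable
      (ae_of_all _ (hkl n))).trans ?_
    gcongr
    exact hint n μ hμ
  · refine iSup_le fun n => iSup_le fun hn => iSup_le fun K => iSup_le fun hK =>
      iSup_le fun f => iSup_le fun hprob => iSup_le fun hμ => hdiv n _ hn _ ?_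
    have := isProbabilityMeasure_messageLaw hK
    have : ∀ i, Nonempty (Fin (K i)) := fun i => ⟨⟨0, hK i⟩⟩
    -- the encoder is applied first: bound the output for a message by the mean over its codewords
    have hFw : Measurable fun w => ∫⁻ s, F n s ∂(S.jointEncoder f w) :=
      (hFm n).lintegral_kernel
    refine (mutualInfo_le (messageLaw K) (S.blockKernel P e n ∘ₖ S.jointEncoder f)
      (Measure.pi fun _ => Q) hFw.aemeasurable (ae_of_all _ fun w => ?_)).trans ?_
    · rw [Kernel.comp_apply]
      exact klDiv_comp_le (hFm n).aemeasurable (ae_of_all _ (hkl n))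
    · gcongr
      rw [← Measure.lintegral_bind (Kernel.aemeasurable _) (hFm n).aemeasurable]
      exact hint n _ hμ

/-- Without power there is no signal. -/
theorem signalRate_zero (e : Eavesdropper) : S.signalRate 0 e = 0 := by
  refine le_antisymm ?_ zero_le
  refine iSup_le fun n => iSup_le fun hn => iSup_le fun μ => iSup_le fun hprob =>
    iSup_le fun hμ => ?_
  have h0 : ∀ᵐ s ∂μ, s = 0 := by
    have h1 := S.sum_lintegral_sqNorm_le hμ
    have hz : ∀ k, ∫⁻ s, ENNReal.ofReal (sqNorm (s k)) ∂μ = 0 := by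
      have h2 : ∑ k, ∫⁻ s : Fin n → S.Signal, ENNReal.ofReal (sqNorm (s k)) ∂μ = 0 :=
        le_antisymm (by simpa using h1) zero_le
      intro k
      exact (Finset.sum_eq_zero_iff.1 h2) k (Finset.mem_univ k)
    have h3 : ∀ k, ∀ᵐ s ∂μ, s k = 0 := by
      intro k
      have h4 := (lintegral_eq_zero_iff (by unfold sqNorm; fun_prop)).1 (hz k)
      filter_upwards [h4] with s hs
      have h5 : sqNorm (s k) ≤ 0 := ENNReal.ofReal_eq_zero.1 hs
      funext i l
      have h6 : ‖s k i l‖ ^ 2 ≤ sqNorm (s k) := by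
        refine le_trans ?_ (Finset.single_le_sum (f := fun i => ∑ a, ‖s k i a‖ ^ 2)
          (fun _ _ => by positivity) (Finset.mem_univ i))
        exact Finset.single_le_sum (f := fun a => ‖s k i a‖ ^ 2) (fun _ _ => by positivity)
          (Finset.mem_univ l)
      have h7 : ‖s k i l‖ ^ 2 = 0 := le_antisymm (h6.trans h5) (sq_nonneg _)
      simpa using h7
    filter_upwards [ae_all_iff.2 h3] with s hs
    funext k
    exact hs k
  have h := mutualInfo_le μ (S.blockKernel 0 e n) (S.blockKernel 0 e n 0) (F := fun _ => 0)
    aemeasurable_const (by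
      filter_upwards [h0] with s hs
      rw [hs, klDiv_self])
  simp only [lintegral_const, zero_mul, ENNReal.zero_div] at h
  rw [le_antisymm h zero_le, ENNReal.zero_div]

/-- If `E log⁺ (1 / |g - c|)` is bounded in `c`, then so is the information rate in the power. -/
theorem exists_signalRate_le (h : LogRegular S.fading) :
    ∃ C : ℝ≥0, ∀ (P : ℝ≥0) (e : Eavesdropper), e.antennas ≤ Fintype.card S.Stream →
      S.signalRate P e ≤ C := by
  set N := Fintype.card S.Stream with hN
  set I := ∫⁻ G, ENNReal.ofReal (N * Real.log (1 + S.amplification G)) ∂S.squareLaw with hI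
  have hItop : I ≠ ∞ := by
    have hm : Measurable fun G => ENNReal.ofReal (Real.log (1 + S.amplification G)) := by
      have := S.measurable_amplification
      fun_prop
    rw [hI]
    simp_rw [ENNReal.ofReal_mul (Nat.cast_nonneg' N)]
    rw [lintegral_const_mul _ hm]
    exact (ENNReal.mul_lt_top ENNReal.ofReal_lt_top (S.lintegral_log_amplification_lt_top h)).ne
  set C := (ENNReal.ofReal ((N / S.α + 1) * 2) + (8 + I)) / ENNReal.ofReal (Real.log 2) with hC
  have hCtop : C ≠ ∞ := by
    refine (ENNReal.div_lt_top ?_ ?_).ne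
    · simp [hItop]
    · simpa using Real.log_pos one_lt_two
  refine ⟨C.toNNReal, fun P e he => ?_⟩
  rw [ENNReal.coe_toNNReal hCtop]
  rcases eq_zero_or_pos P with rfl | hP
  · rw [signalRate_zero]; exact zero_le
  set Γ := {G | (S.jamMatrix G).det ≠ 0} with hΓ
  have hΓm : MeasurableSet Γ :=
    (S.measurable_det_jamMatrix (measurableSet_singleton 0)).compl
  obtain ⟨Q, _, hQ⟩ := S.exists_reference hP hΓm (fun G hG => hG) e he
  have hnull : S.squareLaw Γᶜ = 0 := S.ae_det_jamMatrix_ne_zero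
  refine (S.rates_le hP e (by positivity) hQ).1.trans ?_
  rw [Measure.restrict_zero_set hnull, lintegral_zero_measure, add_zero, hC]
  gcongr
  exact setLIntegral_le_lintegral _ _

/-! ### Zero degrees of freedom -/

/-- A rate carries zero degrees of freedom if, for every `k`, its growth in `log P` is at most
proportional to `p k`, where `p k` tends to zero. -/
theorem zeroDoF_of_le {rate : ℝ≥0 → ℝ≥0∞} {N : ℝ} (hN : 0 ≤ N) {D p : ℕ → ℝ≥0∞}
    (hD : ∀ k, D k ≠ ∞) (hp : Tendsto p atTop (𝓝 0))
    (h : ∀ k P, 0 < P → rate P ≤ D k + ENNReal.ofReal (N * Real.log (1 + P)) * p k) :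
    ZeroDoF rate := by
  unfold ZeroDoF
  set d : ℝ≥0 → ℝ≥0∞ := fun P => ENNReal.ofReal (1 / 2 * Real.logb 2 P) with hd
  have hl2 : 0 < Real.log 2 := Real.log_pos one_lt_two
  have hdtop : Tendsto d atTop (𝓝 ∞) := by
    refine ENNReal.tendsto_ofReal_nhds_top.2 ?_
    refine Tendsto.const_mul_atTop (by norm_num) ?_
    exact (Real.tendsto_logb_atTop one_lt_two).comp (NNReal.tendsto_coe_atTop.2 tendsto_id)
  rw [ENNReal.tendsto_nhds_zero]
  intro ε hε
  set C := ENNReal.ofReal (4 * N * Real.log 2) with hC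
  have hCp : Tendsto (fun k => C * p k) atTop (𝓝 0) := by
    have := ENNReal.Tendsto.const_mul (a := C) hp (Or.inr ENNReal.ofReal_ne_top)
    rwa [mul_zero] at this
  have hε2 : 0 < ε / 2 := ENNReal.half_pos hε.ne'
  obtain ⟨k, hk⟩ := ((ENNReal.tendsto_nhds_zero.1 hCp) (ε / 2) hε2).exists
  have hDk : Tendsto (fun P => D k / d P) atTop (𝓝 0) := by
    have := ENNReal.Tendsto.const_div (a := D k) hdtop (Or.inr (hD k))
    rwa [ENNReal.div_top] at this
  filter_upwards [(ENNReal.tendsto_nhds_zero.1 hDk) (ε / 2) hε2, eventually_ge_atTop 2]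
    with P hP hP2
  have hP2' : (2 : ℝ) ≤ P := by exact_mod_cast hP2
  have hlogP : 0 < Real.log P := Real.log_pos (by linarith)
  have hd0 : d P ≠ 0 := by
    simp only [hd, ne_eq, ENNReal.ofReal_eq_zero, not_le]
    have := Real.logb_pos one_lt_two (show (1 : ℝ) < P by linarith)
    positivity
  have hlog : ENNReal.ofReal (N * Real.log (1 + P)) ≤ C * d P := by
    rw [hC, hd, ← ENNReal.ofReal_mul (by positivity)]
    refine ENNReal.ofReal_le_ofReal ?_
    have h1 : Real.log (1 + P) ≤ 2 * Real.log P := by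
      have := Real.log_le_log (by positivity) (show (1 + P : ℝ) ≤ (P : ℝ) ^ 2 by nlinarith)
      rwa [Real.log_pow] at this
    have h2 : 4 * N * Real.log 2 * (1 / 2 * Real.logb 2 P) = N * (2 * Real.log P) := by
      rw [Real.logb]; field_simp; ring
    rw [h2]
    gcongr
  calc rate P / d P ≤ (D k + C * d P * p k) / d P := by
        gcongr
        refine (h k P (by positivity)).trans ?_
        gcongr
    _ = D k / d P + C * p k := by
        rw [ENNReal.add_div, mul_right_comm, ENNReal.mul_div_cancel_right hd0 ENNReal.ofReal_ne_top]
    _ ≤ ε / 2 + ε / 2 := add_le_add hP hk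
    _ = ε := ENNReal.add_halves ε

theorem zeroDoF (e : Eavesdropper) (he : e.antennas ≤ Fintype.card S.Stream) :
    ZeroDoF (fun P => S.signalRate P e) ∧ ZeroDoF (fun P => S.messageRate P e) := by
  set N := Fintype.card S.Stream with hN
  have hσ : (0 : ℝ) < S.noiseVar := by exact_mod_cast S.noiseVar_pos
  have hl2 : 0 < Real.log 2 := Real.log_pos one_lt_two
  -- jamming matrices for which the jamming hides the signals up to a bounded factor
  set Γ : ℕ → Set (S.Stream → S.Row) := fun k =>
    {G | (S.jamMatrix G).det ≠ 0 ∧ S.amplification G ≤ k} with hΓ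
  have hΓm : ∀ k, MeasurableSet (Γ k) := fun k =>
    (S.measurable_det_jamMatrix (measurableSet_singleton 0)).compl.inter
      (measurableSet_le S.measurable_amplification measurable_const)
  have hp : Tendsto (fun k => S.squareLaw (Γ k)ᶜ) atTop (𝓝 0) := by
    have hanti : Antitone fun k => (Γ k)ᶜ := by
      intro k k' hkk'
      refine Set.compl_subset_compl.2 fun G hG => ⟨hG.1, hG.2.trans ?_⟩
      exact_mod_cast hkk'
    have h1 := tendsto_measure_iInter_atTop (μ := S.squareLaw)
      (fun k => (hΓm k).compl.nullMeasurableSet) hanti ⟨0, measure_ne_top _ _⟩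
    have h2 : S.squareLaw (⋂ k, (Γ k)ᶜ) = 0 := by
      refine measure_mono_null (fun G hG => ?_) S.ae_det_jamMatrix_ne_zero
      rw [Set.mem_iInter] at hG
      intro hdet
      obtain ⟨k, hk⟩ := exists_nat_ge (S.amplification G)
      exact hG k ⟨hdet, hk⟩
    rwa [h2] at h1
  have hgain := S.lintegral_gain_lt_top
  have hgm : Measurable fun G => ENNReal.ofReal (S.gain G) :=
    ENNReal.measurable_ofReal.comp S.measurable_gain
  set I := ∫⁻ G, ENNReal.ofReal (S.gain G) ∂S.squareLaw with hI
  let L2 := ENNReal.ofReal (Real.log 2)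
  let D : ℕ → ℝ≥0∞ := fun k => (ENNReal.ofReal ((N / S.α + 1) * 2) +
    (8 + (ENNReal.ofReal (N * Real.log (1 + k)) + ENNReal.ofReal (N / S.noiseVar) * I))) / L2
  have hD : ∀ k, D k ≠ ∞ := by
    intro k
    refine (ENNReal.div_lt_top ?_ ?_).ne
    · have := (ENNReal.mul_lt_top (ENNReal.ofReal_lt_top (r := N / S.noiseVar)) hgain).ne
      exact ENNReal.add_ne_top.2 ⟨ENNReal.ofReal_ne_top, ENNReal.add_ne_top.2
        ⟨ENNReal.ofNat_ne_top (n := 8), ENNReal.add_ne_top.2 ⟨ENNReal.ofReal_ne_top, this⟩⟩⟩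
    · simpa [L2] using hl2
  have key : ∀ k P, 0 < P → S.signalRate P e ≤
        D k + ENNReal.ofReal (N / Real.log 2 * Real.log (1 + P)) * S.squareLaw (Γ k)ᶜ ∧
      S.messageRate P e ≤
        D k + ENNReal.ofReal (N / Real.log 2 * Real.log (1 + P)) * S.squareLaw (Γ k)ᶜ := by
    intro k P hP
    have hP' : (0 : ℝ) < P := by exact_mod_cast hP
    have hlP : 0 ≤ Real.log (1 + P) := Real.log_nonneg (by linarith)
    obtain ⟨Q, _, hQ⟩ := S.exists_reference hP (hΓm k) (fun G hG => hG.1) e he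
    have hle : (ENNReal.ofReal ((N / S.α + 1) * 2) + (8 + (∫⁻ G in Γ k, ENNReal.ofReal
            (N * Real.log (1 + S.amplification G)) ∂S.squareLaw +
          ∫⁻ G in (Γ k)ᶜ, ENNReal.ofReal
            (N * Real.log (1 + S.gain G * P / S.noiseVar)) ∂S.squareLaw))) / L2 ≤
        D k + ENNReal.ofReal (N / Real.log 2 * Real.log (1 + P)) * S.squareLaw (Γ k)ᶜ := by
      have h1 : ∫⁻ G in Γ k, ENNReal.ofReal (N * Real.log (1 + S.amplification G)) ∂S.squareLaw ≤
          ENNReal.ofReal (N * Real.log (1 + k)) := by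
        refine (setLIntegral_mono (g := fun _ => ENNReal.ofReal (N * Real.log (1 + k)))
          measurable_const fun G hG => ENNReal.ofReal_le_ofReal ?_).trans ?_
        · have := S.amplification_nonneg G
          have := hG.2
          gcongr
        · rw [setLIntegral_const]
          exact mul_le_of_le_one_right' prob_le_one
      have h2 : ∫⁻ G in (Γ k)ᶜ, ENNReal.ofReal
            (N * Real.log (1 + S.gain G * P / S.noiseVar)) ∂S.squareLaw ≤
          ENNReal.ofReal (N / S.noiseVar) * I +
            ENNReal.ofReal (N * Real.log (1 + P)) * S.squareLaw (Γ k)ᶜ := by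
        have h3 : ∀ G, ENNReal.ofReal (N * Real.log (1 + S.gain G * P / S.noiseVar)) ≤
            ENNReal.ofReal (N / S.noiseVar) * ENNReal.ofReal (S.gain G) +
              ENNReal.ofReal (N * Real.log (1 + P)) := by
          intro G
          have hg := S.gain_nonneg G
          rw [← ENNReal.ofReal_mul (by positivity),
            ← ENNReal.ofReal_add (by positivity) (by positivity)]
          refine ENNReal.ofReal_le_ofReal ?_
          have h4 : 1 + S.gain G * P / S.noiseVar ≤ (1 + S.gain G / S.noiseVar) * (1 + P) := by
            have e1 : (1 + S.gain G / S.noiseVar) * (1 + P) = 1 + S.gain G * P / S.noiseVar +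
              (P + S.gain G / S.noiseVar) := by ring
            rw [e1]
            have : 0 ≤ S.gain G / S.noiseVar := by positivity
            linarith
          have h5 := Real.log_le_log (by positivity) h4
          rw [Real.log_mul (by positivity) (by positivity)] at h5
          have h6 := Real.log_le_sub_one_of_pos (show 0 < 1 + S.gain G / S.noiseVar by positivity)
          have h7 : N / S.noiseVar * S.gain G + N * Real.log (1 + P) =
              N * (S.gain G / S.noiseVar + Real.log (1 + P)) := by ring
          rw [h7]
          gcongr
          linarith
        refine (lintegral_mono h3).trans ?_
        rw [lintegral_add_right _ measurable_const, setLIntegral_const,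
          lintegral_const_mul _ hgm]
        gcongr
        exact setLIntegral_le_lintegral _ _
      have h8 : ENNReal.ofReal (N / Real.log 2 * Real.log (1 + P)) =
          ENNReal.ofReal (N * Real.log (1 + P)) / L2 := by
        rw [← ENNReal.ofReal_div_of_pos hl2]
        congr 1
        ring
      have h9 : ENNReal.ofReal (N * Real.log (1 + P)) / L2 * S.squareLaw (Γ k)ᶜ =
          ENNReal.ofReal (N * Real.log (1 + P)) * S.squareLaw (Γ k)ᶜ / L2 := by
        rw [div_eq_mul_inv, div_eq_mul_inv, mul_right_comm]
      rw [h8, h9, ← ENNReal.add_div]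
      refine ENNReal.div_le_div_right ?_ _
      refine (add_le_add_right (add_le_add_right (add_le_add h1 h2) _) _).trans_eq ?_
      simp only [add_assoc]
    have hr := S.rates_le hP e (by positivity) hQ
    exact ⟨hr.1.trans hle, hr.2.trans hle⟩
  exact ⟨zeroDoF_of_le (by positivity) hD hp fun k P hP => (key k P hP).1,
    zeroDoF_of_le (by positivity) hD hp fun k P hP => (key k P hP).2⟩

end System

/-! ### Soft covering by random codewords -/

/-- The concavity of the logarithm, used in the form `log g ≤ log c + g / c - 1` in the `v`-th term
of `g * log g`, where `g` is the mean of the `y v`. The choice `c = 1 + y v / b` is an upper bound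
for the mean of `g` given `y v`, if the other terms have mean one. -/
theorem klFun_mean_add_le {V : Type*} [Fintype V] [Nonempty V] (y : V → ℝ) (hy : ∀ v, 0 ≤ y v) :
    klFun ((Fintype.card V : ℝ)⁻¹ * ∑ v, y v) + 2 * ((Fintype.card V : ℝ)⁻¹ * ∑ v, y v) ≤
      (Fintype.card V : ℝ)⁻¹ * ∑ v, y v * Real.log (1 + y v / Fintype.card V) +
      (Fintype.card V : ℝ)⁻¹ * ∑ v, (Fintype.card V : ℝ)⁻¹ *
        ∑ u, y v / (1 + y v / Fintype.card V) * y u + 1 := by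
  set b := (Fintype.card V : ℝ) with hb
  have hb0 : 0 < b := by rw [hb]; exact_mod_cast Fintype.card_pos
  set g := b⁻¹ * ∑ v, y v with hg
  have hg0 : 0 ≤ g := mul_nonneg (by positivity) (Finset.sum_nonneg fun v _ => hy v)
  have h1 : ∀ v, y v * (Real.log g + 1) ≤
      y v * Real.log (1 + y v / b) + b⁻¹ * ∑ u, y v / (1 + y v / b) * y u := by
    intro v
    have hc : 0 < 1 + y v / b := by have := hy v; positivity
    rw [← Finset.mul_sum]
    have e : b⁻¹ * (y v / (1 + y v / b) * ∑ u, y u) = y v * (g / (1 + y v / b)) := by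
      rw [hg]; ring
    rw [e, ← mul_add]
    rcases hg0.eq_or_lt with h0 | h0
    · have hs : ∑ u, y u = 0 := by
        rcases mul_eq_zero.1 (hg ▸ h0.symm : b⁻¹ * ∑ v, y v = 0) with h | h
        · exact absurd h (by positivity)
        · exact h
      rw [(Finset.sum_eq_zero_iff_of_nonneg fun v _ => hy v).1 hs v (Finset.mem_univ v)]
      simp
    · refine mul_le_mul_of_nonneg_left ?_ (hy v)
      have h2 := Real.log_le_sub_one_of_pos (div_pos h0 hc)
      rw [Real.log_div h0.ne' hc.ne'] at h2
      linarith
  have h3 := mul_le_mul_of_nonneg_left (Finset.sum_le_sum fun v (_ : v ∈ Finset.univ) => h1 v)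
    (inv_nonneg.2 hb0.le)
  rw [← Finset.sum_mul, ← mul_assoc, ← hg, Finset.sum_add_distrib, mul_add] at h3
  rw [klFun_apply]
  linarith

theorem lintegral_pi_eval {V X : Type*} [Fintype V] [MeasurableSpace X] (μ : Measure X)
    [IsProbabilityMeasure μ] {h : X → ℝ≥0∞} (hh : Measurable h) (v : V) :
    ∫⁻ C, h (C v) ∂(Measure.pi fun _ : V => μ) = ∫⁻ x, h x ∂μ :=
  (measurePreserving_eval (fun _ : V => μ) v).lintegral_comp hh

theorem lintegral_pi_eval_mul {V X : Type*} [Fintype V] [MeasurableSpace X] (μ : Measure X)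
    [IsProbabilityMeasure μ] {g h : X → ℝ≥0∞} (hg : Measurable g) (hh : Measurable h) {u v : V}
    (huv : u ≠ v) :
    ∫⁻ C, g (C u) * h (C v) ∂(Measure.pi fun _ : V => μ) =
      (∫⁻ x, g x ∂μ) * ∫⁻ x, h x ∂μ := by
  classical
  have hi := (iIndepFun_pi (μ := fun _ : V => μ) (X := fun _ x => x)
    (fun _ => aemeasurable_id)).indepFun huv
  have := lintegral_mul_eq_lintegral_mul_lintegral_of_indepFun
    (hg.comp (measurable_pi_apply u)) (hh.comp (measurable_pi_apply v)) (hi.comp hg hh)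
  rw [← lintegral_pi_eval μ hg u, ← lintegral_pi_eval μ hh v]
  exact this

/-- Soft covering at a single output: if `h x` is the likelihood of the output under the input `x`,
of mean one, then the mean of `h` over `b` random inputs is close to one as soon as `log b`
dominates the information density `log (h x)`. -/
theorem lintegral_klFun_mean_le {V X : Type*} [Fintype V] [Nonempty V] [MeasurableSpace X]
    (μ : Measure X) [IsProbabilityMeasure μ] {h : X → ℝ≥0} (hh : Measurable h)
    (h1 : ∫⁻ x, h x ∂μ = 1) :
    ∫⁻ C, ENNReal.ofReal (klFun ((Fintype.card V : ℝ)⁻¹ * ∑ v, (h (C v) : ℝ)))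
        ∂(Measure.pi fun _ : V => μ) ≤
      ∫⁻ x, h x * ENNReal.ofReal (Real.log (1 + h x / Fintype.card V)) ∂μ := by
  classical
  set bn := Fintype.card V with hbn
  have hb0 : (0 : ℝ) < bn := by exact_mod_cast Fintype.card_pos
  have hb0' : (bn : ℝ≥0∞) ≠ 0 := by
    rw [Nat.cast_ne_zero, hbn]; exact Fintype.card_ne_zero
  have hbt : (bn : ℝ≥0∞) ≠ ∞ := ENNReal.natCast_ne_top _
  set β : ℝ≥0∞ := ENNReal.ofReal (bn : ℝ)⁻¹ with hβ
  have hβ' : β = (bn : ℝ≥0∞)⁻¹ := by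
    rw [hβ, ENNReal.ofReal_inv_of_pos hb0, ENNReal.ofReal_natCast]
  have hβb : β * bn = 1 := by rw [hβ', ENNReal.inv_mul_cancel hb0' hbt]
  let r : X → ℝ≥0∞ := fun x => h x * ENNReal.ofReal (Real.log (1 + h x / bn))
  let a : X → ℝ≥0∞ := fun x => ENNReal.ofReal (h x / (1 + h x / bn))
  let h' : X → ℝ≥0∞ := fun x => h x
  have hr : Measurable r := by fun_prop
  have ha : Measurable a := by fun_prop
  have hh' : Measurable h' := by fun_prop
  have hah : Measurable fun x => a x * h' x := ha.mul hh'
  have hpt : ∀ C : V → X,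
      ENNReal.ofReal (klFun ((bn : ℝ)⁻¹ * ∑ v, (h (C v) : ℝ))) + 2 * (β * ∑ v, h' (C v)) ≤
        β * ∑ v, r (C v) + β * ∑ v, β * ∑ u, a (C v) * h' (C u) + 1 := by
    intro C
    have hs : 0 ≤ ∑ v, (h (C v) : ℝ) := Finset.sum_nonneg fun v _ => (h (C v)).2
    have h2 := ENNReal.ofReal_le_ofReal
      (klFun_mean_add_le (fun v => (h (C v) : ℝ)) fun v => (h (C v)).2)
    have hl : ∀ v, 0 ≤ Real.log (1 + (h (C v) : ℝ) / bn) := fun v =>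
      Real.log_nonneg (le_add_of_nonneg_right (by positivity))
    have n1 : ∀ v, 0 ≤ (h (C v) : ℝ) * Real.log (1 + (h (C v) : ℝ) / bn) := fun v =>
      mul_nonneg (h (C v)).2 (hl v)
    have n2 : ∀ v u, 0 ≤ (h (C v) : ℝ) / (1 + (h (C v) : ℝ) / bn) * h (C u) := fun v u => by
      positivity
    have n3 : ∀ v, 0 ≤ (bn : ℝ)⁻¹ * ∑ u, (h (C v) : ℝ) / (1 + (h (C v) : ℝ) / bn) * h (C u) :=
      fun v => mul_nonneg (by positivity) (Finset.sum_nonneg fun u _ => n2 v u)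
    have m1 := mul_nonneg (inv_nonneg.2 hb0.le) (Finset.sum_nonneg fun v
      (_ : v ∈ Finset.univ) => n1 v)
    have m3 := mul_nonneg (inv_nonneg.2 hb0.le) (Finset.sum_nonneg fun v
      (_ : v ∈ Finset.univ) => n3 v)
    rw [ENNReal.ofReal_add (klFun_nonneg (by positivity)) (by positivity),
      ENNReal.ofReal_add (add_nonneg m1 m3) zero_le_one, ENNReal.ofReal_add m1 m3,
      ENNReal.ofReal_mul (by positivity), ENNReal.ofReal_mul (by positivity),
      ENNReal.ofReal_mul (by positivity), ENNReal.ofReal_mul (by positivity),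
      ENNReal.ofReal_sum_of_nonneg fun v _ => n1 v, ENNReal.ofReal_sum_of_nonneg fun v _ => n3 v,
      ENNReal.ofReal_sum_of_nonneg fun v _ => NNReal.coe_nonneg (h (C v)), ENNReal.ofReal_one] at h2
    convert h2 using 2
    · simp [h', hβ, hbn]
    · congr 1
      · congr 1
        refine Finset.sum_congr rfl fun v _ => ?_
        rw [ENNReal.ofReal_mul (NNReal.coe_nonneg (h (C v)))]
        simp [r, hbn]
      · congr 1
        refine Finset.sum_congr rfl fun v _ => ?_
        rw [ENNReal.ofReal_mul (by positivity), ENNReal.ofReal_sum_of_nonneg fun u _ => n2 v u]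
        congr 1
        refine Finset.sum_congr rfl fun u _ => ?_
        rw [ENNReal.ofReal_mul (by positivity)]
        simp [a, h', hbn]
  have e1 : ∀ {k : X → ℝ≥0∞}, Measurable k →
      ∫⁻ C, β * ∑ v, k (C v) ∂(Measure.pi fun _ : V => μ) = ∫⁻ x, k x ∂μ := by
    intro k hk
    have hkv : ∀ v, Measurable fun C : V → X => k (C v) := fun v =>
      hk.comp (measurable_pi_apply v)
    rw [lintegral_const_mul _ (Finset.measurable_fun_sum _ fun v _ => hkv v),
      lintegral_finsetSum _ fun v _ => hkv v]
    simp_rw [lintegral_pi_eval μ hk]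
    rw [Finset.sum_const, Finset.card_univ, nsmul_eq_mul, ← mul_assoc, hβb, one_mul]
  have hm2 : ∀ v u : V, Measurable fun C : V → X => a (C v) * h' (C u) := fun v u =>
    (ha.comp (measurable_pi_apply v)).mul (hh'.comp (measurable_pi_apply u))
  have e2 : ∫⁻ C, β * ∑ v, β * ∑ u, a (C v) * h' (C u) ∂(Measure.pi fun _ : V => μ) ≤ 1 := by
    have h3 : ∀ v, ∫⁻ C, β * ∑ u, a (C v) * h' (C u) ∂(Measure.pi fun _ : V => μ) ≤ 1 := by
      intro v
      -- the terms with `u ≠ v` factorise, as the codewords are independent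
      have h4 : ∀ u, ∫⁻ C, a (C v) * h' (C u) ∂(Measure.pi fun _ : V => μ) ≤
          (if u = v then ∫⁻ x, a x * h' x ∂μ else 0) + ∫⁻ x, a x ∂μ := by
        intro u
        by_cases huv : u = v
        · subst huv
          rw [if_pos rfl, lintegral_pi_eval μ hah u]
          exact le_self_add
        · rw [lintegral_pi_eval_mul μ ha hh' (Ne.symm huv), if_neg huv, zero_add]
          exact (congrArg _ h1).trans (mul_one _) |>.le
      rw [lintegral_const_mul _ (Finset.measurable_fun_sum _ fun u _ => hm2 v u),
        lintegral_finsetSum _ fun u _ => hm2 v u]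
      calc β * ∑ u, ∫⁻ C, a (C v) * h' (C u) ∂(Measure.pi fun _ : V => μ)
          ≤ β * ∑ u, ((if u = v then ∫⁻ x, a x * h' x ∂μ else 0) + ∫⁻ x, a x ∂μ) := by
            gcongr with u _; exact h4 u
        _ = ∫⁻ x, (β * (a x * h' x) + a x) ∂μ := by
            rw [Finset.sum_add_distrib, Finset.sum_ite_eq' Finset.univ v,
              if_pos (Finset.mem_univ _),
              Finset.sum_const, Finset.card_univ, nsmul_eq_mul, mul_add, ← mul_assoc β (bn : ℝ≥0∞),
              hβb, one_mul, lintegral_add_right _ ha, lintegral_const_mul _ hah]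
        _ = ∫⁻ x, h' x ∂μ := by
            -- `(y / c) * (y / b + 1) = y`, by the choice of `c = 1 + y / b`
            refine lintegral_congr fun x => ?_
            have hx : (0 : ℝ) ≤ h x := (h x).2
            have hx' : h' x = ENNReal.ofReal (h x) := by simp [h']
            rw [hx', hβ, ← ENNReal.ofReal_mul (by positivity), ← ENNReal.ofReal_mul (by positivity),
              ← ENNReal.ofReal_add (by positivity) (by positivity)]
            congr 1
            field_simp
            ring
        _ = 1 := h1
    rw [lintegral_const_mul _ (by fun_prop), lintegral_finsetSum _ (by fun_prop)]
    calc β * ∑ v, ∫⁻ C, β * ∑ u, a (C v) * h' (C u) ∂(Measure.pi fun _ : V => μ)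
        ≤ β * ∑ v : V, 1 := by gcongr with v _; exact h3 v
      _ = 1 := by
        rw [Finset.sum_const, Finset.card_univ, nsmul_eq_mul, mul_one, hβb]
  have h5 := lintegral_mono (μ := Measure.pi fun _ : V => μ) hpt
  rw [lintegral_add_right _ (by fun_prop), lintegral_const_mul _ (by fun_prop), e1 hh',
    lintegral_add_right _ measurable_const, lintegral_add_left (by fun_prop), e1 hr,
    lintegral_const, measure_univ, mul_one] at h5
  have h6 : ∫⁻ x, h' x ∂μ = 1 := h1
  rw [h6, mul_one] at h5
  refine (ENNReal.add_le_add_iff_right (ENNReal.ofNat_ne_top (n := 2))).1 (h5.trans ?_)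
  rw [add_assoc, ← one_add_one_eq_two]
  gcongr

/-! ### Densities of channels and of their block extensions -/

theorem lintegral_pi_prod {ι : Type*} [Fintype ι] {X : ι → Type*} [∀ i, MeasurableSpace (X i)]
    (μ : ∀ i, Measure (X i)) [∀ i, IsProbabilityMeasure (μ i)] {g : ∀ i, X i → ℝ≥0∞}
    (hg : ∀ i, Measurable (g i)) :
    ∫⁻ x, ∏ i, g i (x i) ∂Measure.pi μ = ∏ i, ∫⁻ x, g i x ∂μ i := by
  rw [lintegral_prod_eq_prod_lintegral_of_indepFun Finset.univ (fun i (x : ∀ i, X i) => g i (x i))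
    (iIndepFun_pi fun i => (hg i).aemeasurable) fun i => (hg i).comp (measurable_pi_apply i)]
  exact Finset.prod_congr rfl fun i _ => (measurePreserving_eval μ i).lintegral_comp (hg i)

theorem pi_withDensity {ι : Type*} [Fintype ι] {X : ι → Type*} [∀ i, MeasurableSpace (X i)]
    (μ : ∀ i, Measure (X i)) [∀ i, IsProbabilityMeasure (μ i)] {g : ∀ i, X i → ℝ≥0∞}
    (hg : ∀ i, Measurable (g i)) [∀ i, SigmaFinite ((μ i).withDensity (g i))] :
    Measure.pi (fun i => (μ i).withDensity (g i)) =
      (Measure.pi μ).withDensity fun x => ∏ i, g i (x i) := by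
  refine Measure.pi_eq fun s hs => ?_
  rw [withDensity_apply _ (MeasurableSet.univ_pi hs),
    ← lintegral_indicator (MeasurableSet.univ_pi hs)]
  have h : ∀ x : ∀ i, X i, (Set.univ.pi s).indicator (fun x => ∏ i, g i (x i)) x =
      ∏ i, (s i).indicator (g i) (x i) := by
    intro x
    by_cases hx : x ∈ Set.univ.pi s
    · rw [Set.indicator_of_mem hx]
      exact Finset.prod_congr rfl fun i _ => (Set.indicator_of_mem (hx i (Set.mem_univ i)) _).symm
    · rw [Set.indicator_of_notMem hx]
      obtain ⟨i, hi⟩ : ∃ i, x i ∉ s i := by simpa using hx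
      exact (Finset.prod_eq_zero (Finset.mem_univ i) (Set.indicator_of_notMem hi _)).symm
  simp_rw [h]
  rw [lintegral_pi_prod μ fun i => (hg i).indicator (hs i)]
  exact Finset.prod_congr rfl fun i _ => by
    rw [lintegral_indicator (hs i), withDensity_apply _ (hs i)]

/-- `f x` is a density, with respect to `Q`, of the output law of the channel `κ` for almost every
input `x`. The density is taken to be finite everywhere. -/
structure IsChannelDensity {X Z : Type*} [MeasurableSpace X] [MeasurableSpace Z] (μ : Measure X)
    (κ : Kernel X Z) (Q : Measure Z) (f : X → Z → ℝ≥0) : Prop where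
  measurable : Measurable (Function.uncurry f)
  eq_withDensity : ∀ᵐ x ∂μ, κ x = Q.withDensity fun z => f x z

namespace IsChannelDensity

variable {X Z : Type*} [MeasurableSpace X] [MeasurableSpace Z] {μ : Measure X} {κ : Kernel X Z}
  {Q : Measure Z} {f : X → Z → ℝ≥0}

theorem exists_of_klDiv_ne_top [MeasurableSpace.CountablyGenerated Z] [IsProbabilityMeasure μ]
    [IsMarkovKernel κ] [IsProbabilityMeasure Q] (h : klDiv (μ ⊗ₘ κ) (μ.prod Q) ≠ ∞) :
    ∃ f, IsChannelDensity μ κ Q f := by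
  have hac := (klDiv_ne_top_iff.1 h).1
  rw [← Measure.compProd_const] at hac
  refine ⟨fun x z => (κ.rnDeriv (Kernel.const X Q) x z).toNNReal,
    ENNReal.measurable_toNNReal.comp (Kernel.measurable_rnDeriv κ _), ?_⟩
  filter_upwards [hac.kernel_of_compProd] with x hx
  rw [← Kernel.withDensity_rnDeriv_eq hx,
    Kernel.withDensity_apply _ (Kernel.measurable_rnDeriv κ _),
    Kernel.const_apply]
  refine withDensity_congr_ae ?_
  filter_upwards [Kernel.rnDeriv_ne_top κ (Kernel.const X Q) (a := x)] with z hz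
  exact (ENNReal.coe_toNNReal hz).symm

theorem measurable_coe (h : IsChannelDensity μ κ Q f) :
    Measurable fun p : X × Z => (f p.1 p.2 : ℝ≥0∞) :=
  ENNReal.continuous_coe.measurable.comp h.measurable

theorem compProd_eq [IsProbabilityMeasure μ] [IsMarkovKernel κ] [IsProbabilityMeasure Q]
    (h : IsChannelDensity μ κ Q f) :
    μ ⊗ₘ κ = (μ.prod Q).withDensity fun p => f p.1 p.2 := by
  ext s hs
  rw [Measure.compProd_apply hs, withDensity_apply _ hs, ← lintegral_indicator hs,
    lintegral_prod _ (h.measurable_coe.indicator hs).aemeasurable]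
  refine lintegral_congr_ae ?_
  filter_upwards [h.eq_withDensity] with x hx
  have hsx : MeasurableSet (Prod.mk x ⁻¹' s) := measurable_prodMk_left hs
  rw [hx, withDensity_apply _ hsx, ← lintegral_indicator hsx]
  rfl

/-- The mean over the inputs of the likelihood of an output is one, if the reference law is the law
of the output. -/
theorem lintegral_eq_one [IsProbabilityMeasure μ] [IsMarkovKernel κ]
    (h : IsChannelDensity μ κ (κ ∘ₘ μ) f) :
    ∀ᵐ z ∂(κ ∘ₘ μ), ∫⁻ x, f x z ∂μ = 1 := by
  have hm : Measurable fun p : Z × X => (f p.2 p.1 : ℝ≥0∞) :=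
    h.measurable_coe.comp measurable_swap
  refine ae_eq_of_forall_setLIntegral_eq_of_sigmaFinite hm.lintegral_prod_right'
    measurable_const fun s hs _ => ?_
  have h1 : (μ ⊗ₘ κ) (Prod.snd ⁻¹' s) = (κ ∘ₘ μ) s := by
    rw [← Measure.snd_compProd, Measure.snd_apply hs]
  rw [h.compProd_eq, withDensity_apply _ (measurable_snd hs)] at h1
  rw [setLIntegral_one, ← h1, ← Set.univ_prod, ← Measure.prod_restrict, Measure.restrict_univ,
    lintegral_prod_symm _ h.measurable_coe.aemeasurable]

/-- Memoryless block channels have product densities. -/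
theorem pi [IsProbabilityMeasure μ] [IsMarkovKernel κ] [IsProbabilityMeasure Q]
    (h : IsChannelDensity μ κ Q f) {n : ℕ} {κn : Kernel (Fin n → X) (Fin n → Z)}
    (hκn : ∀ x, κn x = Measure.pi fun k => κ (x k)) :
    IsChannelDensity (Measure.pi fun _ : Fin n => μ) κn (Measure.pi fun _ : Fin n => Q)
      fun x z => ∏ k, f (x k) (z k) := by
  refine ⟨Finset.measurable_fun_prod _ fun k _ => ?_, ?_⟩
  · have : Measurable fun p : (Fin n → X) × (Fin n → Z) => (p.1 k, p.2 k) := by fun_prop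
    exact h.measurable.comp this
  · have h1 : ∀ᵐ x ∂(Measure.pi fun _ : Fin n => μ), ∀ k,
        κ (x k) = Q.withDensity fun z => f (x k) z :=
      ae_all_iff.2 fun k => (measurePreserving_eval (fun _ : Fin n => μ)
        k).quasiMeasurePreserving.ae
        h.eq_withDensity
    filter_upwards [h1] with x hx
    have hk : ∀ k, IsProbabilityMeasure (Q.withDensity fun z => (f (x k) z : ℝ≥0∞)) := fun k => by
      rw [← hx k]; infer_instance
    have hm : ∀ k, Measurable fun z => (f (x k) z : ℝ≥0∞) := fun k =>
      h.measurable_coe.comp measurable_prodMk_left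
    rw [hκn, funext hx, pi_withDensity (fun _ : Fin n => Q) hm]
    simp

theorem lintegral_pi_eq_one [IsProbabilityMeasure μ] [IsMarkovKernel κ]
    (h : IsChannelDensity μ κ (κ ∘ₘ μ) f) (n : ℕ) :
    ∀ᵐ z ∂(Measure.pi fun _ : Fin n => κ ∘ₘ μ),
      ∫⁻ x, (∏ k, f (x k) (z k) : ℝ≥0) ∂(Measure.pi fun _ : Fin n => μ) = 1 := by
  have h1 : ∀ᵐ z ∂(Measure.pi fun _ : Fin n => κ ∘ₘ μ), ∀ k, ∫⁻ x, f x (z k) ∂μ = 1 :=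
    ae_all_iff.2 fun k => (measurePreserving_eval (fun _ : Fin n => κ ∘ₘ μ)
      k).quasiMeasurePreserving.ae h.lintegral_eq_one
  filter_upwards [h1] with z hz
  have hm : ∀ k, Measurable fun x => (f x (z k) : ℝ≥0∞) := fun k =>
    h.measurable_coe.comp measurable_prodMk_right
  simp_rw [ENNReal.ofNNReal_finsetProd]
  rw [lintegral_pi_prod (fun _ : Fin n => μ) hm]
  simp [hz]

/-- Change of variables from independent inputs and outputs, weighted by the likelihood, to
memoryless uses of the channel. -/
theorem lintegral_pi_mul [IsProbabilityMeasure μ] [IsMarkovKernel κ] [IsProbabilityMeasure Q]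
    (h : IsChannelDensity μ κ Q f) (n : ℕ) {g : ℝ≥0 → ℝ≥0∞} (hg : Measurable g) :
    ∫⁻ z, ∫⁻ x, (∏ k, f (x k) (z k) : ℝ≥0) * g (∏ k, f (x k) (z k))
        ∂(Measure.pi fun _ : Fin n => μ) ∂(Measure.pi fun _ : Fin n => Q) =
      ∫⁻ ω, g (∏ k, f (ω k).1 (ω k).2) ∂(Measure.pi fun _ : Fin n => μ ⊗ₘ κ) := by
  have hm : ∀ _ : Fin n, Measurable fun p : X × Z => (f p.1 p.2 : ℝ≥0∞) :=
    fun _ => h.measurable_coe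
  have hk : IsProbabilityMeasure ((μ.prod Q).withDensity fun p => (f p.1 p.2 : ℝ≥0∞)) := by
    rw [← h.compProd_eq]; infer_instance
  have hprod : Measurable fun ω : Fin n → X × Z => ∏ k, f (ω k).1 (ω k).2 :=
    Finset.measurable_fun_prod _ fun k _ => h.measurable.comp (measurable_pi_apply k)
  have hprod' : Measurable fun p : (Fin n → X) × (Fin n → Z) => ∏ k, f (p.1 k) (p.2 k) :=
    Finset.measurable_fun_prod _ fun k _ => h.measurable.comp (by fun_prop :
      Measurable fun p : (Fin n → X) × (Fin n → Z) => (p.1 k, p.2 k))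
  have hc : Measurable fun a : ℝ≥0 => (a : ℝ≥0∞) * g a :=
    ENNReal.continuous_coe.measurable.mul hg
  have hm' : Measurable fun ω : Fin n → X × Z => ∏ k, (f (ω k).1 (ω k).2 : ℝ≥0∞) :=
    Finset.measurable_fun_prod _ fun k _ => (hm k).comp (measurable_pi_apply k)
  have hgp : Measurable fun ω : Fin n → X × Z => g (∏ k, f (ω k).1 (ω k).2) := hg.comp hprod
  have hc' : Measurable fun p : (Fin n → X) × (Fin n → Z) =>
      ((∏ k, f (p.1 k) (p.2 k) : ℝ≥0) : ℝ≥0∞) * g (∏ k, f (p.1 k) (p.2 k)) := hc.comp hprod'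
  rw [h.compProd_eq, pi_withDensity (fun _ : Fin n => μ.prod Q) hm,
    lintegral_withDensity_eq_lintegral_mul _ hm' hgp,
    ← lintegral_prod_symm (fun p : (Fin n → X) × (Fin n → Z) =>
      (∏ k, f (p.1 k) (p.2 k) : ℝ≥0) * g (∏ k, f (p.1 k) (p.2 k))) hc'.aemeasurable,
    ← (measurePreserving_arrowProdEquivProdArrow X Z (Fin n) (fun _ => μ)
      (fun _ => Q)).lintegral_comp hc']
  refine lintegral_congr fun ω => ?_
  simp [MeasurableEquiv.arrowProdEquivProdArrow, Equiv.arrowProdEquivProdArrow]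

theorem ae_pos [IsProbabilityMeasure μ] [IsMarkovKernel κ] [IsProbabilityMeasure Q]
    (h : IsChannelDensity μ κ Q f) : ∀ᵐ p ∂(μ ⊗ₘ κ), 0 < f p.1 p.2 := by
  rw [h.compProd_eq, ae_withDensity_iff h.measurable_coe]
  exact ae_of_all _ fun p hp => pos_iff_ne_zero.2 fun h0 => hp (by simp [h0])

/-- The logarithm of the density is the information density. -/
theorem llr_ae_eq [IsProbabilityMeasure μ] [IsMarkovKernel κ] [IsProbabilityMeasure Q]
    (h : IsChannelDensity μ κ Q f) :
    llr (μ ⊗ₘ κ) (μ.prod Q) =ᵐ[μ ⊗ₘ κ] fun p => Real.log (f p.1 p.2) := by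
  have hac : μ ⊗ₘ κ ≪ μ.prod Q := by
    rw [h.compProd_eq]; exact withDensity_absolutelyContinuous _ _
  have h1 := Measure.rnDeriv_withDensity (μ.prod Q) h.measurable_coe
  rw [← h.compProd_eq] at h1
  filter_upwards [hac.ae_le h1] with p hp
  rw [llr, hp]
  rfl

theorem integrable_log [IsProbabilityMeasure μ] [IsMarkovKernel κ] [IsProbabilityMeasure Q]
    (h : IsChannelDensity μ κ Q f) (hkl : klDiv (μ ⊗ₘ κ) (μ.prod Q) ≠ ∞) :
    Integrable (fun p => Real.log (f p.1 p.2)) (μ ⊗ₘ κ) :=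
  (integrable_congr h.llr_ae_eq).1 (klDiv_ne_top_iff.1 hkl).2

theorem integral_log [IsProbabilityMeasure μ] [IsMarkovKernel κ] [IsProbabilityMeasure Q]
    (h : IsChannelDensity μ κ Q f) (hkl : klDiv (μ ⊗ₘ κ) (μ.prod Q) ≠ ∞) :
    ∫ p, Real.log (f p.1 p.2) ∂(μ ⊗ₘ κ) = (klDiv (μ ⊗ₘ κ) (μ.prod Q)).toReal := by
  rw [toReal_klDiv_of_measure_eq (klDiv_ne_top_iff.1 hkl).1 (by simp)]
  exact (integral_congr_ae h.llr_ae_eq).symm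

end IsChannelDensity

/-! ### Law of large numbers for the information density -/

/-- If `F` is the exponential of an information density of mean at most `(log (b n)) / n`, then the
product of `n` independent copies of `F` exceeds `b n` by at most a subexponential factor, in the
mean of the logarithm. -/
theorem tendsto_lintegral_log_one_add_prod {Ω : Type*} [MeasurableSpace Ω] (ρ : Measure Ω)
    [IsProbabilityMeasure ρ] {F : Ω → ℝ≥0} (hF : Measurable F) (hpos : ∀ᵐ ω ∂ρ, 0 < F ω)
    (hint : Integrable (fun ω => Real.log (F ω)) ρ) {b : ℕ → ℕ} (hb : ∀ n, 0 < b n)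
    (hlog : ∀ n : ℕ, n * ∫ ω, Real.log (F ω) ∂ρ ≤ Real.log (b n)) :
    Tendsto (fun n : ℕ => (∫⁻ ω, ENNReal.ofReal (Real.log (1 + (∏ k, F (ω k) : ℝ≥0) / b n))
      ∂(Measure.pi fun _ : Fin n => ρ)) / n) atTop (𝓝 0) := by
  set I := ∫ ω, Real.log (F ω) ∂ρ with hI
  let Pr := Measure.infinitePi fun _ : ℕ => ρ
  let Y : ℕ → (ℕ → Ω) → ℝ := fun k ω => Real.log (F (ω k))
  have hlF : Measurable fun ω => Real.log (F ω) := by fun_prop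
  have hev : ∀ k, MeasurePreserving (fun ω : ℕ → Ω => ω k) Pr ρ := fun k =>
    ⟨measurable_pi_apply k, Measure.infinitePi_map_eval _ k⟩
  have hY : ∀ k, Measurable (Y k) := fun k => hlF.comp (measurable_pi_apply k)
  have hind : iIndepFun Y Pr :=
    iIndepFun_infinitePi (P := fun _ : ℕ => ρ) (X := fun _ x => Real.log (F x)) fun _ => hlF
  have hid : ∀ k, IdentDistrib (Y k) (Y 0) Pr Pr := fun k =>
    ⟨(hY k).aemeasurable, (hY 0).aemeasurable, by
      change Pr.map ((fun x => Real.log (F x)) ∘ fun ω => ω k) =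
        Pr.map ((fun x => Real.log (F x)) ∘ fun ω => ω 0)
      rw [← Measure.map_map hlF (hev k).measurable, ← Measure.map_map hlF (hev 0).measurable,
        (hev k).map_eq, (hev 0).map_eq]⟩
  have hY0 : Integrable (Y 0) Pr := (hev 0).integrable_comp_of_integrable hint
  have hmean : ∫ ω, Y 0 ω ∂Pr = I := by
    have := integral_map (μ := Pr) (hev 0).measurable.aemeasurable
      (f := fun x => Real.log (F x)) hlF.aestronglyMeasurable
    rw [(hev 0).map_eq] at this
    exact this.symm
  have hLLN := strong_law_Lp le_rfl ENNReal.one_ne_top Y (memLp_one_iff_integrable.2 hY0)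
    (fun i j hij => hind.indepFun hij) hid
  rw [hmean] at hLLN
  have hlim : Tendsto (fun n : ℕ => ENNReal.ofReal (Real.log 2) / n +
      eLpNorm (fun ω => (n : ℝ)⁻¹ • (∑ i ∈ Finset.range n, Y i ω) - I) 1 Pr) atTop (𝓝 0) := by
    have h1 : Tendsto (fun n : ℕ => ENNReal.ofReal (Real.log 2) / (n : ℝ≥0∞)) atTop (𝓝 0) := by
      simpa using ENNReal.Tendsto.const_div (a := ENNReal.ofReal (Real.log 2))
        ENNReal.tendsto_nat_nhds_top (Or.inr ENNReal.ofReal_ne_top)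
    simpa using h1.add hLLN
  refine tendsto_of_tendsto_of_tendsto_of_le_of_le' tendsto_const_nhds hlim
    (Eventually.of_forall fun _ => zero_le) ?_
  filter_upwards [eventually_gt_atTop 0] with n hn
  have hn' : (0 : ℝ) < n := by exact_mod_cast hn
  have hb' : (0 : ℝ) < b n := by exact_mod_cast hb n
  have hmp : MeasurePreserving (fun (ω : ℕ → Ω) (k : Fin n) => ω k) Pr
      (Measure.pi fun _ : Fin n => ρ) := by
    refine ⟨by fun_prop, ?_⟩
    rw [Measure.map_infinitePi_infinitePi_of_inj (f := fun k : Fin n => (k : ℕ))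
      Fin.val_injective, Measure.infinitePi_eq_pi]
  have hm : Measurable fun ω : Fin n → Ω =>
      ENNReal.ofReal (Real.log (1 + (∏ k, F (ω k) : ℝ≥0) / b n)) := by fun_prop
  rw [← hmp.lintegral_comp hm, eLpNorm_one_eq_lintegral_enorm]
  have hposall : ∀ᵐ ω ∂Pr, ∀ k, 0 < F (ω k) :=
    ae_all_iff.2 fun k => (hev k).quasiMeasurePreserving.ae hpos
  have hpt : ∀ᵐ ω ∂Pr, ENNReal.ofReal (Real.log (1 + (∏ k : Fin n, F (ω k) : ℝ≥0) / b n)) ≤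
      ENNReal.ofReal (Real.log 2) +
        n * ‖(n : ℝ)⁻¹ • (∑ i ∈ Finset.range n, Y i ω) - I‖ₑ := by
    filter_upwards [hposall] with ω hω
    set s := ∑ i ∈ Finset.range n, Y i ω with hs
    have e1 : ((∏ k : Fin n, F (ω k) : ℝ≥0) : ℝ) = Real.exp s := by
      rw [hs, Real.exp_sum, ← Fin.prod_univ_eq_prod_range (fun i => Real.exp (Y i ω)) n]
      push_cast
      exact Finset.prod_congr rfl fun k _ => (Real.exp_log (by exact_mod_cast hω k)).symm
    have e2 : (n : ℝ≥0∞) * ‖(n : ℝ)⁻¹ • s - I‖ₑ = ENNReal.ofReal |s - n * I| := by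
      rw [Real.enorm_eq_ofReal_abs, ← ENNReal.ofReal_natCast, ← ENNReal.ofReal_mul hn'.le]
      congr 1
      rw [← abs_of_pos hn', ← abs_mul, abs_of_pos hn', smul_eq_mul]
      congr 1
      field_simp
    rw [e1, e2, ← ENNReal.ofReal_add (Real.log_nonneg one_le_two) (abs_nonneg _)]
    refine ENNReal.ofReal_le_ofReal ?_
    have e3 : Real.exp s / b n = Real.exp (s - Real.log (b n)) := by
      rw [Real.exp_sub, Real.exp_log hb']
    -- `s` is the sum of the information densities, and `log (b n) ≥ n * I`
    have h1 : s - Real.log (b n) ≤ |s - n * I| := by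
      have := hlog n
      have := le_abs_self (s - n * I)
      linarith
    have h2 : 1 + Real.exp s / b n ≤ 2 * Real.exp |s - n * I| := by
      have h3 := Real.exp_le_exp.2 h1
      have h4 := Real.one_le_exp (abs_nonneg (s - n * I))
      rw [e3]
      linarith
    have h5 := Real.log_le_log (by positivity) h2
    rwa [Real.log_mul two_ne_zero (Real.exp_ne_zero _), Real.log_exp] at h5
  have hn0 : (n : ℝ≥0∞) ≠ 0 := by exact_mod_cast hn.ne'
  rw [ENNReal.div_le_iff hn0 (ENNReal.natCast_ne_top n), add_mul,
    ENNReal.div_mul_cancel hn0 (ENNReal.natCast_ne_top n), mul_comm (lintegral _ _)]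
  refine (lintegral_mono_ae hpt).trans_eq ?_
  have hm2 : Measurable fun ω => ‖(n : ℝ)⁻¹ • (∑ i ∈ Finset.range n, Y i ω) - I‖ₑ := by fun_prop
  rw [lintegral_add_left measurable_const, lintegral_const, measure_univ, mul_one,
    lintegral_const_mul _ hm2]

/-! ### Equivocation -/

section Equivocation

variable {W O : Type*} [Fintype W] [MeasurableSpace W] [MeasurableSingletonClass W]
  [MeasurableSpace O] {μ : Measure W} [IsProbabilityMeasure μ] {κ : Kernel W O} [IsMarkovKernel κ]

/-- Bayes' rule for the conditional probabilities of a finitely valued channel input. -/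
theorem IsChannelDensity.condExp_indicator_ae_eq {f : W → O → ℝ≥0}
    (h : IsChannelDensity μ κ (κ ∘ₘ μ) f) (w : W) :
    (fun x : W × O => μ.real {w} * f w x.2) =ᵐ[μ ⊗ₘ κ]
      (μ ⊗ₘ κ)[(Prod.fst ⁻¹' {w}).indicator (fun _ => (1 : ℝ)) |
        MeasurableSpace.comap Prod.snd inferInstance] := by
  have hw : MeasurableSet (Prod.fst ⁻¹' {w} : Set (W × O)) :=
    measurable_fst (measurableSet_singleton w)
  have hmf : Measurable fun o => (f w o : ℝ) :=
    measurable_coe_nnreal_real.comp (h.measurable.comp measurable_prodMk_left)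
  have hsnd : MeasurePreserving Prod.snd (μ ⊗ₘ κ) (κ ∘ₘ μ) :=
    ⟨measurable_snd, Measure.snd_compProd μ κ⟩
  -- `κ w` is unconstrained if `w` has probability zero
  have hdens : μ {w} ≠ 0 → κ w = (κ ∘ₘ μ).withDensity fun o => f w o := by
    intro h0
    by_contra hne
    exact h0 (measure_mono_null (Set.singleton_subset_iff.2 hne)
      (ae_iff.1 h.eq_withDensity))
  have hint : Integrable (fun o => μ.real {w} * (f w o : ℝ)) (κ ∘ₘ μ) := by
    by_cases h0 : μ {w} = 0
    · simp [measureReal_def, h0]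
    · refine Integrable.const_mul ⟨hmf.aestronglyMeasurable, ?_⟩ _
      have h1 : κ w Set.univ = ∫⁻ o, f w o ∂(κ ∘ₘ μ) := by
        rw [hdens h0, withDensity_apply _ MeasurableSet.univ, Measure.restrict_univ]
      rw [measure_univ] at h1
      simp only [HasFiniteIntegral, Real.enorm_eq_ofReal (NNReal.coe_nonneg _),
        ENNReal.ofReal_coe_nnreal]
      rw [← h1]
      exact ENNReal.one_lt_top
  refine ae_eq_condExp_of_forall_setIntegral_eq measurable_snd.comap_le
    ((integrable_const (1 : ℝ)).indicator hw)
    (fun s _ _ => (hsnd.integrable_comp_of_integrable hint).integrableOn) ?_ ?_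
  · rintro _ ⟨t, ht, rfl⟩ -
    have e1 : ∫ x in Prod.snd ⁻¹' t, μ.real {w} * (f w x.2 : ℝ) ∂(μ ⊗ₘ κ) =
        ∫ o in t, μ.real {w} * (f w o : ℝ) ∂(κ ∘ₘ μ) := by
      rw [← hsnd.map_eq, setIntegral_map ht
        (by rw [hsnd.map_eq]; exact hint.aestronglyMeasurable) measurable_snd.aemeasurable]
    have e2 : (μ ⊗ₘ κ) (Prod.fst ⁻¹' {w} ∩ Prod.snd ⁻¹' t) = κ w t * μ {w} := by
      rw [← Set.prod_eq, Measure.compProd_apply_prod (measurableSet_singleton w) ht,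
        lintegral_singleton]
    rw [e1, setIntegral_indicator hw, setIntegral_const, smul_eq_mul, mul_one, Set.inter_comm,
      measureReal_def, measureReal_def, e2, ENNReal.toReal_mul, integral_const_mul, mul_comm]
    by_cases h0 : μ {w} = 0
    · simp [h0]
    · rw [hdens h0, withDensity_apply _ ht, integral_eq_lintegral_of_nonneg_ae
        (ae_of_all _ fun o => NNReal.coe_nonneg _) hmf.aestronglyMeasurable]
      simp only [ENNReal.ofReal_coe_nnreal]
  · exact ((hmf.const_mul _).comp (comap_measurable Prod.snd)).aestronglyMeasurable

/-- The conditional entropy is the entropy diminished by the mutual information. -/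
theorem condEntropy_eq [MeasurableSpace.CountablyGenerated O]
    (h : klDiv (μ ⊗ₘ κ) (μ.prod (κ ∘ₘ μ)) ≠ ∞) :
    condEntropy μ κ = entropy μ -
      (klDiv (μ ⊗ₘ κ) (μ.prod (κ ∘ₘ μ))).toReal / Real.log 2 := by
  obtain ⟨f, hf⟩ := IsChannelDensity.exists_of_klDiv_ne_top h
  set P := κ ∘ₘ μ with hP
  rw [condEntropy, entropy, ← sub_div]
  congr 1
  have hfst : MeasurePreserving Prod.fst (μ ⊗ₘ κ) μ := ⟨measurable_fst, Measure.fst_compProd μ κ⟩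
  have hsnd : MeasurePreserving Prod.snd (μ ⊗ₘ κ) P := ⟨measurable_snd, Measure.snd_compProd μ κ⟩
  -- the logarithm of the posterior probability `μ {w} * f w o`
  let G : W × O → ℝ := fun x => Real.log (μ.real {x.1}) + Real.log (f x.1 x.2)
  have hG1 : Integrable (fun x : W × O => Real.log (μ.real {x.1})) (μ ⊗ₘ κ) :=
    hfst.integrable_comp_of_integrable (g := fun w => Real.log (μ.real {w})) .of_finite
  have hG2 := hf.integrable_log h
  have hG : Integrable G (μ ⊗ₘ κ) := hG1.add hG2
  have hfm : Measurable fun x : W × O => f x.1 x.2 := hf.measurable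
  have hGP : Integrable (fun x => f x.1 x.2 • G x) (μ.prod P) := by
    rw [hf.compProd_eq] at hG
    exact (integrable_withDensity_iff_integrable_smul hfm).1 hG
  have e1 : ∀ᵐ x ∂(μ ⊗ₘ κ), ∑ w, Real.negMulLog
      (((μ ⊗ₘ κ)[(Prod.fst ⁻¹' {w}).indicator (fun _ => (1 : ℝ)) |
        MeasurableSpace.comap Prod.snd inferInstance]) x) =
      -∫ w, f w x.2 • G (w, x.2) ∂μ := by
    filter_upwards [ae_all_iff.2 fun w => hf.condExp_indicator_ae_eq w] with x hx
    rw [integral_fintype .of_finite, ← Finset.sum_neg_distrib]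
    refine Finset.sum_congr rfl fun w _ => ?_
    rw [← hx w, Real.negMulLog, NNReal.smul_def, smul_eq_mul, smul_eq_mul]
    by_cases h0 : μ.real {w} = 0
    · simp [h0]
    by_cases h1 : (f w x.2 : ℝ) = 0
    · simp [h1]
    rw [Real.log_mul h0 h1]
    ring
  have hm : AEStronglyMeasurable (fun o => -∫ w, f w o • G (w, o) ∂μ) P :=
    hGP.integral_prod_right.aestronglyMeasurable.neg
  rw [integral_congr_ae e1]
  have e2 : ∫ x, -∫ w, f w x.2 • G (w, x.2) ∂μ ∂(μ ⊗ₘ κ) =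
      ∫ o, -∫ w, f w o • G (w, o) ∂μ ∂P := by
    rw [← hsnd.map_eq] at hm
    rw [← integral_map measurable_snd.aemeasurable hm, hsnd.map_eq]
  have e3 : ∫ x, Real.log (μ.real {x.1}) ∂(μ ⊗ₘ κ) = ∑ w, μ.real {w} * Real.log (μ.real {w}) := by
    have h3 := integral_map (μ := μ ⊗ₘ κ) measurable_fst.aemeasurable
      (f := fun w : W => Real.log (μ.real {w})) (measurable_of_finite _).aestronglyMeasurable
    rw [hfst.map_eq, integral_fintype .of_finite] at h3
    simpa using h3.symm
  have e4 : ∫ x, f x.1 x.2 • G x ∂(μ.prod P) = ∫ x, G x ∂(μ ⊗ₘ κ) := by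
    rw [hf.compProd_eq, integral_withDensity_eq_integral_smul hfm]
  rw [e2, integral_neg, integral_integral_swap, ← integral_prod (fun x => f x.1 x.2 • G x) hGP, e4,
    integral_add hG1 hG2, e3, hf.integral_log h]
  · simp only [Real.negMulLog, neg_mul, Finset.sum_neg_distrib]
    ring
  · exact hGP.swap

end Equivocation

/-! ### Outputs of random codes -/

/-- The divergence from `Q` of the output of a channel with density `f` with respect to `Q`, for an
input drawn uniformly at random from the codewords `C v`. -/
noncomputable def codeDivergence {V X Z : Type*} [Fintype V] [MeasurableSpace Z] (Q : Measure Z)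
    (f : X → Z → ℝ≥0) (C : V → X) : ℝ≥0∞ :=
  ∫⁻ z, ENNReal.ofReal (klFun ((Fintype.card V : ℝ)⁻¹ * ∑ v, (f (C v) z : ℝ))) ∂Q

section Covering

variable {V X Z : Type*} [Fintype V] [MeasurableSpace X] [MeasurableSpace Z]
  {μ : Measure X} {κ : Kernel X Z} {Q : Measure Z} {f : X → Z → ℝ≥0}

theorem lintegral_uniformOn_univ [MeasurableSpace V] [MeasurableSingletonClass V]
    (g : V → ℝ≥0∞) :
    ∫⁻ v, g v ∂(uniformOn Set.univ) = (Fintype.card V : ℝ≥0∞)⁻¹ * ∑ v, g v := by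
  rw [uniformOn, ProbabilityTheory.cond, lintegral_smul_measure, Measure.restrict_univ,
    lintegral_count, tsum_fintype, Measure.count_apply_finite _ Set.finite_univ, smul_eq_mul]
  simp

theorem measurable_codeDivergence_integrand (hf : Measurable (Function.uncurry f)) :
    Measurable fun q : (V → X) × Z =>
      ENNReal.ofReal (klFun ((Fintype.card V : ℝ)⁻¹ * ∑ v, (f (q.1 v) q.2 : ℝ))) := by
  have h1 : ∀ v, Measurable fun q : (V → X) × Z => (f (q.1 v) q.2 : ℝ) := fun v =>
    measurable_coe_nnreal_real.comp (hf.comp (by fun_prop :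
      Measurable fun q : (V → X) × Z => (q.1 v, q.2)))
  exact ENNReal.measurable_ofReal.comp (measurable_klFun.comp
    ((Finset.measurable_fun_sum _ fun v _ => h1 v).const_mul _))

theorem measurable_codeDivergence [SFinite Q] (hf : Measurable (Function.uncurry f)) :
    Measurable (codeDivergence (V := V) Q f) :=
  (measurable_codeDivergence_integrand hf).lintegral_prod_right'

/-- Soft covering: the mean over random codes of the divergence of the output from `Q`. -/
theorem lintegral_codeDivergence_le [Nonempty V] [IsProbabilityMeasure μ] [IsProbabilityMeasure Q]
    (hf : Measurable (Function.uncurry f)) (h1 : ∀ᵐ z ∂Q, ∫⁻ x, f x z ∂μ = 1) :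
    ∫⁻ C, codeDivergence Q f C ∂(Measure.pi fun _ : V => μ) ≤
      ∫⁻ z, ∫⁻ x, f x z * ENNReal.ofReal (Real.log (1 + f x z / Fintype.card V)) ∂μ ∂Q := by
  obtain ⟨G, hGdef⟩ : ∃ G : (V → X) → Z → ℝ≥0∞, ∀ C z, G C z =
      ENNReal.ofReal (klFun ((Fintype.card V : ℝ)⁻¹ * ∑ v, (f (C v) z : ℝ))) :=
    ⟨_, fun _ _ => rfl⟩
  have hG : Measurable (Function.uncurry G) := by
    convert measurable_codeDivergence_integrand (V := V) hf using 2 with q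
    exact hGdef _ _
  simp only [codeDivergence, ← hGdef]
  rw [lintegral_lintegral_swap hG.aemeasurable]
  refine lintegral_mono_ae ?_
  have key : ∀ z, ∫⁻ x, f x z ∂μ = 1 → ∫⁻ C, G C z ∂(Measure.pi fun _ : V => μ) ≤
      ∫⁻ x, f x z * ENNReal.ofReal (Real.log (1 + f x z / Fintype.card V)) ∂μ := by
    intro z hz
    have hfz : Measurable fun x => f x z := hf.comp measurable_prodMk_right
    have h := lintegral_klFun_mean_le (V := V) μ hfz hz
    simp only [hGdef]
    exact h
  exact h1.mono key

/-- `codeDivergence` is a divergence, for codewords at which the output has density `f`. -/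
theorem klDiv_comp_uniformOn_map [Nonempty V] [MeasurableSpace V] [MeasurableSingletonClass V]
    [IsMarkovKernel κ] [IsProbabilityMeasure Q] (hf : Measurable (Function.uncurry f)) {C : V → X}
    (hC : ∀ v, κ (C v) = Q.withDensity fun z => f (C v) z) :
    klDiv (κ ∘ₘ (uniformOn Set.univ).map C) Q = codeDivergence Q f C := by
  have hCm : Measurable C := measurable_of_finite C
  have hb : (0 : ℝ) < Fintype.card V := by exact_mod_cast Fintype.card_pos
  have hfm : ∀ v, Measurable fun z => (f (C v) z : ℝ≥0∞) := fun v =>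
    ENNReal.continuous_coe.measurable.comp (hf.comp measurable_prodMk_left)
  have : IsProbabilityMeasure (uniformOn (Set.univ : Set V)) :=
    isProbabilityMeasure_uniformOn Set.finite_univ Set.univ_nonempty
  have : IsProbabilityMeasure ((uniformOn (Set.univ : Set V)).map C) :=
    Measure.isProbabilityMeasure_map hCm.aemeasurable
  let g : Z → ℝ≥0∞ := fun z => (Fintype.card V : ℝ≥0∞)⁻¹ * ∑ v, (f (C v) z : ℝ≥0∞)
  have hg : Measurable g := (Finset.measurable_fun_sum _ fun v _ => hfm v).const_mul _
  have h : κ ∘ₘ (uniformOn Set.univ).map C = Q.withDensity g := by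
    ext s hs
    rw [Measure.bind_apply hs κ.aemeasurable, lintegral_map (κ.measurable_coe hs) hCm,
      lintegral_uniformOn_univ, withDensity_apply _ hs, lintegral_const_mul _
        (Finset.measurable_fun_sum _ fun v _ => hfm v), lintegral_finsetSum _ fun v _ => hfm v]
    congr 1
    exact Finset.sum_congr rfl fun v _ => by rw [hC v, withDensity_apply _ hs]
  have : IsFiniteMeasure (Q.withDensity g) := by rw [← h]; infer_instance
  rw [h, klDiv_withDensity Q hg, codeDivergence]
  refine lintegral_congr fun z => ?_
  simp only [g]
  rw [ENNReal.toReal_mul, ENNReal.toReal_sum fun _ _ => ENNReal.coe_ne_top]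
  simp

end Covering

/-- If the law of a random index `t` is invariant under all the shifts `σ · u`, then the output for
the random codeword `c t` is a mixture of the outputs for `c (σ t u)` with random `u`. -/
theorem klDiv_comp_map_le_of_shift {T V X Z : Type*} [Finite T] [MeasurableSpace T]
    [MeasurableSingletonClass T] [Finite V] [MeasurableSpace V] [MeasurableSingletonClass V]
    [MeasurableSpace X] [MeasurableSpace Z] [MeasurableSpace.CountablyGenerated Z]
    {U : Measure T} [IsProbabilityMeasure U] {A : Measure V} [IsProbabilityMeasure A]
    {κ : Kernel X Z} [IsMarkovKernel κ] {Q : Measure Z} [IsProbabilityMeasure Q] (c : T → X)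
    {σ : T → V → T} (hσ : ∀ u, U.map (fun t => σ t u) = U) :
    klDiv (κ ∘ₘ U.map c) Q ≤ ∫⁻ t, klDiv (κ ∘ₘ A.map fun u => c (σ t u)) Q ∂U := by
  have hc : Measurable c := measurable_of_finite c
  have hcσ : ∀ t, Measurable fun u => c (σ t u) := fun t => measurable_of_finite _
  have hprob : ∀ t, IsProbabilityMeasure (A.map fun u => c (σ t u)) := fun t =>
    Measure.isProbabilityMeasure_map (hcσ t).aemeasurable
  let η : Kernel T Z := Kernel.ofFunOfCountable fun t => κ ∘ₘ A.map fun u => c (σ t u)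
  have hη : IsMarkovKernel η := ⟨fun t => by
    change IsProbabilityMeasure (κ ∘ₘ A.map fun u => c (σ t u))
    infer_instance⟩
  have h : κ ∘ₘ U.map c = η ∘ₘ U := by
    ext s hs
    have hκs := κ.measurable_coe hs
    rw [Measure.bind_apply hs κ.aemeasurable, Measure.bind_apply hs η.aemeasurable,
      lintegral_map hκs hc]
    have e1 : ∀ t, η t s = ∫⁻ u, κ (c (σ t u)) s ∂A := fun t => by
      change (κ ∘ₘ A.map fun u => c (σ t u)) s = _
      rw [Measure.bind_apply hs κ.aemeasurable, lintegral_map hκs (hcσ t)]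
    simp_rw [e1]
    rw [lintegral_lintegral_swap (measurable_of_finite _).aemeasurable]
    have e2 : ∀ u, ∫⁻ t, κ (c (σ t u)) s ∂U = ∫⁻ t, κ (c t) s ∂U := fun u => by
      conv_rhs => rw [← hσ u]
      rw [lintegral_map (measurable_of_finite _) (measurable_of_finite _)]
    simp_rw [e2]
    simp
  rw [h]
  exact klDiv_comp_le (measurable_of_finite _).aemeasurable (ae_of_all _ fun t => le_rfl)

theorem measurable_lintegral_of_finite {W A : Type*} [Finite W] [MeasurableSpace W]
    [MeasurableSingletonClass W] [MeasurableSpace A] (m : Measure W) [IsProbabilityMeasure m]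
    {g : W → A → ℝ≥0∞} (hg : ∀ w, Measurable (g w)) :
    Measurable fun a => ∫⁻ w, g w a ∂m :=
  (measurable_from_prod_countable_left (f := fun q : A × W => g q.2 q.1)
    fun w => hg w).lintegral_prod_right'

theorem lintegral_lintegral_le_of_finite {W A : Type*} [Finite W] [MeasurableSpace W]
    [MeasurableSingletonClass W] [MeasurableSpace A] (m : Measure W) [IsProbabilityMeasure m]
    (ν : Measure A) [SFinite ν] {g : W → A → ℝ≥0∞} (hg : ∀ w, Measurable (g w)) {Λ : ℝ≥0∞}
    (h : ∀ w, ∫⁻ a, g w a ∂ν ≤ Λ) : ∫⁻ a, ∫⁻ w, g w a ∂m ∂ν ≤ Λ := by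
  rw [lintegral_lintegral_swap (measurable_from_prod_countable_left
    (f := fun q : A × W => g q.2 q.1) fun w => hg w).aemeasurable]
  exact (lintegral_mono h).trans (by simp)

theorem measurePreserving_pi_swap_symm {T I : Type*} [Fintype T] [Fintype I] {X : I → Type*}
    [∀ i, MeasurableSpace (X i)] (μ : ∀ i, Measure (X i)) [∀ i, IsProbabilityMeasure (μ i)] :
    MeasurePreserving (fun (x : ∀ i, T → X i) a i => x i a)
      (Measure.pi fun i => Measure.pi fun _ => μ i) (Measure.pi fun _ => Measure.pi μ) := by
  have hm : Measurable (fun (x : ∀ i, T → X i) a i => x i a) := by fun_prop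
  refine ⟨hm, ?_⟩
  have h := measurePreserving_pi_swap (T := T) μ
  rw [← h.map_eq, Measure.map_map hm h.measurable]
  exact Measure.map_id

namespace System

variable {𝕜 : Type*} [RCLike 𝕜] (S : System 𝕜)

/-! ### Leakage of random Wyner codes -/

variable {S} in
/-- The block sent jointly by the transmitters when they pick the codewords with indices `v` from
the bins `w`. -/
def codeword {n : ℕ} {K B : Fin 2 → ℕ} (cb : S.Codebook n K B) (w : ∀ i, Fin (K i))
    (v : ∀ i, Fin (B i)) : Fin n → S.Signal :=
  fun k i => cb i (w i) (v i) k

/-- A shift of both codeword indices by `u`, cyclically in each bin. For fixed `t` and varying `u`,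
no index of either transmitter is repeated, because `u` takes at most `B i` values. -/
def shift {b : ℕ} {B : Fin 2 → ℕ} [∀ i, NeZero (B i)] (hB : ∀ i, b ≤ B i) (t : ∀ i, Fin (B i))
    (u : Fin b) : ∀ i, Fin (B i) :=
  fun i => t i + Fin.castLE (hB i) u

/-- The law of a uniformly random pair of codeword indices. -/
noncomputable def indexLaw (B : Fin 2 → ℕ) : Measure (∀ i, Fin (B i)) :=
  Measure.pi fun i => uniformOn (Set.univ : Set (Fin (B i)))

theorem isProbabilityMeasure_uniformOn_fin (b : ℕ) [NeZero b] :
    IsProbabilityMeasure (uniformOn (Set.univ : Set (Fin b))) :=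
  isProbabilityMeasure_uniformOn Set.finite_univ Set.univ_nonempty

theorem isProbabilityMeasure_indexLaw (B : Fin 2 → ℕ) [∀ i, NeZero (B i)] :
    IsProbabilityMeasure (indexLaw B) := by
  have := fun i => isProbabilityMeasure_uniformOn_fin (B i)
  unfold indexLaw
  infer_instance

theorem map_shift_indexLaw {b : ℕ} {B : Fin 2 → ℕ} [∀ i, NeZero (B i)] (hB : ∀ i, b ≤ B i)
    (u : Fin b) : (indexLaw B).map (fun t => shift hB t u) = indexLaw B := by
  have := fun i => isProbabilityMeasure_uniformOn_fin (B i)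
  refine (measurePreserving_pi (fun i => uniformOn (Set.univ : Set (Fin (B i))))
    (fun i => uniformOn (Set.univ : Set (Fin (B i))))
    (f := fun i t => t + Fin.castLE (hB i) u) fun i => ⟨measurable_of_finite _, ?_⟩).map_eq
  ext s hs
  rw [Measure.map_apply (measurable_of_finite _) hs, uniformOn_univ, uniformOn_univ]
  congr 1
  have h := Measure.count_injective_image
    (Equiv.addRight (Fin.castLE (hB i) u)).symm.injective s
  rwa [Equiv.image_symm_eq_preimage] at h

theorem jointEncoder_wynerEncoder {n : ℕ} {K B : Fin 2 → ℕ} [∀ i, NeZero (B i)]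
    (cb : S.Codebook n K B) (w : ∀ i, Fin (K i)) :
    S.jointEncoder (S.wynerEncoder cb) w = (indexLaw B).map (codeword cb w) := by
  have := fun i => isProbabilityMeasure_uniformOn_fin (B i)
  have hm : Measurable fun (x : ∀ i, Fin n → Fin (S.L i) → 𝕜) (k : Fin n) i => x i k := by fun_prop
  have hi : ∀ i, Measurable fun v : Fin (B i) => cb i (w i) v := fun i => measurable_of_finite _
  have := fun i => Measure.isProbabilityMeasure_map (μ := uniformOn (Set.univ : Set (Fin (B i))))
    (hi i).aemeasurable
  change (Measure.pi fun i => (uniformOn (Set.univ : Set (Fin (B i)))).map (cb i (w i))).map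
    (fun x k i => x i k) = _
  rw [← Measure.pi_map_pi fun i => (hi i).aemeasurable, Measure.map_map hm (measurable_of_finite _)]
  rfl

/-- The codewords along a diagonal of the rectangle of indices are independent, with independent
symbols of law `p 0 × p 1`. -/
theorem measurePreserving_codeword_shift (p : ∀ i, Measure (Fin (S.L i) → 𝕜))
    [∀ i, IsProbabilityMeasure (p i)] {n b : ℕ} {K B : Fin 2 → ℕ} [∀ i, NeZero (B i)]
    (hB : ∀ i, b ≤ B i) (w : ∀ i, Fin (K i)) (t : ∀ i, Fin (B i)) :
    MeasurePreserving (fun (cb : S.Codebook n K B) (u : Fin b) => codeword cb w (shift hB t u))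
      (S.codebookLaw p n K B)
      (Measure.pi fun _ : Fin b => Measure.pi fun _ : Fin n => Measure.pi p) := by
  have hinj : ∀ i, Function.Injective fun u : Fin b => t i + Fin.castLE (hB i) u := fun i =>
    (add_right_injective (t i)).comp (Fin.castLE_injective (hB i))
  let blk : ∀ i, Measure (Fin n → Fin (S.L i) → 𝕜) := fun i => Measure.pi fun _ => p i
  have h1 : ∀ i, MeasurePreserving
      (fun (x : Fin (K i) → Fin (B i) → Fin n → Fin (S.L i) → 𝕜) (u : Fin b) =>
        x (w i) (t i + Fin.castLE (hB i) u))
      (Measure.pi fun _ => Measure.pi fun _ => blk i) (Measure.pi fun _ => blk i) := fun i =>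
    (measurePreserving_pi_comp (blk i) (hinj i)).comp
      (measurePreserving_eval (fun _ : Fin (K i) => Measure.pi fun _ : Fin (B i) => blk i) (w i))
  have h2 := measurePreserving_pi _ _ h1
  have h3 := measurePreserving_pi_swap_symm (T := Fin b) blk
  have h4 := measurePreserving_pi (fun _ : Fin b => Measure.pi blk)
    (fun _ => Measure.pi fun _ : Fin n => Measure.pi p)
    fun _ => measurePreserving_pi_swap_symm (T := Fin n) p
  exact h4.comp (h3.comp h2)

/-- For random Wyner codes, the mean divergence between the true joint law of the messages and the
eavesdropper's observation, and the law under which they are independent, is controlled by the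
information density of the block channel and the smaller of the two numbers of codewords in a
bin. -/
theorem exists_leakage_bound (P : ℝ≥0) (e : Eavesdropper) (p : ∀ i, Measure (Fin (S.L i) → 𝕜))
    [∀ i, IsProbabilityMeasure (p i)] {f : S.Signal → S.Obs e.antennas → ℝ≥0}
    (hf : IsChannelDensity (Measure.pi p) (S.useKernel P e)
      (S.useKernel P e ∘ₘ Measure.pi p) f) (n : ℕ) {b : ℕ} [NeZero b] {K B : Fin 2 → ℕ}
    [∀ i, NeZero (K i)] [∀ i, NeZero (B i)] (hB : ∀ i, b ≤ B i) :
    ∃ F : S.Codebook n K B → ℝ≥0∞, Measurable F ∧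
      ∫⁻ cb, F cb ∂(S.codebookLaw p n K B) ≤
        ∫⁻ ω, ENNReal.ofReal (Real.log (1 + (∏ k, f (ω k).1 (ω k).2 : ℝ≥0) / b))
          ∂(Measure.pi fun _ : Fin n => Measure.pi p ⊗ₘ S.useKernel P e) ∧
      ∀ᵐ cb ∂(S.codebookLaw p n K B),
        klDiv (messageLaw K ⊗ₘ (S.blockKernel P e n ∘ₖ S.jointEncoder (S.wynerEncoder cb)))
          ((messageLaw K).prod ((S.blockKernel P e n ∘ₖ S.jointEncoder (S.wynerEncoder cb)) ∘ₘ
            messageLaw K)) ≤ F cb := by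
  have := isProbabilityMeasure_messageLaw fun i => Nat.pos_of_ne_zero (NeZero.ne (K i))
  have := isProbabilityMeasure_indexLaw B
  have := isProbabilityMeasure_uniformOn_fin b
  have hB' := fun i => isProbabilityMeasure_uniformOn_fin (B i)
  have : IsProbabilityMeasure (S.codebookLaw p n K B) := by unfold codebookLaw; infer_instance
  have hfn := hf.pi (S.blockKernel_apply P e n)
  have hfn1 := hf.lintegral_pi_eq_one n
  set fn : (Fin n → S.Signal) → (Fin n → S.Obs e.antennas) → ℝ≥0 :=
    fun x z => ∏ k, f (x k) (z k) with hfn_def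
  set Qn : Measure (Fin n → S.Obs e.antennas) :=
    Measure.pi fun _ => S.useKernel P e ∘ₘ Measure.pi p with hQn
  let Φ : (∀ i, Fin (K i)) → (∀ i, Fin (B i)) → S.Codebook n K B → ℝ≥0∞ := fun w t cb =>
    codeDivergence Qn fn fun u : Fin b => codeword cb w (shift hB t u)
  have hmp := fun w t => S.measurePreserving_codeword_shift (K := K) p (n := n) hB w t
  have hΦm : ∀ w t, Measurable (Φ w t) := fun w t =>
    (measurable_codeDivergence hfn.measurable).comp (hmp w t).measurable
  have hΦ : ∀ w t, ∫⁻ cb, Φ w t cb ∂(S.codebookLaw p n K B) ≤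
      ∫⁻ ω, ENNReal.ofReal (Real.log (1 + (∏ k, f (ω k).1 (ω k).2 : ℝ≥0) / b))
        ∂(Measure.pi fun _ : Fin n => Measure.pi p ⊗ₘ S.useKernel P e) := by
    intro w t
    rw [(hmp w t).lintegral_comp (measurable_codeDivergence hfn.measurable)]
    refine (lintegral_codeDivergence_le hfn.measurable hfn1).trans_eq ?_
    rw [Fintype.card_fin]
    exact hf.lintegral_pi_mul n
      (g := fun a => ENNReal.ofReal (Real.log (1 + (a : ℝ) / b))) (by fun_prop)
  refine ⟨fun cb => ∫⁻ w, ∫⁻ t, Φ w t cb ∂(indexLaw B) ∂(messageLaw K),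
    measurable_lintegral_of_finite _ fun w => measurable_lintegral_of_finite _ (hΦm w),
    lintegral_lintegral_le_of_finite _ _
      (fun w => measurable_lintegral_of_finite _ (hΦm w))
      fun w => lintegral_lintegral_le_of_finite _ _ (hΦm w) (hΦ w), ?_⟩
  -- almost surely, the density describes the output for all codewords
  have hgood : ∀ᵐ cb ∂(S.codebookLaw p n K B), ∀ w t (u : Fin b),
      S.blockKernel P e n (codeword cb w (shift hB t u)) =
        Qn.withDensity fun z => fn (codeword cb w (shift hB t u)) z := by
    refine ae_all_iff.2 fun w => ae_all_iff.2 fun t => ae_all_iff.2 fun u => ?_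
    exact ((measurePreserving_eval (fun _ : Fin b => Measure.pi fun _ : Fin n => Measure.pi p)
      u).comp (hmp w t)).quasiMeasurePreserving.ae hfn.eq_withDensity
  filter_upwards [hgood] with cb hcb
  have : ∀ i w, IsProbabilityMeasure (S.wynerEncoder cb i w) := fun i w =>
    Measure.isProbabilityMeasure_map (measurable_of_finite _).aemeasurable
  refine (klDiv_prod_comp_le _ _ Qn).trans (klDiv_compProd_prod_le
    (measurable_of_finite _).aemeasurable (ae_of_all _ fun w => ?_))
  rw [Kernel.comp_apply, jointEncoder_wynerEncoder]
  refine (klDiv_comp_map_le_of_shift (A := uniformOn (Set.univ : Set (Fin b)))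
    (codeword cb w) (map_shift_indexLaw hB)).trans (lintegral_mono fun t => ?_)
  exact (klDiv_comp_uniformOn_map hfn.measurable fun u => hcb w t u).le

/-! ### Secrecy of random Wyner codes -/

theorem size_pos (n : ℕ) (R : ℝ) : 0 < size n R :=
  Nat.ceil_pos.2 (Real.rpow_pos_of_pos two_pos _)

theorem mul_log_two_le_log_size (n : ℕ) (R : ℝ) : n * (R * Real.log 2) ≤ Real.log (size n R) := by
  have h := Real.log_le_log (Real.rpow_pos_of_pos two_pos ((n : ℝ) * R)) (Nat.le_ceil _)
  rw [Real.log_rpow two_pos, mul_assoc] at h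
  exact h

/-- If the secrecy constraint fails, then the messages and the observation are far from
independent. -/
theorem le_of_not_secret {P : ℝ≥0} {n : ℕ} (hn : 0 < n) {K B : Fin 2 → ℕ} [∀ i, NeZero (K i)]
    [∀ i, NeZero (B i)] {cb : S.Codebook n K B} {ε : ℝ} {e : Eavesdropper}
    (h : ¬ S.Secret P cb ε e) :
    ENNReal.ofReal (n * (ε * Real.log 2)) ≤
      klDiv (messageLaw K ⊗ₘ (S.blockKernel P e n ∘ₖ S.jointEncoder (S.wynerEncoder cb)))
        ((messageLaw K).prod ((S.blockKernel P e n ∘ₖ S.jointEncoder (S.wynerEncoder cb)) ∘ₘ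
          messageLaw K)) := by
  have := isProbabilityMeasure_messageLaw fun i => Nat.pos_of_ne_zero (NeZero.ne (K i))
  have := fun i => isProbabilityMeasure_uniformOn_fin (B i)
  have : ∀ i w, IsProbabilityMeasure (S.wynerEncoder cb i w) := fun i w =>
    Measure.isProbabilityMeasure_map (measurable_of_finite _).aemeasurable
  by_contra! hlt
  refine h ?_
  have hn' : (0 : ℝ) < n := by exact_mod_cast hn
  have hl2 : 0 < Real.log 2 := Real.log_pos one_lt_two
  rw [Secret, condEntropy_eq hlt.ne_top, sub_div]
  have h1 : (klDiv (messageLaw K ⊗ₘ (S.blockKernel P e n ∘ₖ S.jointEncoder (S.wynerEncoder cb)))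
        ((messageLaw K).prod ((S.blockKernel P e n ∘ₖ S.jointEncoder (S.wynerEncoder cb)) ∘ₘ
          messageLaw K))).toReal < n * (ε * Real.log 2) :=
    (ENNReal.lt_ofReal_iff_toReal_lt hlt.ne_top).1 hlt
  have h2 := h1.le
  rw [← mul_assoc, ← div_le_iff₀ hl2, ← div_le_iff₀' hn'] at h2
  linarith

/-- Random Wyner codes keep the messages secret from an eavesdropper as soon as the randomization
rates are not smaller than the information leaked in one channel use. -/
theorem tendsto_codebookLaw_not_secret (P : ℝ≥0) (p : ∀ i, Measure (Fin (S.L i) → 𝕜))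
    [∀ i, IsProbabilityMeasure (p i)] (e : Eavesdropper) (R Rl : Fin 2 → ℝ)
    (hRl : ∀ i, 0 ≤ Rl i)
    (hI : ∀ i, mutualInfo (Measure.pi p) (S.useKernel P e) ≤ ENNReal.ofReal (Rl i))
    {ε : ℝ} (hε : 0 < ε) :
    Tendsto (fun n : ℕ => S.codebookLaw p n (fun i => size n (R i)) (fun i => size n (Rl i))
      {cb | ¬ S.Secret P cb ε e}) atTop (𝓝 0) := by
  have hl2 : 0 < Real.log 2 := Real.log_pos one_lt_two
  have hK : ∀ n i, NeZero (size n (R i)) := fun n i => ⟨(size_pos n (R i)).ne'⟩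
  have hB : ∀ n i, NeZero (size n (Rl i)) := fun n i => ⟨(size_pos n (Rl i)).ne'⟩
  set D := klDiv (Measure.pi p ⊗ₘ S.useKernel P e)
    ((Measure.pi p).prod (S.useKernel P e ∘ₘ Measure.pi p)) with hD
  have hDle : ∀ i, D ≤ ENNReal.ofReal (Rl i * Real.log 2) := by
    intro i
    have h := hI i
    rw [mutualInfo, ENNReal.div_le_iff (by simpa using hl2) ENNReal.ofReal_ne_top,
      ← ENNReal.ofReal_mul (hRl i)] at h
    exact h
  have hDtop : D ≠ ∞ := ((hDle 0).trans_lt ENNReal.ofReal_lt_top).ne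
  obtain ⟨f, hf⟩ := IsChannelDensity.exists_of_klDiv_ne_top hDtop
  -- the length of the diagonals in the rectangle of pairs of codeword indices
  let b : ℕ → ℕ := fun n => min (size n (Rl 0)) (size n (Rl 1))
  have hbpos : ∀ n, 0 < b n := fun n => lt_min (size_pos n _) (size_pos n _)
  have hb0 : ∀ n, NeZero (b n) := fun n => ⟨(hbpos n).ne'⟩
  have hbB : ∀ n i, b n ≤ size n (Rl i) := fun n i => by
    fin_cases i
    · exact min_le_left _ _
    · exact min_le_right _ _
  have hblog : ∀ n : ℕ, n * D.toReal ≤ Real.log (b n) := by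
    intro n
    have h : ∀ i, n * D.toReal ≤ Real.log (size n (Rl i)) := fun i => by
      have h1 := ENNReal.toReal_le_of_le_ofReal (mul_nonneg (hRl i) hl2.le) (hDle i)
      refine le_trans ?_ (mul_log_two_le_log_size n (Rl i))
      gcongr
    rcases min_choice (size n (Rl 0)) (size n (Rl 1)) with h' | h' <;>
      simp only [b, h'] <;> exact h _
  rw [hD, ← hf.integral_log hDtop] at hblog
  have hΛ := tendsto_lintegral_log_one_add_prod (Measure.pi p ⊗ₘ S.useKernel P e) hf.measurable
    hf.ae_pos (hf.integrable_log hDtop) hbpos hblog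
  have hlim := ENNReal.Tendsto.div_const (b := ENNReal.ofReal (ε * Real.log 2)) hΛ
    (Or.inr (by simpa using mul_pos hε hl2))
  rw [ENNReal.zero_div] at hlim
  refine tendsto_of_tendsto_of_tendsto_of_le_of_le' tendsto_const_nhds hlim
    (Eventually.of_forall fun _ => zero_le) ?_
  filter_upwards [eventually_gt_atTop 0] with n hn
  have hn' : (0 : ℝ) < n := by exact_mod_cast hn
  obtain ⟨F, hFm, hFint, hF⟩ := S.exists_leakage_bound P e p hf n
    (K := fun i => size n (R i)) (hbB n)
  have hc : 0 < n * (ε * Real.log 2) := by positivity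
  -- Markov's inequality for the bound `F` on the divergence
  refine (measure_mono_ae (t := {cb | ENNReal.ofReal (n * (ε * Real.log 2)) ≤ F cb}) ?_).trans
    ((meas_ge_le_lintegral_div hFm.aemeasurable (ENNReal.ofReal_pos.2 hc).ne'
      ENNReal.ofReal_ne_top).trans ?_)
  · filter_upwards [hF] with cb hcb hns
    exact (S.le_of_not_secret hn hns).trans hcb
  · rw [ENNReal.ofReal_mul hn'.le, ENNReal.ofReal_natCast, div_eq_mul_inv, div_eq_mul_inv,
      div_eq_mul_inv, ENNReal.mul_inv (Or.inr ENNReal.ofReal_ne_top)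
        (Or.inl (ENNReal.natCast_ne_top n)), ← mul_assoc]
    gcongr
    exact hFint

/-- Secrecy from any family of eavesdroppers with a bounded number of antennas, because such
eavesdroppers are of finitely many kinds. -/
theorem tendsto_codebookLaw_not_forall_secret (P : ℝ≥0) (p : ∀ i, Measure (Fin (S.L i) → 𝕜))
    [∀ i, IsProbabilityMeasure (p i)] {ι : Type*} (eve : ι → Eavesdropper) {N : ℕ}
    (hN : ∀ j, (eve j).antennas ≤ N) (R Rl : Fin 2 → ℝ) (hRl : ∀ i, 0 ≤ Rl i)
    (hI : ∀ j i, mutualInfo (Measure.pi p) (S.useKernel P (eve j)) ≤ ENNReal.ofReal (Rl i))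
    {ε : ℝ} (hε : 0 < ε) :
    Tendsto (fun n : ℕ => S.codebookLaw p n (fun i => size n (R i)) (fun i => size n (Rl i))
      {cb | ¬ ∀ j, S.Secret P cb ε (eve j)}) atTop (𝓝 0) := by
  have hfin : (Set.range eve).Finite := by
    refine ((Set.finite_Iic N).prod (Set.finite_univ (α := Bool))).preimage
      (f := fun e : Eavesdropper => (e.antennas, e.knowsChannel)) ?_ |>.subset ?_
    · rintro ⟨_, _⟩ - ⟨_, _⟩ - h
      simpa using h
    · rintro _ ⟨j, rfl⟩
      exact ⟨hN j, Set.mem_univ _⟩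
  have hsum : Tendsto (fun n : ℕ => ∑ e ∈ hfin.toFinset,
      S.codebookLaw p n (fun i => size n (R i)) (fun i => size n (Rl i))
        {cb | ¬ S.Secret P cb ε e}) atTop (𝓝 0) := by
    rw [← Finset.sum_const_zero (s := hfin.toFinset)]
    refine tendsto_finsetSum _ fun e he => ?_
    obtain ⟨j, rfl⟩ := hfin.mem_toFinset.1 he
    exact S.tendsto_codebookLaw_not_secret P p (eve j) R Rl hRl (hI j) hε
  refine tendsto_of_tendsto_of_tendsto_of_le_of_le tendsto_const_nhds hsum
    (fun _ => zero_le) fun n => ?_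
  refine (measure_mono ?_).trans (measure_biUnion_finset_le _ _)
  intro cb hcb
  obtain ⟨j, hj⟩ := not_forall.1 hcb
  exact Set.mem_biUnion (hfin.mem_toFinset.2 ⟨j, rfl⟩) hj

end System

end JammedMAC

theorem proposition1 {𝕜 : Type*} [RCLike 𝕜] (S : JammedMAC.System 𝕜)
    (N_E : ℕ) (hN_E : S.J 0 + S.J 1 = N_E) :
    -- the rate about the legitimate signals is bounded by a constant independent of the power
    (JammedMAC.LogRegular S.fading →
      ∃ C : ℝ≥0, ∀ (P : ℝ≥0) (e : JammedMAC.Eavesdropper), e.antennas ≤ N_E →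
        S.signalRate P e ≤ C) ∧
    -- every eavesdropper gets zero degrees of freedom
    (∀ e : JammedMAC.Eavesdropper, e.antennas ≤ N_E →
      JammedMAC.System.ZeroDoF (fun P => S.signalRate P e) ∧
      JammedMAC.System.ZeroDoF (fun P => S.messageRate P e)) ∧
    -- Wyner codes whose randomness exceeds the leakage meet the secrecy constraint
    (∀ (P : ℝ≥0) (p : ∀ i, Measure (Fin (S.L i) → 𝕜)) (_ : ∀ i, IsProbabilityMeasure (p i))
      (_ : ∀ i, ∫⁻ s, S.energy P i s ∂(p i) ≤ P)
      {ι : Type} (eve : ι → JammedMAC.Eavesdropper) (_ : ∀ j, (eve j).antennas ≤ N_E)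
      (R Rl : Fin 2 → ℝ) (_ : ∀ i, 0 ≤ R i) (_ : ∀ i, 0 ≤ Rl i)
      (_ : ∀ j i, JammedMAC.mutualInfo (Measure.pi p) (S.useKernel P (eve j)) ≤
        ENNReal.ofReal (Rl i))
      (ε : ℝ) (_ : 0 < ε),
      Tendsto (fun n : ℕ =>
        S.codebookLaw p n (fun i => JammedMAC.System.size n (R i))
            (fun i => JammedMAC.System.size n (Rl i))
          {cb | ¬ ∀ j, S.Secret P cb ε (eve j)}) atTop (𝓝 0)) := by
  have hcard : Fintype.card S.Stream = N_E := by
    rw [← hN_E]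
    simp [JammedMAC.System.Stream, Fintype.card_sigma, Fin.sum_univ_two]
  subst hcard
  exact ⟨S.exists_signalRate_le, S.zeroDoF,
    fun P p _ _ _ eve heve R Rl _ hRl hI ε hε =>
      S.tendsto_codebookLaw_not_forall_secret P p eve heve R Rl hRl hI hε⟩
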